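/- All vector spaces are over $\mathbb Q$, $(-)^\vee=\mathrm{Hom}(-,\mathbb Q)$, and $\land V$ is the free graded commutative algebra on a graded vector space $V$. A minimal Sullivan algebra is a commutative differential graded algebra $(\land V,d)$ with $V=V^{\ge 1}$, $d:V\to\land^{\ge 2}V$, and $V=\bigcup_n V(n)$, where $V(0)=V\cap\ker d$ and $V(n+1)=V\cap d^{-1}(\land V(n))$; write $d_1v$ for the component of $dv$ in $\land^2V$. *Homotopy Lie algebra.* $L_V$ is given by $s:(L_V)_p\cong (V^{p+1})^\vee$ and $\langle v,s[x,y]\rangle=(-1)^{\deg y+1}\langle d_1v,sx,sy\rangle$, where $\langle vw,sx,sy\rangle=\langle v,sy\rangle\langle w,sx\rangle+(-1)^{\deg v\deg w}\langle w,sy\rangle\langle v,sx\rangle$. Let $\mathcal I_V=\{V_\alpha\}$ be the family of finite dimensional graded subspaces of $V$ for which $\land V_\alpha$ is preserved by $d$, and let $L_\alpha$ be the homotopy Lie algebra of $\land V_\alpha$, a quotient of $L_V$, with universal enveloping algebra $UL_\alpha$ and augmentation ideal $I_\alpha$. Then $L_V=\varprojlim_\alpha L_\alpha$; put $$\overline{UL_V}=\varprojlim_\alpha\varprojlim_n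 UL_\alpha/I_\alpha^n,\qquad L_V^{(r)}=\varprojlim_\alpha L_\alpha^r\subset L_V\quad(r\ge 1),$$ where $L_\alpha^r$ is the linear span of the iterated commutators of length $r$ in $L_\alpha$. "Continuous" refers to the inverse limit topology of $\overline{UL_V}$: a representation on $M=L_Z$ or on a dual $M=N^\vee$ (resp. on $M=H(\land Z)$) is continuous if for each $z\in Z$ or $z\in N$ (resp. each $z\in M$) there are $\alpha,n$ such that every $a$ with zero component in $UL_\alpha/I_\alpha^n$ satisfies $\langle z,y\cdot a\rangle=0$ for all $y\in M$ (resp. $a\cdot z=0$). *$\Lambda$-extensions.* Let $\land V$ be a minimal Sullivan algebra and let $(\land W,d)=\land V\otimes\land Z$, $W=V\oplus Z$, be a $\Lambda$-extension of it: $\land V$ is a sub differential graded algebra and $Z$ is an increasing union of subspaces $Z(k)$, $k\ge0$, with $d:Z(0)\to\land V$ and $d:Z(k+1)\to\land V\otimes\land Z(k)$. Let $(\land Z,\bar d)=\mathbb Q\otimes_{\land V}\land W$. Assume that $\land W$ is itself a minimal Sullivan algebra; then so is $\land Z$, and $0\leftarrow L_V\leftarrow L_W\leftarrow L_Z\leftarrow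 0$ identifies $L_Z$ with an ideal of $L_W$. Then there are: a unique continuous right representation $ad_R$ of $\overline{UL_W}$ in $L_Z$ in which $x\in L_W$ acts by $y\mapsto[y,x]$ (the right adjoint representation); and a unique continuous representation of $\overline{UL_V}$ in $H(\land Z)$ in which $x\in L_V$ acts by $-\sum_i\langle v_i,sx\rangle H(\theta_i)$ (the holonomy representation), where $(v_i)$ is a basis of $V$ and $d(1\otimes\Phi)=1\otimes\bar d\Phi+\sum_i v_i\otimes\theta_i\Phi+\Omega$ with $\Omega\in\land^{\ge2}V\otimes\land Z$. Both are compatible with degrees: $a$ of degree $p$ raises degrees in $L_Z$ by $p$ and lowers degrees in $H(\land Z)$ by $p$. Moreover: (i) each $L_Z^{(r)}$, $r\ge1$, is a sub right $\overline{UL_W}$-module of $L_Z$; (ii) the surjection $L_W\to L_V$ extends to a unique continuous morphism of algebras $\pi:\overline{UL_W}\to\overline{UL_V}$; it preserves degrees and is surjective, also in each degree; (iii) for $r\ge1$ the quotient right representation of $\overline{UL_W}$ in $L_Z^{(r)}/L_Z^{(r+1)}$ factors through $\pi$ to yield a right representation of $\overline{UL_V}$; (iv) $H^{\ge1}(\land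 Z)$ is stable under the holonomy representation, and division by $\land^{\ge2}Z$ induces a linear map $\xi:H^{\ge1}(\land Z)\to Z$; the map $y\mapsto sy\circ\xi$ vanishes on $L_Z^{(2)}$, and the resulting Hurewicz map $\xi^\vee:L_Z/L_Z^{(2)}\to H^{\ge1}(\land Z)^\vee$ is a morphism of right $\overline{UL_V}$-modules. Here $\overline{UL_V}$ acts on the left hand side as in (iii) with $r=1$, and on the right hand side by the continuous dual of the holonomy representation, $\langle m,f\cdot a\rangle=(-1)^{\deg a}\langle a\cdot m,f\rangle$. -/

import Mathlib

open scoped DirectSum TensorProduct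

noncomputable section

namespace SullivanRep

/-! ### Graded vector spaces and free graded commutative algebras

A graded rational vector space is a family `V : ℕ → Type*`; its total space is `⨁ i, V i`. -/

section FreeCGA

variable (V : ℕ → Type*) [∀ i, AddCommGroup (V i)] [∀ i, Module ℚ (V i)]

/-- The relations `v w = (-1)^(i j) w v` for `v` of degree `i` and `w` of degree `j`. -/
inductive CommRel : TensorAlgebra ℚ (⨁ i, V i) → TensorAlgebra ℚ (⨁ i, V i) → Prop
  | comm (i j : ℕ) (v : V i) (w : V j) :
      CommRel
        (TensorAlgebra.ι ℚ (DirectSum.lof ℚ ℕ V i v) * TensorAlgebra.ι ℚ (DirectSum.lof ℚ ℕ V j w))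
        ((-1 : ℚ) ^ (i * j) •
          (TensorAlgebra.ι ℚ (DirectSum.lof ℚ ℕ V j w) *
            TensorAlgebra.ι ℚ (DirectSum.lof ℚ ℕ V i v)))

/-- The free graded commutative algebra `⋀V` on the graded vector space `V`. -/
def FreeCGA : Type _ := RingQuot (CommRel V)

instance : Ring (FreeCGA V) := inferInstanceAs (Ring (RingQuot (CommRel V)))
instance : Algebra ℚ (FreeCGA V) := inferInstanceAs (Algebra ℚ (RingQuot (CommRel V)))

namespace FreeCGA

/-- The inclusion `V → ⋀V` of the generators. -/
def ι : (⨁ i, V i) →ₗ[ℚ] FreeCGA V :=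
  (RingQuot.mkAlgHom ℚ (CommRel V)).toLinearMap ∘ₗ TensorAlgebra.ι ℚ

/-- A homogeneous generator, `v ∈ V i`, as an element of `⋀V`. -/
def gen (i : ℕ) : V i →ₗ[ℚ] FreeCGA V := ι V ∘ₗ DirectSum.lof ℚ ℕ V i

theorem gen_mul_gen (i j : ℕ) (v : V i) (w : V j) :
    gen V i v * gen V j w = (-1 : ℚ) ^ (i * j) • (gen V j w * gen V i v) := by
  have h := RingQuot.mkAlgHom_rel ℚ (CommRel.comm i j v w)
  simp only [map_mul, map_smul] at h
  exact h

variable {V}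

/-- The universal property: a linear map on generators whose values satisfy the graded
commutation relations extends to an algebra morphism. -/
def lift {A : Type*} [Semiring A] [Algebra ℚ A] (f : (⨁ i, V i) →ₗ[ℚ] A)
    (hf : ∀ (i j : ℕ) (v : V i) (w : V j),
      f (DirectSum.lof ℚ ℕ V i v) * f (DirectSum.lof ℚ ℕ V j w) =
        (-1 : ℚ) ^ (i * j) •
          (f (DirectSum.lof ℚ ℕ V j w) * f (DirectSum.lof ℚ ℕ V i v))) :
    FreeCGA V →ₐ[ℚ] A :=
  RingQuot.liftAlgHom ℚ ⟨TensorAlgebra.lift ℚ f, by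
    rintro _ _ ⟨i, j, v, w⟩
    simp only [map_mul, map_smul, TensorAlgebra.lift_ι_apply]
    exact hf i j v w⟩

theorem lift_ι {A : Type*} [Semiring A] [Algebra ℚ A] (f : (⨁ i, V i) →ₗ[ℚ] A) (hf) (v : ⨁ i, V i) :
    lift f hf (ι V v) = f v := by
  have : lift f hf (ι V v) = TensorAlgebra.lift ℚ f (TensorAlgebra.ι ℚ v) :=
    RingQuot.liftAlgHom_mkAlgHom_apply ℚ _ _ _
  rw [this, TensorAlgebra.lift_ι_apply]

variable (V)

/-- The augmentation `⋀V → ℚ` vanishing on `V`. -/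
def aug : FreeCGA V →ₐ[ℚ] ℚ := lift 0 (by intros; simp)

/-- The subspace of `⋀V` of elements of (cohomological) degree `n`. -/
def deg (n : ℕ) : Submodule ℚ (FreeCGA V) :=
  Submodule.span ℚ {a | ∃ l : List (Σ i, V i),
    (l.map Sigma.fst).sum = n ∧ a = (l.map fun p => gen V p.1 p.2).prod}

/-- The subspace `⋀^{≥ p} V` spanned by the monomials of length at least `p`. -/
def wedgeGE (p : ℕ) : Submodule ℚ (FreeCGA V) :=
  ⨆ q : ℕ, ⨆ _ : p ≤ q, LinearMap.range (ι V) ^ q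

variable {V}

/-- The subalgebra `⋀S ⊆ ⋀V` generated by a subset `S` of the total space of `V`. -/
def sub (S : Set (⨁ i, V i)) : Subalgebra ℚ (FreeCGA V) :=
  Algebra.adjoin ℚ (ι V '' S)

/-- The algebra morphism `⋀V → ⋀W` induced by a degree zero linear map `V → W`. -/
def map {W : ℕ → Type*} [∀ i, AddCommGroup (W i)] [∀ i, Module ℚ (W i)]
    (f : ∀ i, V i →ₗ[ℚ] W i) : FreeCGA V →ₐ[ℚ] FreeCGA W :=
  lift (ι W ∘ₗ DirectSum.lmap f) (by
    intro i j v w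
    simp only [LinearMap.comp_apply, DirectSum.lmap_lof]
    exact gen_mul_gen W i j (f i v) (f j w))

end FreeCGA

/-- The degree involution `v ↦ (-1)^{deg v} v` of the total space of `V`. -/
def sgn : (⨁ i, V i) →ₗ[ℚ] ⨁ i, V i :=
  DirectSum.lmap fun i => (-1 : ℚ) ^ i • (LinearMap.id : V i →ₗ[ℚ] V i)

end FreeCGA

/-! ### Linear and quadratic components -/

section Components

variable {V Z W : ℕ → Type*}
  [∀ i, AddCommGroup (V i)] [∀ i, Module ℚ (V i)]
  [∀ i, AddCommGroup (Z i)] [∀ i, Module ℚ (Z i)]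
  [∀ i, AddCommGroup (W i)] [∀ i, Module ℚ (W i)]

theorem sgn_lof (i : ℕ) (v : V i) :
    sgn V (DirectSum.lof ℚ ℕ V i v) = (-1 : ℚ) ^ i • DirectSum.lof ℚ ℕ V i v := by
  simp [sgn]

/-- Given `p : W → V` and `q : W → Z`, a generator `w ∈ W` of degree `i` acts on
`⋀Z ⊕ (V ⊗ ⋀Z)` by
`w · (Φ, v ⊗ Ψ) = (q w Φ, p w ⊗ Φ + (-1)^{i deg v} v ⊗ q w Ψ)`. -/
def splitAct (p : ∀ i, W i →ₗ[ℚ] V i) (q : ∀ i, W i →ₗ[ℚ] Z i) (i : ℕ) :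
    W i →ₗ[ℚ] Module.End ℚ (FreeCGA Z × ((⨁ i, V i) ⊗[ℚ] FreeCGA Z)) where
  toFun w := LinearMap.prod
    (LinearMap.mulLeft ℚ (FreeCGA.gen Z i (q i w)) ∘ₗ LinearMap.fst ℚ _ _)
    (TensorProduct.mk ℚ _ _ (DirectSum.lof ℚ ℕ V i (p i w)) ∘ₗ LinearMap.fst ℚ _ _ +
      TensorProduct.map (sgn V ^ i) (LinearMap.mulLeft ℚ (FreeCGA.gen Z i (q i w))) ∘ₗ
        LinearMap.snd ℚ _ _)
  map_add' a b := by
    refine LinearMap.ext fun x => ?_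
    refine Prod.ext ?_ ?_
    · simp [add_mul]
    · have : LinearMap.mulLeft ℚ (FreeCGA.gen Z i (q i a) + FreeCGA.gen Z i (q i b)) =
          LinearMap.mulLeft ℚ (FreeCGA.gen Z i (q i a)) +
            LinearMap.mulLeft ℚ (FreeCGA.gen Z i (q i b)) := by
        ext; simp [add_mul]
      simp [this, TensorProduct.map_add_right]
      abel
  map_smul' c a := by
    refine LinearMap.ext fun x => ?_
    refine Prod.ext ?_ ?_
    · simp
    · have : LinearMap.mulLeft ℚ (c • FreeCGA.gen Z i (q i a)) =
          c • LinearMap.mulLeft ℚ (FreeCGA.gen Z i (q i a)) := by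
        ext; simp
      simp [this, TensorProduct.map_smul_right, TensorProduct.smul_tmul']

theorem splitAct_comm (p : ∀ i, W i →ₗ[ℚ] V i) (q : ∀ i, W i →ₗ[ℚ] Z i) (i j : ℕ)
    (a : W i) (b : W j) :
    splitAct p q i a * splitAct p q j b =
      (-1 : ℚ) ^ (i * j) • (splitAct p q j b * splitAct p q i a) := by
  have hpow : ∀ (m n : ℕ) (v : V n), (sgn V ^ m) (DirectSum.lof ℚ ℕ V n v) =
      (-1 : ℚ) ^ (m * n) • DirectSum.lof ℚ ℕ V n v := by
    intro m n v
    induction m with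
    | zero => simp
    | succ m ih =>
      rw [pow_succ', Module.End.mul_apply, ih, map_smul, sgn_lof, smul_smul, ← pow_add]
      congr 2; ring
  have hg := FreeCGA.gen_mul_gen Z i j (q i a) (q j b)
  have hs : (-1 : ℚ) ^ (i * j) * (-1 : ℚ) ^ (i * j) = 1 := by
    rw [← mul_pow]; simp
  refine LinearMap.ext fun x => ?_
  obtain ⟨Φ, t⟩ := x
  refine Prod.ext ?_ ?_
  · simp only [splitAct, Module.End.mul_apply, LinearMap.coe_mk, AddHom.coe_mk,
      LinearMap.prod_apply, LinearMap.smul_apply, Function.prod_apply, LinearMap.comp_apply,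
      LinearMap.fst_apply, LinearMap.mulLeft_apply, Prod.smul_fst]
    rw [← mul_assoc, hg, smul_mul_assoc, mul_assoc]
  · have ht : TensorProduct.map (sgn V ^ i) (LinearMap.mulLeft ℚ (FreeCGA.gen Z i (q i a)))
          (TensorProduct.map (sgn V ^ j) (LinearMap.mulLeft ℚ (FreeCGA.gen Z j (q j b))) t) =
        (-1 : ℚ) ^ (i * j) •
          TensorProduct.map (sgn V ^ j) (LinearMap.mulLeft ℚ (FreeCGA.gen Z j (q j b)))
          (TensorProduct.map (sgn V ^ i) (LinearMap.mulLeft ℚ (FreeCGA.gen Z i (q i a))) t) := by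
      induction t using TensorProduct.induction_on with
      | zero => simp
      | add t₁ t₂ h₁ h₂ => simp only [map_add, smul_add, h₁, h₂]
      | tmul v Ψ =>
        simp only [TensorProduct.map_tmul, LinearMap.mulLeft_apply]
        rw [← Module.End.mul_apply, ← Module.End.mul_apply, ← pow_add, ← pow_add, add_comm j i,
          ← mul_assoc, hg, smul_mul_assoc, mul_assoc, TensorProduct.tmul_smul]
    simp only [splitAct, Module.End.mul_apply, LinearMap.coe_mk, AddHom.coe_mk,
      LinearMap.prod_apply, LinearMap.smul_apply, Function.prod_apply, LinearMap.comp_apply,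
      LinearMap.fst_apply, LinearMap.snd_apply, LinearMap.mulLeft_apply, LinearMap.add_apply,
      TensorProduct.mk_apply, map_add, TensorProduct.map_tmul, hpow, Prod.smul_snd, smul_add,
      ht, ← TensorProduct.smul_tmul', smul_smul]
    rw [mul_comm j i, hs, one_smul]
    abel

/-- The action of all generators on `⋀Z ⊕ (V ⊗ ⋀Z)`. -/
def splitGen (p : ∀ i, W i →ₗ[ℚ] V i) (q : ∀ i, W i →ₗ[ℚ] Z i) :
    (⨁ i, W i) →ₗ[ℚ] Module.End ℚ (FreeCGA Z × ((⨁ i, V i) ⊗[ℚ] FreeCGA Z)) :=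
  DirectSum.toModule ℚ ℕ _ (splitAct p q)

theorem splitGen_lof (p : ∀ i, W i →ₗ[ℚ] V i) (q : ∀ i, W i →ₗ[ℚ] Z i) (i : ℕ) (w : W i) :
    splitGen p q (DirectSum.lof ℚ ℕ W i w) = splitAct p q i w := by
  rw [splitGen, DirectSum.toModule_lof]

theorem splitGen_comm (p : ∀ i, W i →ₗ[ℚ] V i) (q : ∀ i, W i →ₗ[ℚ] Z i) (i j : ℕ)
    (v : W i) (w : W j) :
    splitGen p q (DirectSum.lof ℚ ℕ W i v) * splitGen p q (DirectSum.lof ℚ ℕ W j w) =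
      (-1 : ℚ) ^ (i * j) • (splitGen p q (DirectSum.lof ℚ ℕ W j w) *
        splitGen p q (DirectSum.lof ℚ ℕ W i v)) := by
  rw [splitGen_lof, splitGen_lof]
  exact splitAct_comm p q i j v w

/-- The resulting action of `⋀W` on `⋀Z ⊕ (V ⊗ ⋀Z)`. -/
def splitHom (p : ∀ i, W i →ₗ[ℚ] V i) (q : ∀ i, W i →ₗ[ℚ] Z i) :
    FreeCGA W →ₐ[ℚ] Module.End ℚ (FreeCGA Z × ((⨁ i, V i) ⊗[ℚ] FreeCGA Z)) :=
  FreeCGA.lift (splitGen p q) (splitGen_comm p q)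

/-- For `W = V ⊕ Z` with its projections `p` and `q`, this is the projection of
`⋀W = ⋀V ⊗ ⋀Z` onto the summand `⋀¹V ⊗ ⋀Z`. For `V = Z = W` and `p = q = id` it is the map
`w₁ ⋯ wₖ ↦ ∑ ± wᵢ ⊗ w₁ ⋯ ŵᵢ ⋯ wₖ`, with the Koszul signs of `w₁ ⋯ wₖ = ± wᵢ w₁ ⋯ ŵᵢ ⋯ wₖ`. -/
def split (p : ∀ i, W i →ₗ[ℚ] V i) (q : ∀ i, W i →ₗ[ℚ] Z i) :
    FreeCGA W →ₗ[ℚ] (⨁ i, V i) ⊗[ℚ] FreeCGA Z where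
  toFun a := (splitHom p q a (1, 0)).2
  map_add' a b := by simp
  map_smul' c a := by simp

variable (V)

/-- The linear component `⋀V → V`, i.e. the projection onto `⋀¹V = V` along the `⋀^pV`, `p ≠ 1`;
on `⋀^{≥1}V` it is division by `⋀^{≥2}V`. -/
def lin : FreeCGA V →ₗ[ℚ] ⨁ i, V i :=
  (TensorProduct.rid ℚ _).toLinearMap ∘ₗ
    TensorProduct.map LinearMap.id (FreeCGA.aug V).toLinearMap ∘ₗ
      split (fun _ => LinearMap.id) (fun _ => LinearMap.id)

/-- The quadratic component `⋀V → V ⊗ V`: it kills `⋀^pV`, `p ≠ 2`, and maps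
`v w ↦ v ⊗ w + (-1)^{deg v deg w} w ⊗ v`. -/
def quad : FreeCGA V →ₗ[ℚ] (⨁ i, V i) ⊗[ℚ] ⨁ i, V i :=
  TensorProduct.map LinearMap.id (lin V) ∘ₗ
    split (fun _ => LinearMap.id) (fun _ => LinearMap.id)

end Components

/-! ### Sullivan algebras and Λ-extensions -/

section Sullivan

variable {V Z : ℕ → Type*}
  [∀ i, AddCommGroup (V i)] [∀ i, Module ℚ (V i)]
  [∀ i, AddCommGroup (Z i)] [∀ i, Module ℚ (Z i)]

/-- The filtration `V(0) = V ∩ ker d`, `V(n+1) = V ∩ d⁻¹(⋀V(n))` of `V`. -/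
def sullivanFiltration (d : FreeCGA V →ₗ[ℚ] FreeCGA V) : ℕ → Submodule ℚ (⨁ i, V i)
  | 0 => LinearMap.ker (d ∘ₗ FreeCGA.ι V)
  | n + 1 => (Subalgebra.toSubmodule
      (FreeCGA.sub (sullivanFiltration d n : Set (⨁ i, V i)))).comap (d ∘ₗ FreeCGA.ι V)

/-- `(⋀V, d)` is a minimal Sullivan algebra: a commutative differential graded algebra with
`V = V^{≥1}`, satisfying the Sullivan condition, and such that `d : V → ⋀^{≥2}V`. -/
structure IsMinimalSullivan (d : FreeCGA V →ₗ[ℚ] FreeCGA V) : Prop where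
  connected : Subsingleton (V 0)
  degree : ∀ n, ∀ a ∈ FreeCGA.deg V n, d a ∈ FreeCGA.deg V (n + 1)
  leibniz : ∀ n, ∀ a ∈ FreeCGA.deg V n, ∀ b, d (a * b) = d a * b + (-1 : ℚ) ^ n • (a * d b)
  square_zero : ∀ a, d (d a) = 0
  sullivan : ∀ v, ∃ n, v ∈ sullivanFiltration d n
  minimal : ∀ v, d (FreeCGA.ι V v) ∈ FreeCGA.wedgeGE V 2

/-- The inclusion `V → V ⊕ Z`. -/
abbrev inV (V Z : ℕ → Type*) [∀ i, AddCommGroup (V i)] [∀ i, Module ℚ (V i)]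
    [∀ i, AddCommGroup (Z i)] [∀ i, Module ℚ (Z i)] (i : ℕ) : V i →ₗ[ℚ] V i × Z i :=
  LinearMap.inl ℚ (V i) (Z i)

/-- The inclusion `Z → V ⊕ Z`. -/
abbrev inZ (V Z : ℕ → Type*) [∀ i, AddCommGroup (V i)] [∀ i, Module ℚ (V i)]
    [∀ i, AddCommGroup (Z i)] [∀ i, Module ℚ (Z i)] (i : ℕ) : Z i →ₗ[ℚ] V i × Z i :=
  LinearMap.inr ℚ (V i) (Z i)

/-- The projection `V ⊕ Z → V`. -/
abbrev prV (V Z : ℕ → Type*) [∀ i, AddCommGroup (V i)] [∀ i, Module ℚ (V i)]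
    [∀ i, AddCommGroup (Z i)] [∀ i, Module ℚ (Z i)] (i : ℕ) : V i × Z i →ₗ[ℚ] V i :=
  LinearMap.fst ℚ (V i) (Z i)

/-- The projection `V ⊕ Z → Z`. -/
abbrev prZ (V Z : ℕ → Type*) [∀ i, AddCommGroup (V i)] [∀ i, Module ℚ (V i)]
    [∀ i, AddCommGroup (Z i)] [∀ i, Module ℚ (Z i)] (i : ℕ) : V i × Z i →ₗ[ℚ] Z i :=
  LinearMap.snd ℚ (V i) (Z i)

/-- `(⋀(V ⊕ Z), dW) = (⋀V ⊗ ⋀Z, dW)` is a Λ-extension of `(⋀V, dV)`: the inclusion of `⋀V`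
commutes with the differentials, and `Z` is the union of an increasing sequence of subspaces
`Z(k)` with `d : Z(0) → ⋀V` and `d : Z(k+1) → ⋀V ⊗ ⋀Z(k)`. -/
structure IsLambdaExtension (dV : FreeCGA V →ₗ[ℚ] FreeCGA V)
    (dW : FreeCGA (fun i => V i × Z i) →ₗ[ℚ] FreeCGA (fun i => V i × Z i)) : Prop where
  comm : ∀ a, dW (FreeCGA.map (inV V Z) a) = FreeCGA.map (inV V Z) (dV a)
  filtration : ∃ F : ℕ → Submodule ℚ (⨁ i, Z i), Monotone F ∧ (∀ z, ∃ k, z ∈ F k) ∧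
    (∀ z ∈ F 0, dW (FreeCGA.ι _ (DirectSum.lmap (inZ V Z) z)) ∈
      FreeCGA.sub (Set.range (DirectSum.lmap (inV V Z)))) ∧
    ∀ k, ∀ z ∈ F (k + 1), dW (FreeCGA.ι _ (DirectSum.lmap (inZ V Z) z)) ∈
      FreeCGA.sub (Set.range (DirectSum.lmap (inV V Z)) ∪ DirectSum.lmap (inZ V Z) '' (F k))

/-- The differential of the quotient `⋀Z = ℚ ⊗_{⋀V} (⋀V ⊗ ⋀Z)`. -/
def quotDiff (dW : FreeCGA (fun i => V i × Z i) →ₗ[ℚ] FreeCGA (fun i => V i × Z i)) :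
    FreeCGA Z →ₗ[ℚ] FreeCGA Z :=
  (FreeCGA.map (prZ V Z)).toLinearMap ∘ₗ dW ∘ₗ (FreeCGA.map (inZ V Z)).toLinearMap

end Sullivan

/-! ### The homotopy Lie algebra

The homotopy Lie algebra `L_V` is the dual `Hom(V, ℚ)`, an element of degree `p` being a functional
that vanishes outside `V^{p+1}`; the suspension `s` is thus the identity, with degrees shifted.
The total space `Hom(V, ℚ)` is the product of its homogeneous parts. -/

section HomotopyLie

variable {V : ℕ → Type*} [∀ i, AddCommGroup (V i)] [∀ i, Module ℚ (V i)]

variable (V) in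
/-- The space underlying the homotopy Lie algebra `L_V`. -/
abbrev HLie : Type _ := Module.Dual ℚ (⨁ i, V i)

/-- The elements of degree `p` in `L_V`: the functionals concentrated on `V^{p+1}`. -/
def HLie.deg (p : ℕ) : Submodule ℚ (HLie V) where
  carrier := {x | ∀ i, i ≠ p + 1 → ∀ v : V i, x (DirectSum.lof ℚ ℕ V i v) = 0}
  zero_mem' := by intro i _ v; rfl
  add_mem' := by
    intro a b ha hb i hi v
    rw [LinearMap.add_apply, ha i hi v, hb i hi v, add_zero]
  smul_mem' := by
    intro c a ha i hi v
    rw [LinearMap.smul_apply, ha i hi v, smul_zero]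

/-- The Lie bracket of `L_V`, `⟨v, s[x,y]⟩ = (-1)^{deg y + 1} ⟨d₁ v, sx, sy⟩`, where
`⟨v w, sx, sy⟩ = ⟨v, sy⟩ ⟨w, sx⟩ + (-1)^{deg v deg w} ⟨w, sy⟩ ⟨v, sx⟩`; the sign
`(-1)^{deg y + 1}` is the degree involution of `V` followed by `sy`. Since `quad` only sees the
component in `⋀²V`, `d` may be written for `d₁`. -/
def HLie.bracket (d : FreeCGA V →ₗ[ℚ] FreeCGA V) (x y : HLie V) : HLie V :=
  LinearMap.mul' ℚ ℚ ∘ₗ TensorProduct.map (y ∘ₗ sgn V) x ∘ₗ quad V ∘ₗ d ∘ₗ FreeCGA.ι V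

/-- The finite dimensional graded subspaces `S ⊆ V` for which `⋀S` is preserved by `d`. -/
structure Idx (d : FreeCGA V →ₗ[ℚ] FreeCGA V) where
  carrier : Submodule ℚ (⨁ i, V i)
  finite : FiniteDimensional ℚ carrier
  homogeneous : ∀ v ∈ carrier, ∀ i, DirectSum.lof ℚ ℕ V i (v i) ∈ carrier
  stable : ∀ a ∈ FreeCGA.sub (carrier : Set (⨁ i, V i)),
    d a ∈ FreeCGA.sub (carrier : Set (⨁ i, V i))

variable {d : FreeCGA V →ₗ[ℚ] FreeCGA V}

/-- The space underlying the homotopy Lie algebra `L_S` of `⋀S`, for `S` in the index set. -/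
abbrev Idx.Lie (S : Idx d) : Type _ := Module.Dual ℚ S.1

/-- The surjection `ρ_S : L_V → L_S` dual to the inclusion. It is a morphism of Lie algebras, so
that the bracket of `L_S` is given by `[ρ_S x, ρ_S y] = ρ_S [x, y]`. -/
def Idx.res (S : Idx d) : HLie V →ₗ[ℚ] S.Lie := S.1.subtype.dualMap

/-- The dual `L_{S'} → L_S` of an inclusion `S ⊆ S'`. -/
def Idx.trans {S S' : Idx d} (h : S.1 ≤ S'.1) : S'.Lie →ₗ[ℚ] S.Lie :=
  (Submodule.inclusion h).dualMap

theorem Idx.trans_res {S S' : Idx d} (h : S.1 ≤ S'.1) (x : HLie V) :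
    Idx.trans h (S'.res x) = S.res x := rfl

/-- The lower central series of `L_S`: `L_S^1 = L_S` (also the value at the index `0`), and
`L_S^{r+1}` is the linear span of the `[x, y]` with `x ∈ L_S` and `y ∈ L_S^r`. -/
def Idx.lcs (S : Idx d) : ℕ → Submodule ℚ S.Lie
  | 0 => ⊤
  | 1 => ⊤
  | r + 2 => Submodule.span ℚ
      {z | ∃ x y : HLie V, S.res y ∈ Idx.lcs S (r + 1) ∧ z = S.res (HLie.bracket d x y)}

variable (d) in
/-- The Sullivan lower central series `L_V^{(r)} = lim_S L_S^r`, as a subspace of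
`L_V = lim_S L_S`. -/
def sullivanLCS (r : ℕ) : Submodule ℚ (HLie V) :=
  ⨅ S : Idx d, (S.lcs r).comap S.res

end HomotopyLie

/-! ### Enveloping algebras and the Sullivan completion -/

section Completion

variable {V : ℕ → Type*} [∀ i, AddCommGroup (V i)] [∀ i, Module ℚ (V i)]
  {d : FreeCGA V →ₗ[ℚ] FreeCGA V}

/-- The relations `x y - (-1)^{deg x deg y} y x = [x, y]` of the universal enveloping algebra
of the graded Lie algebra `L_S`. -/
inductive EnvRel (S : Idx d) : TensorAlgebra ℚ S.Lie → TensorAlgebra ℚ S.Lie → Prop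
  | bracket (p q : ℕ) (x y : HLie V) (hx : x ∈ HLie.deg p) (hy : y ∈ HLie.deg q) :
      EnvRel S
        (TensorAlgebra.ι ℚ (S.res x) * TensorAlgebra.ι ℚ (S.res y))
        ((-1 : ℚ) ^ (p * q) • (TensorAlgebra.ι ℚ (S.res y) * TensorAlgebra.ι ℚ (S.res x)) +
          TensorAlgebra.ι ℚ (S.res (HLie.bracket d x y)))

/-- The universal enveloping algebra `UL_S`. -/
def UEnv (S : Idx d) : Type _ := RingQuot (EnvRel S)

namespace UEnv

instance (S : Idx d) : Ring (UEnv S) := inferInstanceAs (Ring (RingQuot (EnvRel S)))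
instance (S : Idx d) : Algebra ℚ (UEnv S) := inferInstanceAs (Algebra ℚ (RingQuot (EnvRel S)))

/-- The canonical map `L_S → UL_S`. -/
def ι (S : Idx d) : S.Lie →ₗ[ℚ] UEnv S :=
  (RingQuot.mkAlgHom ℚ (EnvRel S)).toLinearMap ∘ₗ TensorAlgebra.ι ℚ

theorem ι_mul_ι (S : Idx d) (p q : ℕ) (x y : HLie V) (hx : x ∈ HLie.deg p)
    (hy : y ∈ HLie.deg q) :
    ι S (S.res x) * ι S (S.res y) = (-1 : ℚ) ^ (p * q) • (ι S (S.res y) * ι S (S.res x)) +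
      ι S (S.res (HLie.bracket d x y)) := by
  have h := RingQuot.mkAlgHom_rel ℚ (EnvRel.bracket (S := S) p q x y hx hy)
  simp only [map_mul, map_smul, map_add] at h
  exact h

/-- The universal property of `UL_S`. -/
def lift {S : Idx d} {A : Type*} [Semiring A] [Algebra ℚ A] (f : S.Lie →ₗ[ℚ] A)
    (hf : ∀ (p q : ℕ) (x y : HLie V), x ∈ HLie.deg p → y ∈ HLie.deg q →
      f (S.res x) * f (S.res y) = (-1 : ℚ) ^ (p * q) • (f (S.res y) * f (S.res x)) +
        f (S.res (HLie.bracket d x y))) :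
    UEnv S →ₐ[ℚ] A :=
  RingQuot.liftAlgHom ℚ ⟨TensorAlgebra.lift ℚ f, by
    rintro _ _ ⟨p, q, x, y, hx, hy⟩
    simp only [map_mul, map_smul, map_add, TensorAlgebra.lift_ι_apply]
    exact hf p q x y hx hy⟩

theorem lift_ι {S : Idx d} {A : Type*} [Semiring A] [Algebra ℚ A] (f : S.Lie →ₗ[ℚ] A) (hf)
    (x : S.Lie) : lift f hf (ι S x) = f x := by
  have : lift f hf (ι S x) = TensorAlgebra.lift ℚ f (TensorAlgebra.ι ℚ x) :=
    RingQuot.liftAlgHom_mkAlgHom_apply ℚ _ _ _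
  rw [this, TensorAlgebra.lift_ι_apply]

theorem hom_ext {S : Idx d} {A : Type*} [Semiring A] [Algebra ℚ A] {f g : UEnv S →ₐ[ℚ] A}
    (h : ∀ x, f (ι S x) = g (ι S x)) : f = g := by
  refine RingQuot.ringQuot_ext' ℚ f g ?_
  refine TensorAlgebra.hom_ext ?_
  exact LinearMap.ext h

/-- The augmentation `UL_S → ℚ`. -/
def aug (S : Idx d) : UEnv S →ₐ[ℚ] ℚ := lift 0 (by intros; simp)

/-- The augmentation ideal of `UL_S`, i.e. the ideal generated by `L_S`. -/
def augIdeal (S : Idx d) : Ideal (UEnv S) := RingHom.ker (aug S)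

instance (S : Idx d) : (augIdeal S).IsTwoSided :=
  inferInstanceAs (RingHom.ker (aug S)).IsTwoSided

/-- The morphism `UL_{S'} → UL_S` induced by `L_{S'} → L_S`, for `S ⊆ S'`. -/
def trans {S S' : Idx d} (h : S.1 ≤ S'.1) : UEnv S' →ₐ[ℚ] UEnv S :=
  lift (ι S ∘ₗ Idx.trans h) (by
    intro p q x y hx hy
    exact ι_mul_ι S p q x y hx hy)

theorem trans_ι {S S' : Idx d} (h : S.1 ≤ S'.1) (x : S'.Lie) :
    trans h (ι S' x) = ι S (Idx.trans h x) :=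
  lift_ι _ _ _

theorem aug_ι (S : Idx d) (x : S.Lie) : aug S (ι S x) = 0 := lift_ι _ _ _

theorem aug_trans {S S' : Idx d} (h : S.1 ≤ S'.1) (a : UEnv S') :
    aug S (trans h a) = aug S' a := by
  have : (aug S).comp (trans h) = aug S' := by
    refine hom_ext fun x => ?_
    rw [AlgHom.comp_apply, trans_ι, aug_ι, aug_ι]
  rw [← this, AlgHom.comp_apply]

theorem trans_mem_pow {S S' : Idx d} (h : S.1 ≤ S'.1) (n : ℕ) {a : UEnv S'}
    (ha : a ∈ augIdeal S' ^ n) : trans h a ∈ augIdeal S ^ n := by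
  induction n generalizing a with
  | zero => rw [Submodule.pow_zero, Ideal.one_eq_top]; exact Submodule.mem_top
  | succ n ih =>
    rw [Submodule.pow_succ] at ha ⊢
    refine Submodule.mul_induction_on ha ?_ ?_
    · intro b hb c hc
      rw [map_mul]
      refine Ideal.mul_mem_mul (ih hb) ?_
      have hc' : aug S' c = 0 := hc
      show aug S (trans h c) = 0
      rw [aug_trans, hc']
    · intro b c hb hc
      rw [map_add]
      exact add_mem hb hc

/-- The subspace of `UL_S` of elements of degree `p`. -/
def deg (S : Idx d) (p : ℕ) : Submodule ℚ (UEnv S) :=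
  Submodule.span ℚ {a | ∃ l : List (ℕ × HLie V), (∀ c ∈ l, c.2 ∈ HLie.deg c.1) ∧
    (l.map Prod.fst).sum = p ∧ a = (l.map fun c => ι S (S.res c.2)).prod}

end UEnv

/-- The quotient `UL_S / I^n` by the `n`-th power of the augmentation ideal. -/
abbrev UQuot (S : Idx d) (n : ℕ) : Type _ := UEnv S ⧸ UEnv.augIdeal S ^ n

/-- The maps `UL_{S'} / I^{n'} → UL_S / I^n` of the inverse system, for `S ⊆ S'`, `n ≤ n'`. -/
def UQuot.trans {S S' : Idx d} {n n' : ℕ} (h : S.1 ≤ S'.1) (hn : n ≤ n') :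
    UQuot S' n' →ₐ[ℚ] UQuot S n :=
  Ideal.Quotient.liftₐ (UEnv.augIdeal S' ^ n')
    ((Ideal.Quotient.mkₐ ℚ (UEnv.augIdeal S ^ n)).comp (UEnv.trans h)) (by
      intro a ha
      exact Ideal.Quotient.eq_zero_iff_mem.2
        (Ideal.pow_le_pow_right hn (UEnv.trans_mem_pow h n' ha)))

variable (d) in
/-- The Sullivan completion `lim_S lim_n UL_S / I^n` of `UL_V`. This total algebra is the product
of its homogeneous parts, the inverse limits taken degree by degree (`UBar.deg` below). -/
def UBar : Subalgebra ℚ (∀ (S : Idx d) (n : ℕ), UQuot S n) where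
  carrier := {a | ∀ (S S' : Idx d) (n n' : ℕ) (h : S.1 ≤ S'.1) (hn : n ≤ n'),
    UQuot.trans h hn (a S' n') = a S n}
  mul_mem' := by
    intro a b ha hb S S' n n' h hn
    simp only [Pi.mul_apply, map_mul, ha S S' n n' h hn, hb S S' n n' h hn]
  add_mem' := by
    intro a b ha hb S S' n n' h hn
    simp only [Pi.add_apply, map_add, ha S S' n n' h hn, hb S S' n n' h hn]
  algebraMap_mem' := by
    intro c S S' n n' h hn
    exact AlgHom.commutes _ c

/-- The canonical map from `L_V` to the Sullivan completion of `UL_V`. -/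
def UBar.ι : HLie V →ₗ[ℚ] UBar d where
  toFun x := ⟨fun S n => Ideal.Quotient.mkₐ ℚ (UEnv.augIdeal S ^ n) (UEnv.ι S (S.res x)), by
    intro S S' n n' h hn
    show Ideal.Quotient.mkₐ ℚ (UEnv.augIdeal S ^ n) (UEnv.trans h (UEnv.ι S' (S'.res x))) = _
    rw [UEnv.trans_ι]
    rfl⟩
  map_add' x y := by
    refine Subtype.ext (funext fun S => funext fun n => ?_)
    simp
  map_smul' c x := by
    refine Subtype.ext (funext fun S => funext fun n => ?_)
    simp

/-- The subspace of elements of degree `p` in the Sullivan completion of `UL_V`. -/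
def UBar.deg (p : ℕ) : Submodule ℚ (UBar d) where
  carrier := {a | ∀ (S : Idx d) (n : ℕ), a.1 S n ∈
    (UEnv.deg S p).map (Ideal.Quotient.mkₐ ℚ (UEnv.augIdeal S ^ n)).toLinearMap}
  zero_mem' := fun _ _ => Submodule.zero_mem _
  add_mem' := fun ha hb S n => Submodule.add_mem _ (ha S n) (hb S n)
  smul_mem' := fun c _ ha S n => Submodule.smul_mem _ c (ha S n)

end Completion

/-! ### Cohomology -/

section Cohomology

variable {V : ℕ → Type*} [∀ i, AddCommGroup (V i)] [∀ i, Module ℚ (V i)]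

/-- The cohomology `H(⋀V, d) = ker d / im d`. -/
abbrev Coh (d : FreeCGA V →ₗ[ℚ] FreeCGA V) : Type _ :=
  LinearMap.ker d ⧸ (LinearMap.range d).submoduleOf (LinearMap.ker d)

/-- The class of a cycle. -/
def Coh.mk (d : FreeCGA V →ₗ[ℚ] FreeCGA V) : LinearMap.ker d →ₗ[ℚ] Coh d :=
  ((LinearMap.range d).submoduleOf (LinearMap.ker d)).mkQ

/-- The cohomology `H^m(⋀V, d)`, as a subspace of `H(⋀V, d)`. -/
def Coh.deg (d : FreeCGA V →ₗ[ℚ] FreeCGA V) (m : ℕ) : Submodule ℚ (Coh d) :=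
  ((FreeCGA.deg V m).submoduleOf (LinearMap.ker d)).map (Coh.mk d)

/-- The subspace `H^{≥1}(⋀V, d)` of `H(⋀V, d)`. -/
def Coh.pos (d : FreeCGA V →ₗ[ℚ] FreeCGA V) : Submodule ℚ (Coh d) :=
  ⨆ m : ℕ, ⨆ _ : 1 ≤ m, Coh.deg d m

end Cohomology

/-! ### The representations attached to a Λ-extension

Representations of the complete algebra `UBar` are required to be continuous for the inverse limit
topology: this is what it means to be obtained from representations of the algebras `UL_S / I^n`
by passing to limits, and, `L_V` generating a dense subalgebra, a continuous representation is
determined by its restriction to `L_V`. Right representations of `A` are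
representations of the opposite algebra `Aᵐᵒᵖ`. -/

section Representations

variable {V Z : ℕ → Type*}
  [∀ i, AddCommGroup (V i)] [∀ i, Module ℚ (V i)]
  [∀ i, AddCommGroup (Z i)] [∀ i, Module ℚ (Z i)]

/-- The surjection `L_W → L_V` dual to the inclusion of `V` in `W = V ⊕ Z`. -/
def lieToBase : HLie (fun i => V i × Z i) →ₗ[ℚ] HLie V := (DirectSum.lmap (inV V Z)).dualMap

/-- The injection `L_Z → L_W` dual to the projection of `W = V ⊕ Z` on `Z`. -/
def lieOfFibre : HLie Z →ₗ[ℚ] HLie (fun i => V i × Z i) := (DirectSum.lmap (prZ V Z)).dualMap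

/-- The restriction `L_W → L_Z` to `Z`, left inverse to the injection `L_Z → L_W`. -/
def lieToFibre : HLie (fun i => V i × Z i) →ₗ[ℚ] HLie Z := (DirectSum.lmap (inZ V Z)).dualMap

/-- The right adjoint representation of `UBar_W` in the ideal `L_Z` of `L_W`: the continuous right
representation in which `x ∈ L_W` acts by `y ↦ [y, x] = -(-1)^{deg x deg y} [x, y]`. -/
structure IsRightAdjoint
    (dW : FreeCGA (fun i => V i × Z i) →ₗ[ℚ] FreeCGA (fun i => V i × Z i))
    (adR : (UBar dW)ᵐᵒᵖ →ₐ[ℚ] Module.End ℚ (HLie Z)) : Prop where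
  adjoint : ∀ (x : HLie fun i => V i × Z i) (y : HLie Z),
    lieOfFibre (adR (MulOpposite.op (UBar.ι x)) y) = HLie.bracket dW (lieOfFibre y) x
  continuous : ∀ z : ⨁ i, Z i, ∃ (S : Idx dW) (n : ℕ), ∀ a : UBar dW, a.1 S n = 0 →
    ∀ y : HLie Z, adR (MulOpposite.op a) y z = 0
  graded : ∀ (p q : ℕ), ∀ a ∈ UBar.deg (d := dW) p, ∀ y ∈ HLie.deg (V := Z) q,
    adR (MulOpposite.op a) y ∈ HLie.deg (V := Z) (q + p)

/-- For `x ∈ L_V`, the operator `-∑ ⟨vᵢ, sx⟩ θᵢ` of `⋀Z`, where `vᵢ` is a basis of `V` and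
`d(1 ⊗ Φ) = 1 ⊗ d̄Φ + ∑ vᵢ ⊗ θᵢ Φ + Ω` with `Ω ∈ ⋀^{≥2}V ⊗ ⋀Z`. -/
def theta (dW : FreeCGA (fun i => V i × Z i) →ₗ[ℚ] FreeCGA (fun i => V i × Z i)) (x : HLie V) :
    FreeCGA Z →ₗ[ℚ] FreeCGA Z :=
  -((TensorProduct.lid ℚ (FreeCGA Z)).toLinearMap ∘ₗ
    TensorProduct.map x LinearMap.id ∘ₗ split (prV V Z) (prZ V Z) ∘ₗ dW ∘ₗ
      (FreeCGA.map (inZ V Z)).toLinearMap)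

/-- The holonomy representation of `UBar_V` in `H(⋀Z)`: the continuous representation in which
`x ∈ L_V` acts by `-∑ ⟨vᵢ, sx⟩ H(θᵢ)`. -/
structure IsHolonomy (dV : FreeCGA V →ₗ[ℚ] FreeCGA V)
    (dW : FreeCGA (fun i => V i × Z i) →ₗ[ℚ] FreeCGA (fun i => V i × Z i))
    (hol : UBar dV →ₐ[ℚ] Module.End ℚ (Coh (quotDiff dW))) : Prop where
  holonomy : ∀ (x : HLie V) (Φ : LinearMap.ker (quotDiff dW)),
    ∃ h : theta dW x Φ.1 ∈ LinearMap.ker (quotDiff dW),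
      hol (UBar.ι x) (Coh.mk _ Φ) = Coh.mk _ ⟨theta dW x Φ.1, h⟩
  continuous : ∀ c : Coh (quotDiff dW), ∃ (S : Idx dV) (n : ℕ), ∀ a : UBar dV, a.1 S n = 0 →
    hol a c = 0
  graded : ∀ p, ∀ a ∈ UBar.deg (d := dV) p,
    (∀ m, ∀ c ∈ Coh.deg (quotDiff dW) (m + p), hol a c ∈ Coh.deg (quotDiff dW) m) ∧
    ∀ m < p, ∀ c ∈ Coh.deg (quotDiff dW) m, hol a c = 0

/-- The dual right representation of a representation of `UBar_V` in `M`: the continuous right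
representation in the dual of `M` with `⟨m, f · a⟩ = (-1)^{deg a} ⟨a · m, f⟩`. -/
structure IsDualRight {dV : FreeCGA V →ₗ[ℚ] FreeCGA V} {M : Type*} [AddCommGroup M] [Module ℚ M]
    (R : UBar dV →ₐ[ℚ] Module.End ℚ M)
    (D : (UBar dV)ᵐᵒᵖ →ₐ[ℚ] Module.End ℚ (Module.Dual ℚ M)) : Prop where
  dual : ∀ p, ∀ a ∈ UBar.deg (d := dV) p, ∀ (f : Module.Dual ℚ M) (m : M),
    D (MulOpposite.op a) f m = (-1 : ℚ) ^ p * f (R a m)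
  continuous : ∀ m : M, ∃ (S : Idx dV) (n : ℕ), ∀ a : UBar dV, a.1 S n = 0 →
    ∀ f : Module.Dual ℚ M, D (MulOpposite.op a) f m = 0

/-- The morphism `UBar_W → UBar_V` extending `L_W → L_V`, i.e. the continuous morphism of algebras
that restricts to it. -/
structure IsCompletedProjection (dV : FreeCGA V →ₗ[ℚ] FreeCGA V)
    (dW : FreeCGA (fun i => V i × Z i) →ₗ[ℚ] FreeCGA (fun i => V i × Z i))
    (π : UBar dW →ₐ[ℚ] UBar dV) : Prop where
  extends_lie : ∀ x : HLie fun i => V i × Z i, π (UBar.ι x) = UBar.ι (lieToBase x)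
  continuous : ∀ (S : Idx dV) (n : ℕ), ∃ (S' : Idx dW) (n' : ℕ), ∀ a : UBar dW,
    a.1 S' n' = 0 → (π a).1 S n = 0

/-- The graded piece `L_Z^{(r)} / L_Z^{(r+1)}` of the Sullivan lower central series. -/
abbrev LCSQuot (d : FreeCGA V →ₗ[ℚ] FreeCGA V) (r : ℕ) : Type _ :=
  sullivanLCS d r ⧸ (sullivanLCS d (r + 1)).submoduleOf (sullivanLCS d r)

/-- The projection `L_Z^{(r)} → L_Z^{(r)} / L_Z^{(r+1)}`. -/
def LCSQuot.mk (d : FreeCGA V →ₗ[ℚ] FreeCGA V) (r : ℕ) : sullivanLCS d r →ₗ[ℚ] LCSQuot d r :=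
  ((sullivanLCS d (r + 1)).submoduleOf (sullivanLCS d r)).mkQ

end Representations

end SullivanRep

end

open SullivanRep

/-! The proof works on the discrete side, on `V`, `Z` and `⋀Z`, and obtains the statements about
`L_V`, `L_Z` and the completions by transposition.

A functional `x` on `V` contracts `⋀V` by a map `I_x` (`ctr`), a derivation when `x` is homogeneous.
Its graded commutator with `d` is `L_x` (`lieDer`). The linear part of `L_x` is, up to sign, the
coadjoint action `coad d x` on `V`, and `[x, y] = x ∘ coad y` (`bracket_apply`). Hence the right
adjoint action of `L_W` on `L_Z` is the transpose of the coadjoint action on `Z = W / V`. Likewise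
the holonomy operator of `x ∈ L_V` is induced by `-L_{x'}` on `⋀Z = ⋀W / (⋀⁺V)`, for any extension
`x'` of `x` to `W`: if `x'` vanishes on `V`, the induced operator is a commutator with the
differential of `⋀Z` and so is zero in cohomology. The operators satisfy `[L_x, L_y] = -L_{[x,y]}`
up to a commutator `[K, d]` (`lieDer_lieDer`), which is invisible both in cohomology and in linear
parts. This one identity gives the Lie relations of both actions.

The Sullivan condition makes both actions locally nilpotent and makes them factor locally through
some `L_S` (`exists_idx_mem`, `exists_mem_lieNil`). Such an action of `L_V` extends uniquely to a
continuous action of the completion (`lift_eq_zero`, `exists_rep`), because the free algebra on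
`L_V` maps onto every `UL_S / I^n` and is therefore dense. By the same density, every identity
between continuous representations only has to be checked on `L_V` (`intertwine`).

Each `UL_S / I^n` is finite dimensional, so the completion is the dual of the space of continuous
functionals on the free algebra. The morphism `π` is the transpose of an injection between such
spaces, so it is onto; extending functionals that respect the degree gives surjectivity in each
degree (`exists_proj_eq`).

Finally, `L_Z^{(r+1)}` is the annihilator of the `r`-th socle of `Z` under the coadjoint action of
`L_Z` (`mem_sullivanLCS_succ`). The socles are stable under `L_W` because `L_Z` is an ideal, and on
each layer `L_W` acts through `L_V`; this gives (i) and (iii). The linear part of a cycle lies in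
the first socle, and taking linear parts intertwines the holonomy action, twisted by the sign of the
degree, with the coadjoint action. The transpose of that statement is (iv). -/

noncomputable section

namespace SullivanRep

section

/-! ### Contractions and signed derivations of `⋀V` -/

section Calculus

variable {V W : ℕ → Type*}
  [∀ i, AddCommGroup (V i)] [∀ i, Module ℚ (V i)]
  [∀ i, AddCommGroup (W i)] [∀ i, Module ℚ (W i)]

namespace FreeCGA

theorem ι_lof (i : ℕ) (v : V i) : ι V (DirectSum.lof ℚ ℕ V i v) = gen V i v := rfl

/-- A subspace of `⋀V` containing `1` and stable under left multiplication by the homogeneous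
generators is everything. -/
theorem mem_of_gen_mul (M : Submodule ℚ (FreeCGA V)) (h1 : (1 : FreeCGA V) ∈ M)
    (hm : ∀ i (v : V i), ∀ a ∈ M, gen V i v * a ∈ M) (a : FreeCGA V) : a ∈ M := by
  have hι : ∀ (v : ⨁ i, V i), ∀ a ∈ M, ι V v * a ∈ M := by
    intro v a ha
    induction v using DirectSum.induction_on with
    | zero => simp
    | of i v => exact hm i v a ha
    | add x y hx hy => rw [map_add, add_mul]; exact M.add_mem hx hy
  let mk : TensorAlgebra ℚ (⨁ i, V i) →ₐ[ℚ] FreeCGA V := RingQuot.mkAlgHom ℚ (CommRel V)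
  have key : ∀ t : TensorAlgebra ℚ (⨁ i, V i), ∀ a ∈ M, mk t * a ∈ M := by
    intro t
    induction t using TensorAlgebra.induction with
    | algebraMap r =>
      intro a ha
      rw [AlgHom.commutes]
      have := M.smul_mem r ha
      rwa [Algebra.smul_def] at this
    | ι v => intro a ha; exact hι v a ha
    | mul x y hx hy => intro a ha; rw [map_mul, mul_assoc]; exact hx _ (hy _ ha)
    | add x y hx hy => intro a ha; rw [map_add, add_mul]; exact M.add_mem (hx a ha) (hy a ha)
  obtain ⟨t, rfl⟩ := RingQuot.mkAlgHom_surjective ℚ (CommRel V) a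
  have := key t 1 h1
  rwa [mul_one] at this

theorem linearMap_ext {M : Type*} [AddCommGroup M] [Module ℚ M] {f g : FreeCGA V →ₗ[ℚ] M}
    (h1 : f 1 = g 1)
    (hm : ∀ i (v : V i) a, f a = g a → f (gen V i v * a) = g (gen V i v * a)) : f = g := by
  refine LinearMap.ext fun a => ?_
  have := mem_of_gen_mul (LinearMap.eqLocus f g) h1 (fun i v a ha => hm i v a ha) a
  exact this

theorem algHom_ext {A : Type*} [Ring A] [Algebra ℚ A] {f g : FreeCGA V →ₐ[ℚ] A}
    (h : ∀ i (v : V i), f (gen V i v) = g (gen V i v)) : f = g := by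
  have : f.toLinearMap = g.toLinearMap := by
    refine linearMap_ext (by simp) fun i v a ha => ?_
    simp only [AlgHom.toLinearMap_apply] at ha ⊢
    rw [map_mul, map_mul, h, ha]
  exact AlgHom.toLinearMap_injective this

theorem lift_gen {A : Type*} [Semiring A] [Algebra ℚ A] (f : (⨁ i, V i) →ₗ[ℚ] A) (hf) (i : ℕ)
    (v : V i) : lift f hf (gen V i v) = f (DirectSum.lof ℚ ℕ V i v) := lift_ι _ _ _

@[simp] theorem aug_gen (i : ℕ) (v : V i) : aug V (gen V i v) = 0 := by
  rw [aug, lift_gen]; rfl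

@[simp] theorem aug_ι (v : ⨁ i, V i) : aug V (ι V v) = 0 := by
  rw [aug, lift_ι]; rfl

theorem map_ι (f : ∀ i, V i →ₗ[ℚ] W i) (v : ⨁ i, V i) :
    map f (ι V v) = ι W (DirectSum.lmap f v) := by
  rw [map, lift_ι]; rfl

@[simp] theorem map_gen (f : ∀ i, V i →ₗ[ℚ] W i) (i : ℕ) (v : V i) :
    map f (gen V i v) = gen W i (f i v) := by
  rw [← ι_lof, map_ι, DirectSum.lmap_lof]; rfl

theorem map_comp_apply {U : ℕ → Type*} [∀ i, AddCommGroup (U i)] [∀ i, Module ℚ (U i)]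
    (f : ∀ i, V i →ₗ[ℚ] W i) (g : ∀ i, W i →ₗ[ℚ] U i) (a : FreeCGA V) :
    map g (map f a) = map (fun i => g i ∘ₗ f i) a := by
  have : (map g).comp (map f) = map (fun i => g i ∘ₗ f i) := algHom_ext (by intros; simp)
  rw [← this]; rfl

@[simp] theorem map_id_apply (a : FreeCGA V) :
    map (fun i => (LinearMap.id : V i →ₗ[ℚ] V i)) a = a := by
  have : map (fun i => (LinearMap.id : V i →ₗ[ℚ] V i)) = AlgHom.id ℚ _ :=
    algHom_ext (by intros; simp)
  rw [this]; rfl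

@[simp] theorem aug_map (f : ∀ i, V i →ₗ[ℚ] W i) (a : FreeCGA V) :
    aug W (map f a) = aug V a := by
  have : (aug W).comp (map f) = aug V := algHom_ext (by intros; simp)
  rw [← this]; rfl

variable (V) in
/-- The `k`-th power of the degree involution of `⋀V`. -/
def tw (k : ℕ) : FreeCGA V →ₐ[ℚ] FreeCGA V :=
  map fun i => (-1 : ℚ) ^ (k * i) • (LinearMap.id : V i →ₗ[ℚ] V i)

@[simp] theorem tw_gen (k i : ℕ) (v : V i) :
    tw V k (gen V i v) = (-1 : ℚ) ^ (k * i) • gen V i v := by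
  simp [tw]

theorem tw_tw (j k : ℕ) (a : FreeCGA V) : tw V j (tw V k a) = tw V (j + k) a := by
  have : (tw V j).comp (tw V k) = tw V (j + k) := algHom_ext (by
    intro i v
    simp [smul_smul, ← pow_add, add_mul, add_comm])
  rw [← this]; rfl

theorem tw_congr {j k : ℕ} (h : (-1 : ℚ) ^ j = (-1) ^ k) : tw V j = tw V k :=
  algHom_ext (by intro i v; simp [pow_mul, h])

theorem tw_map (f : ∀ i, V i →ₗ[ℚ] W i) (k : ℕ) (a : FreeCGA V) :
    tw W k (map f a) = map f (tw V k a) := by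
  have : (tw W k).comp (map f) = (map f).comp (tw V k) := algHom_ext (by intro i v; simp)
  exact DFunLike.congr_fun this a

end FreeCGA

open FreeCGA

theorem sgn_pow_lof (m n : ℕ) (v : V n) : (sgn V ^ m) (DirectSum.lof ℚ ℕ V n v) =
    (-1 : ℚ) ^ (m * n) • DirectSum.lof ℚ ℕ V n v := by
  induction m with
  | zero => simp
  | succ m ih =>
    rw [pow_succ', Module.End.mul_apply, ih, map_smul, sgn_lof, smul_smul, ← pow_add]
    congr 2; ring

theorem sgn_sgn (v : ⨁ i, V i) : sgn V (sgn V v) = v := by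
  induction v using DirectSum.induction_on with
  | zero => simp
  | of i v =>
    have := sgn_lof (V := V) i v
    rw [DirectSum.lof_eq_of] at this
    rw [this, map_smul, this, smul_smul, ← mul_pow]; simp
  | add x y hx hy => simp [hx, hy]

theorem sgn_lmap (f : ∀ i, V i →ₗ[ℚ] W i) (v : ⨁ i, V i) :
    sgn W (DirectSum.lmap f v) = DirectSum.lmap f (sgn V v) := by
  induction v using DirectSum.induction_on with
  | zero => simp
  | of i v => simp only [← DirectSum.lof_eq_of ℚ, sgn_lof, DirectSum.lmap_lof, map_smul]
  | add x y hx hy => simp [hx, hy]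

/-- Contraction of the first tensor factor with a functional. -/
def contract {U M : Type*} [AddCommGroup U] [Module ℚ U] [AddCommGroup M] [Module ℚ M]
    (x : Module.Dual ℚ U) : U ⊗[ℚ] M →ₗ[ℚ] M :=
  (TensorProduct.lid ℚ M).toLinearMap ∘ₗ TensorProduct.map x LinearMap.id

@[simp] theorem contract_tmul {U M : Type*} [AddCommGroup U] [Module ℚ U] [AddCommGroup M]
    [Module ℚ M] (x : Module.Dual ℚ U) (u : U) (m : M) : contract x (u ⊗ₜ m) = x u • m := by
  simp [contract]

theorem contract_add {U M : Type*} [AddCommGroup U] [Module ℚ U] [AddCommGroup M]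
    [Module ℚ M] (x y : Module.Dual ℚ U) (t : U ⊗[ℚ] M) :
    contract (x + y) t = contract x t + contract y t := by
  induction t using TensorProduct.induction_on with
  | zero => simp
  | add s t hs ht => simp only [map_add, hs, ht]; abel
  | tmul u m => simp [add_smul]

theorem contract_smul {U M : Type*} [AddCommGroup U] [Module ℚ U] [AddCommGroup M]
    [Module ℚ M] (c : ℚ) (x : Module.Dual ℚ U) (t : U ⊗[ℚ] M) :
    contract (c • x) t = c • contract x t := by
  induction t using TensorProduct.induction_on with
  | zero => simp
  | add s t hs ht => simp only [map_add, hs, ht, smul_add]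
  | tmul u m => simp [mul_smul]

theorem splitHom_apply_fst (p : ∀ i, W i →ₗ[ℚ] V i) {Z : ℕ → Type*}
    [∀ i, AddCommGroup (Z i)] [∀ i, Module ℚ (Z i)] (q : ∀ i, W i →ₗ[ℚ] Z i) (a : FreeCGA W) :
    (splitHom p q a (1, 0)).1 = FreeCGA.map q a := by
  have : LinearMap.fst ℚ _ _ ∘ₗ LinearMap.applyₗ (1, 0) ∘ₗ (splitHom p q).toLinearMap =
      (FreeCGA.map q).toLinearMap := by
    refine linearMap_ext (by simp) fun i w a ha => ?_
    simp only [LinearMap.comp_apply, LinearMap.fst_apply, LinearMap.applyₗ_apply_apply,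
      AlgHom.toLinearMap_apply, map_mul, Module.End.mul_apply, map_gen] at ha ⊢
    rw [← ha, splitHom, lift_gen, splitGen_lof]
    simp [splitAct]
  exact LinearMap.congr_fun this a

/-- With `split_one`, this recursion determines `split`; every later fact on contractions is proved
from it by induction on the generators. -/
theorem split_gen_mul {Z : ℕ → Type*}
    [∀ i, AddCommGroup (Z i)] [∀ i, Module ℚ (Z i)]
    (p : ∀ i, W i →ₗ[ℚ] V i) (q : ∀ i, W i →ₗ[ℚ] Z i) (i : ℕ) (w : W i) (a : FreeCGA W) :
    split p q (gen W i w * a) = DirectSum.lof ℚ ℕ V i (p i w) ⊗ₜ FreeCGA.map q a +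
      TensorProduct.map (sgn V ^ i) (LinearMap.mulLeft ℚ (gen Z i (q i w))) (split p q a) := by
  show (splitHom p q (gen W i w * a) (1, 0)).2 = _
  rw [map_mul, Module.End.mul_apply]
  have h1 : splitHom p q (gen W i w) = splitAct p q i w := by
    rw [splitHom, lift_gen, splitGen_lof]
  rw [h1]
  simp only [splitAct, LinearMap.coe_mk, AddHom.coe_mk, LinearMap.prod_apply, Function.prod_apply,
    LinearMap.add_apply, LinearMap.comp_apply, LinearMap.fst_apply, LinearMap.snd_apply,
    splitHom_apply_fst]
  rfl

theorem split_one {Z : ℕ → Type*}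
    [∀ i, AddCommGroup (Z i)] [∀ i, Module ℚ (Z i)]
    (p : ∀ i, W i →ₗ[ℚ] V i) (q : ∀ i, W i →ₗ[ℚ] Z i) : split p q 1 = 0 := by
  show (splitHom p q 1 (1, 0)).2 = _
  simp

theorem contract_map {U M : Type*} [AddCommGroup U] [Module ℚ U] [AddCommGroup M] [Module ℚ M]
    {U' M' : Type*} [AddCommGroup U'] [Module ℚ U'] [AddCommGroup M'] [Module ℚ M']
    (x : Module.Dual ℚ U') (f : U →ₗ[ℚ] U') (g : M →ₗ[ℚ] M') (t : U ⊗[ℚ] M) :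
    contract x (TensorProduct.map f g t) = g (contract (x ∘ₗ f) t) := by
  induction t using TensorProduct.induction_on with
  | zero => simp
  | add s t hs ht => simp only [map_add, hs, ht]
  | tmul u m => simp

variable (V) in
/-- The contraction `I_x` of `⋀V` by `x ∈ Hom(V, ℚ)`; for `x` homogeneous it is the derivation
extending `x`. -/
def ctr (x : HLie V) : FreeCGA V →ₗ[ℚ] FreeCGA V :=
  contract x ∘ₗ split (fun _ => LinearMap.id) (fun _ => LinearMap.id)

@[simp] theorem ctr_one (x : HLie V) : ctr V x 1 = 0 := by
  simp [ctr, split_one]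

/-- The Koszul sign is carried by `x ∘ sgn ^ i` rather than by a scalar, so that the formula also
holds for inhomogeneous `x`. -/
theorem ctr_gen_mul (x : HLie V) (i : ℕ) (v : V i) (a : FreeCGA V) :
    ctr V x (gen V i v * a) = x (DirectSum.lof ℚ ℕ V i v) • a +
      gen V i v * ctr V (x ∘ₗ sgn V ^ i) a := by
  simp only [ctr, LinearMap.comp_apply, split_gen_mul, map_add, contract_map, contract_tmul,
    map_id_apply, LinearMap.id_apply, LinearMap.mulLeft_apply]

theorem ctr_gen (x : HLie V) (i : ℕ) (v : V i) :
    ctr V x (gen V i v) = algebraMap ℚ _ (x (DirectSum.lof ℚ ℕ V i v)) := by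
  have := ctr_gen_mul x i v 1
  rw [mul_one, ctr_one, mul_zero, add_zero] at this
  rw [this, Algebra.algebraMap_eq_smul_one]

theorem ctr_ι (x : HLie V) (v : ⨁ i, V i) : ctr V x (ι V v) = algebraMap ℚ _ (x v) := by
  induction v using DirectSum.induction_on with
  | zero => simp
  | of i v => exact ctr_gen x i v
  | add v w hv hw => simp only [map_add, hv, hw]

theorem ctr_add (x y : HLie V) (a : FreeCGA V) : ctr V (x + y) a = ctr V x a + ctr V y a :=
  contract_add _ _ _

theorem ctr_smul (c : ℚ) (x : HLie V) (a : FreeCGA V) : ctr V (c • x) a = c • ctr V x a :=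
  contract_smul _ _ _

/-- Contractions are natural; this includes the general `split`. -/
theorem contract_split {Z : ℕ → Type*} [∀ i, AddCommGroup (Z i)] [∀ i, Module ℚ (Z i)]
    (p : ∀ i, W i →ₗ[ℚ] V i) (q : ∀ i, W i →ₗ[ℚ] Z i) (x : HLie V) (a : FreeCGA W) :
    contract x (split p q a) = FreeCGA.map q (ctr W (x ∘ₗ DirectSum.lmap p) a) := by
  have : ∀ a ∈ (⊤ : Submodule ℚ (FreeCGA W)), ∀ x : HLie V,
      contract x (split p q a) = FreeCGA.map q (ctr W (x ∘ₗ DirectSum.lmap p) a) := by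
    -- All `x` are treated at once, since passing a generator of degree `i` replaces `x` by `x ∘ sgn
    -- ^ i`.
    let M : Submodule ℚ (FreeCGA W) :=
      { carrier := {a | ∀ x : HLie V,
          contract x (split p q a) = FreeCGA.map q (ctr W (x ∘ₗ DirectSum.lmap p) a)}
        zero_mem' := by intro x; simp
        add_mem' := by intro a b ha hb x; simp only [map_add, ha x, hb x]
        smul_mem' := by intro c a ha x; simp only [map_smul, ha x] }
    intro a _
    refine mem_of_gen_mul M ?_ ?_ a
    · intro x; simp [split_one]
    · intro i w a ha x
      simp only [split_gen_mul, ctr_gen_mul, map_add, contract_map, contract_tmul, map_smul,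
        map_mul, map_gen, LinearMap.mulLeft_apply, ha (x ∘ₗ sgn V ^ i)]
      congr 3
      · simp
      · congr 2
        refine DirectSum.linearMap_ext _ fun j => LinearMap.ext fun w => ?_
        simp [sgn_pow_lof]
  exact this a trivial x

theorem ctr_map (f : ∀ i, V i →ₗ[ℚ] W i) (x : HLie W) (a : FreeCGA V) :
    ctr W x (FreeCGA.map f a) = FreeCGA.map f (ctr V (x ∘ₗ DirectSum.lmap f) a) := by
  have h : ∀ a ∈ (⊤ : Submodule ℚ (FreeCGA V)), ∀ x : HLie W,
      ctr W x (FreeCGA.map f a) = FreeCGA.map f (ctr V (x ∘ₗ DirectSum.lmap f) a) := by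
    let M : Submodule ℚ (FreeCGA V) :=
      { carrier := {a | ∀ x : HLie W,
          ctr W x (FreeCGA.map f a) = FreeCGA.map f (ctr V (x ∘ₗ DirectSum.lmap f) a)}
        zero_mem' := by intro x; simp
        add_mem' := by intro a b ha hb x; simp only [map_add, ha x, hb x]
        smul_mem' := by intro c a ha x; simp only [map_smul, ha x] }
    intro a _
    refine mem_of_gen_mul M ?_ ?_ a
    · intro x; simp
    · intro i v a ha x
      simp only [map_mul, map_gen, ctr_gen_mul, map_add, map_smul, ha (x ∘ₗ sgn W ^ i)]
      congr 3
      · simp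
      · congr 2
        refine DirectSum.linearMap_ext _ fun j => LinearMap.ext fun w => ?_
        simp [sgn_pow_lof]
  exact h a trivial x

@[simp] theorem lin_one : lin V 1 = 0 := by simp [lin, split_one]

theorem lin_eq (x : HLie V) (a : FreeCGA V) : x (lin V a) = aug V (ctr V x a) := by
  simp only [lin, ctr, LinearMap.comp_apply]
  generalize split (fun _ => LinearMap.id) (fun _ => LinearMap.id) a = t
  induction t using TensorProduct.induction_on with
  | zero => simp
  | add s t hs ht => simp only [map_add, hs, ht]
  | tmul u m => simp [mul_comm]

theorem eq_of_dual {v w : ⨁ i, V i} (h : ∀ x : HLie V, x v = x w) : v = w := by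
  rw [← sub_eq_zero]
  refine (Module.forall_dual_apply_eq_zero_iff ℚ _).1 fun x => ?_
  rw [map_sub, h, sub_self]

/-- Turns the bracket, defined through `quad`, into a contraction followed by a linear part. -/
theorem quad_eq (x y : HLie V) (a : FreeCGA V) :
    LinearMap.mul' ℚ ℚ (TensorProduct.map x y (quad V a)) = y (lin V (ctr V x a)) := by
  simp only [quad, ctr, LinearMap.comp_apply]
  generalize split (fun _ => LinearMap.id) (fun _ => LinearMap.id) a = t
  induction t using TensorProduct.induction_on with
  | zero => simp
  | add s t hs ht => simp only [map_add, hs, ht]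
  | tmul u m => simp

theorem lin_gen_mul (i : ℕ) (v : V i) (a : FreeCGA V) :
    lin V (gen V i v * a) = aug V a • DirectSum.lof ℚ ℕ V i v := by
  refine eq_of_dual fun x => ?_
  rw [lin_eq, ctr_gen_mul]
  simp [mul_comm]

theorem lin_mul (a b : FreeCGA V) :
    lin V (a * b) = aug V b • lin V a + aug V a • lin V b := by
  have := linearMap_ext (f := lin V ∘ₗ LinearMap.mulRight ℚ b)
    (g := aug V b • lin V + (aug V).toLinearMap.smulRight (lin V b)) (by simp) (by
      intro i v a ha
      simp [mul_assoc, lin_gen_mul, smul_smul, mul_comm])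
  have h := LinearMap.congr_fun this a
  simpa using h

@[simp] theorem lin_gen (i : ℕ) (v : V i) : lin V (gen V i v) = DirectSum.lof ℚ ℕ V i v := by
  have := lin_gen_mul i v 1
  simpa using this

@[simp] theorem lin_ι (v : ⨁ i, V i) : lin V (ι V v) = v := by
  induction v using DirectSum.induction_on with
  | zero => simp
  | of i v => exact lin_gen i v
  | add v w hv hw => simp only [map_add, hv, hw]

theorem lin_map (f : ∀ i, V i →ₗ[ℚ] W i) (a : FreeCGA V) :
    lin W (FreeCGA.map f a) = DirectSum.lmap f (lin V a) := by
  have := linearMap_ext (f := lin W ∘ₗ (FreeCGA.map f).toLinearMap)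
    (g := DirectSum.lmap f ∘ₗ lin V) (by simp) (by
      intro i v a ha
      simp [lin_gen_mul])
  exact LinearMap.congr_fun this a

/-- `D` is a derivation of `⋀V` of parity `k`. -/
structure IsDer (k : ℕ) (D : FreeCGA V →ₗ[ℚ] FreeCGA V) : Prop where
  mul : ∀ a b, D (a * b) = D a * b + tw V k a * D b
  tw : ∀ j a, D (tw V j a) = (-1 : ℚ) ^ (j * k) • tw V j (D a)

namespace IsDer

variable {j k : ℕ} {D E : FreeCGA V →ₗ[ℚ] FreeCGA V}

theorem congr (hD : IsDer j D) (h : (-1 : ℚ) ^ j = (-1) ^ k) : IsDer k D where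
  mul a b := by rw [hD.mul, tw_congr h]
  tw i a := by rw [hD.tw, mul_comm i j, mul_comm i k, pow_mul, h, pow_mul]

theorem one (hD : IsDer k D) : D 1 = 0 := by
  have := hD.mul 1 1
  simpa using this

theorem gen_mul (hD : IsDer k D) (i : ℕ) (v : V i) (a : FreeCGA V) :
    D (gen V i v * a) = D (gen V i v) * a + (-1 : ℚ) ^ (k * i) • (gen V i v * D a) := by
  rw [hD.mul, tw_gen, smul_mul_assoc]

theorem add (hD : IsDer k D) (hE : IsDer k E) : IsDer k (D + E) where
  mul a b := by
    simp only [LinearMap.add_apply, hD.mul, hE.mul, add_mul, mul_add]; abel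
  tw i a := by simp only [LinearMap.add_apply, hD.tw, hE.tw, map_add, smul_add]

theorem smul (hD : IsDer k D) (c : ℚ) : IsDer k (c • D) where
  mul a b := by
    simp only [LinearMap.smul_apply, hD.mul, smul_add, smul_mul_assoc, mul_smul_comm]
  tw i a := by
    simp only [LinearMap.smul_apply, hD.tw, map_smul, smul_smul, mul_comm]

theorem comm (hD : IsDer j D) (hE : IsDer k E) :
    IsDer (j + k) (D ∘ₗ E - (-1 : ℚ) ^ (j * k) • E ∘ₗ D) where
  mul a b := by
    have h : (-1 : ℚ) ^ (j * k) * (-1) ^ (j * k) = 1 := by rw [← mul_pow]; simp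
    simp only [LinearMap.sub_apply, LinearMap.smul_apply, LinearMap.comp_apply, hD.mul, hE.mul,
      map_add, hD.tw, hE.tw, tw_tw, smul_add, sub_mul, mul_sub, smul_mul_assoc, mul_smul_comm,
      smul_smul, add_comm k j, mul_comm k j, h, one_smul]
    abel
  tw i a := by
    simp only [LinearMap.sub_apply, LinearMap.smul_apply, LinearMap.comp_apply, hD.tw, hE.tw,
      map_sub, map_smul, smul_sub, smul_smul, mul_add, pow_add]
    congr 2 <;> ring

/-- A derivation vanishing in `⋀⁰` on the generators preserves the augmentation ideal. -/
theorem aug_eq (hD : IsDer k D) (h : ∀ i (v : V i), aug V (D (gen V i v)) = 0) (a : FreeCGA V) :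
    aug V (D a) = 0 := by
  have := linearMap_ext (f := (aug V).toLinearMap ∘ₗ D) (g := 0) (by simp [hD.one]) (by
    intro i v a ha
    simp [hD.gen_mul, h])
  exact LinearMap.congr_fun this a

/-- Such a derivation is determined on `⋀^{≥1} / ⋀^{≥2}` by its values on generators. -/
theorem lin_eq (hD : IsDer k D) (h : ∀ i (v : V i), aug V (D (gen V i v)) = 0) (a : FreeCGA V) :
    lin V (D a) = lin V (D (ι V (lin V a))) := by
  have := linearMap_ext (f := lin V ∘ₗ D) (g := lin V ∘ₗ D ∘ₗ ι V ∘ₗ lin V) (by simp [hD.one]) (by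
    intro i v a ha
    simp only [LinearMap.comp_apply, hD.gen_mul, map_add, map_smul, lin_mul, h,
      hD.aug_eq h, ι_lof, lin_gen, aug_gen]
    simp)
  exact LinearMap.congr_fun this a

/-- The derivation `g ∘ D` over a morphism `g` is determined by its values on generators. -/
theorem map_comp_ext (hD : IsDer k D) {E : FreeCGA W →ₗ[ℚ] FreeCGA W} (hE : IsDer k E)
    (g : ∀ i, V i →ₗ[ℚ] W i)
    (h : ∀ i (v : V i), FreeCGA.map g (D (gen V i v)) = E (gen W i (g i v)))
    (a : FreeCGA V) : FreeCGA.map g (D a) = E (FreeCGA.map g a) := by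
  have := linearMap_ext (f := (FreeCGA.map g).toLinearMap ∘ₗ D)
    (g := E ∘ₗ (FreeCGA.map g).toLinearMap) (by simp [hD.one, hE.one]) (by
      intro i v a ha
      simp only [LinearMap.comp_apply, AlgHom.toLinearMap_apply] at ha ⊢
      simp only [hD.gen_mul, map_add, map_mul, map_smul, map_gen, hE.gen_mul, h, ha])
  exact LinearMap.congr_fun this a

end IsDer

/-- The signed Leibniz rule may be checked on generators. -/
theorem isDer_of_gen_mul {k : ℕ} {D : FreeCGA V →ₗ[ℚ] FreeCGA V} (h1 : D 1 = 0)
    (hm : ∀ i (v : V i) a,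
      D (gen V i v * a) = D (gen V i v) * a + (-1 : ℚ) ^ (k * i) • (gen V i v * D a))
    (ht : ∀ j i (v : V i), D (tw V j (gen V i v)) = (-1 : ℚ) ^ (j * k) • tw V j (D (gen V i v))) :
    IsDer k D where
  mul a b := by
    have := linearMap_ext (f := D ∘ₗ LinearMap.mulRight ℚ b)
      (g := LinearMap.mulRight ℚ b ∘ₗ D + LinearMap.mulRight ℚ (D b) ∘ₗ (tw V k).toLinearMap)
      (by simp [h1]) (by
        intro i v a ha
        simp only [LinearMap.comp_apply, LinearMap.mulRight_apply, LinearMap.add_apply,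
          AlgHom.toLinearMap_apply] at ha ⊢
        simp only [mul_assoc, hm, ha, map_mul, tw_gen, add_mul, mul_add, smul_add, smul_mul_assoc]
        abel)
    exact LinearMap.congr_fun this a
  tw j a := by
    have := linearMap_ext (f := D ∘ₗ (tw V j).toLinearMap)
      (g := (-1 : ℚ) ^ (j * k) • (tw V j).toLinearMap ∘ₗ D)
      (by simp [h1]) (by
        intro i v a ha
        simp only [LinearMap.comp_apply, LinearMap.smul_apply,
          AlgHom.toLinearMap_apply] at ha ⊢
        have h2 := ht j i v
        rw [tw_gen, map_smul] at h2
        simp only [map_mul, tw_gen, smul_mul_assoc, map_smul, hm, ha, map_add, smul_add,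
          mul_smul_comm]
        rw [← smul_mul_assoc, h2]
        simp only [smul_mul_assoc, smul_smul]
        congr 2; ring)
    exact LinearMap.congr_fun this a

/-- `x` only sees `V^{p+1}`, where the involution is the scalar `(-1)^{p+1}`. -/
theorem HLie.comp_sgn_pow {p : ℕ} {x : HLie V} (hx : x ∈ HLie.deg p) (i : ℕ) :
    x ∘ₗ sgn V ^ i = (-1 : ℚ) ^ ((p + 1) * i) • x := by
  refine DirectSum.linearMap_ext _ fun j => LinearMap.ext fun v => ?_
  simp only [LinearMap.comp_apply, sgn_pow_lof, map_smul, LinearMap.smul_apply]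
  by_cases h : j = p + 1
  · subst h; rw [mul_comm]
  · rw [hx j h v, smul_zero, smul_zero]

theorem HLie.comp_sgn {p : ℕ} {x : HLie V} (hx : x ∈ HLie.deg p) :
    x ∘ₗ sgn V = (-1 : ℚ) ^ (p + 1) • x := by
  have := HLie.comp_sgn_pow hx 1
  simpa using this

/-- The parity is `p + 1` and not `p` because it is the suspension `sx` that contracts. -/
theorem isDer_ctr {p : ℕ} {x : HLie V} (hx : x ∈ HLie.deg p) : IsDer (p + 1) (ctr V x) := by
  refine isDer_of_gen_mul (ctr_one x) ?_ ?_
  · intro i v a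
    rw [ctr_gen_mul, HLie.comp_sgn_pow hx, ctr_smul, mul_smul_comm, ctr_gen,
      ← Algebra.smul_def]
  · intro j i v
    rw [tw_gen, map_smul, ctr_gen, AlgHom.commutes]
    by_cases h : i = p + 1
    · subst h; rfl
    · rw [hx i h v]; simp

/-- Contractions by homogeneous functionals commute up to sign. -/
theorem ctr_ctr {p q : ℕ} {x y : HLie V} (hx : x ∈ HLie.deg p) (hy : y ∈ HLie.deg q)
    (a : FreeCGA V) :
    ctr V x (ctr V y a) = (-1 : ℚ) ^ ((p + 1) * (q + 1)) • ctr V y (ctr V x a) := by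
  -- The graded commutator is again a derivation, and it kills the generators because a contraction
  -- maps them to scalars.
  have h := (isDer_ctr hx).comm (isDer_ctr hy)
  have := linearMap_ext (f := ctr V x ∘ₗ ctr V y - (-1 : ℚ) ^ ((p + 1) * (q + 1)) •
    ctr V y ∘ₗ ctr V x) (g := 0) h.one (by
      intro i v a ha
      rw [h.gen_mul, ha]
      simp [ctr_gen, Algebra.algebraMap_eq_smul_one])
  have h2 := LinearMap.congr_fun this a
  rw [← sub_eq_zero]
  exact h2

end Calculus

end

section

open FreeCGA

/-! ### Degree components and the subalgebras `⋀S` of graded subspaces -/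

section Degrees

variable {V W : ℕ → Type*}
  [∀ i, AddCommGroup (V i)] [∀ i, Module ℚ (V i)]
  [∀ i, AddCommGroup (W i)] [∀ i, Module ℚ (W i)]

namespace FreeCGA

variable (V) in
/-- The elements of degree `k` of `⋀V`, with `k` an integer. -/
def degZ (k : ℤ) : Submodule ℚ (FreeCGA V) :=
  Submodule.span ℚ {a | ∃ l : List (Σ i, V i),
    (((l.map Sigma.fst).sum : ℕ) : ℤ) = k ∧ a = (l.map fun p => gen V p.1 p.2).prod}

theorem degZ_natCast (n : ℕ) : degZ V n = deg V n := by
  simp only [degZ, deg, Nat.cast_inj]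

theorem degZ_of_neg {k : ℤ} (hk : k < 0) : degZ V k = ⊥ := by
  rw [degZ, Submodule.span_eq_bot]
  rintro a ⟨l, hl, -⟩
  omega

theorem one_mem_degZ : (1 : FreeCGA V) ∈ degZ V 0 :=
  Submodule.subset_span ⟨[], by simp, by simp⟩

theorem gen_mul_mem_degZ {k : ℤ} (i : ℕ) (v : V i) {a : FreeCGA V} (ha : a ∈ degZ V k) :
    gen V i v * a ∈ degZ V (k + i) := by
  refine Submodule.span_induction ?_ ?_ ?_ ?_ ha
  · rintro _ ⟨l, hl, rfl⟩
    exact Submodule.subset_span ⟨⟨i, v⟩ :: l, by simp [← hl, add_comm], by simp⟩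
  · simp
  · intro x y _ _ hx hy; rw [mul_add]; exact add_mem hx hy
  · intro c x _ hx; rw [mul_smul_comm]; exact Submodule.smul_mem _ c hx

/-- Induction on the degree components of `⋀V`, one generator at a time. -/
theorem degZ_le {M : ℤ → Submodule ℚ (FreeCGA V)} (h1 : 1 ∈ M 0)
    (hm : ∀ (k : ℤ) i (v : V i), ∀ a ∈ M k, a ∈ degZ V k → gen V i v * a ∈ M (k + i)) (k : ℤ) :
    degZ V k ≤ M k := by
  rw [degZ, Submodule.span_le]
  rintro a ⟨l, hl, rfl⟩
  induction l generalizing k with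
  | nil =>
    simp only [List.map_nil, List.sum_nil, Nat.cast_zero] at hl
    subst hl; simpa using h1
  | cons p l ih =>
    simp only [List.map_cons, List.sum_cons, Nat.cast_add] at hl
    rw [List.map_cons, List.prod_cons, ← hl, add_comm]
    exact hm _ _ _ _ (ih _ rfl) (Submodule.subset_span ⟨l, rfl, rfl⟩)

theorem iSup_degZ : ⨆ k, degZ V k = ⊤ := by
  rw [eq_top_iff]
  rintro a -
  refine mem_of_gen_mul _ ?_ ?_ a
  · exact Submodule.mem_iSup_of_mem 0 one_mem_degZ
  · intro i v a ha
    induction ha using Submodule.iSup_induction' with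
    | mem k a ha => exact Submodule.mem_iSup_of_mem _ (gen_mul_mem_degZ i v ha)
    | zero => simp
    | add x y _ _ hx hy => rw [mul_add]; exact add_mem hx hy

theorem iSup_deg : ⨆ n, deg V n = ⊤ := by
  rw [eq_top_iff, ← iSup_degZ]
  refine iSup_le fun k => ?_
  rcases lt_or_ge k 0 with hk | hk
  · rw [degZ_of_neg hk]; exact bot_le
  · obtain ⟨n, rfl⟩ := Int.eq_ofNat_of_zero_le hk
    exact (degZ_natCast (V := V) n).le.trans (le_iSup (deg V) n)

theorem linearMap_ext_deg {M : Type*} [AddCommGroup M] [Module ℚ M] {f g : FreeCGA V →ₗ[ℚ] M}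
    (h : ∀ n, ∀ a ∈ deg V n, f a = g a) : f = g := by
  refine LinearMap.ext fun a => ?_
  have : (⊤ : Submodule ℚ (FreeCGA V)) ≤ LinearMap.eqLocus f g := by
    rw [← iSup_deg]
    exact iSup_le fun n a ha => h n a ha
  exact this trivial

theorem gen_mem_deg (i : ℕ) (v : V i) : gen V i v ∈ deg V i :=
  Submodule.subset_span ⟨[⟨i, v⟩], by simp, by simp⟩

theorem aug_eq_zero_of_degZ {k : ℤ} (hk : k ≠ 0) {a : FreeCGA V} (ha : a ∈ degZ V k) :
    aug V a = 0 := by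
  have := degZ_le (V := V) (M := fun k => if k = 0 then ⊤ else LinearMap.ker (aug V).toLinearMap)
    (by simp) (by
      intro k i v a _ _
      split_ifs
      · trivial
      · simp) k
  have h := this ha
  rw [if_neg hk] at h
  exact h

theorem tw_of_deg {n : ℕ} {a : FreeCGA V} (ha : a ∈ deg V n) (j : ℕ) :
    tw V j a = (-1 : ℚ) ^ (j * n) • a := by
  refine Submodule.span_induction ?_ ?_ ?_ ?_ ha
  · rintro _ ⟨l, rfl, rfl⟩
    clear ha
    induction l with
    | nil => simp
    | cons p l ih =>
      simp only [List.map_cons, List.prod_cons, List.sum_cons, map_mul, tw_gen, ih]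
      rw [smul_mul_smul_comm, ← pow_add, mul_add]
  · simp
  · intro x y _ _ hx hy; rw [map_add, hx, hy, smul_add]
  · intro c x _ hx; rw [map_smul, hx, smul_comm]

theorem map_mem_degZ (f : ∀ i, V i →ₗ[ℚ] W i) {k : ℤ} {a : FreeCGA V} (ha : a ∈ degZ V k) :
    map f a ∈ degZ W k := by
  refine degZ_le (M := fun k => (degZ W k).comap (map f).toLinearMap) ?_ ?_ k ha
  · simpa using one_mem_degZ
  · intro k i v a ha _
    simp only [Submodule.mem_comap, AlgHom.toLinearMap_apply, map_mul, map_gen] at ha ⊢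
    exact gen_mul_mem_degZ _ _ ha

variable (V) in
/-- The morphism `⋀V → ⋀V[t]`, `v ↦ v t^{deg v}`, encoding the degree components. -/
def grd : FreeCGA V →ₐ[ℚ] Polynomial (FreeCGA V) :=
  lift (DirectSum.toModule ℚ ℕ _ fun i =>
    (Polynomial.monomial i).restrictScalars ℚ ∘ₗ gen V i) (by
      intro i j v w
      simp only [DirectSum.toModule_lof, LinearMap.comp_apply, LinearMap.restrictScalars_apply,
        Polynomial.monomial_mul_monomial]
      rw [gen_mul_gen, add_comm, Polynomial.smul_monomial])

theorem grd_gen (i : ℕ) (v : V i) : grd V (gen V i v) = Polynomial.monomial i (gen V i v) := by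
  rw [grd, lift_gen, DirectSum.toModule_lof]; rfl

theorem grd_of_deg {n : ℕ} {a : FreeCGA V} (ha : a ∈ deg V n) :
    grd V a = Polynomial.monomial n a := by
  refine Submodule.span_induction ?_ ?_ ?_ ?_ ha
  · rintro _ ⟨l, rfl, rfl⟩
    clear ha
    induction l with
    | nil => simp
    | cons p l ih =>
      simp only [List.map_cons, List.prod_cons, List.sum_cons, map_mul, grd_gen, ih,
        Polynomial.monomial_mul_monomial]
  · simp
  · intro x y _ _ hx hy; rw [map_add, hx, hy, map_add]
  · intro c x _ hx; rw [map_smul, hx, Polynomial.smul_monomial]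

variable (V) in
/-- The component of degree `n` of an element of `⋀V`. -/
def comp (n : ℕ) : FreeCGA V →ₗ[ℚ] FreeCGA V :=
  (Polynomial.lcoeff (FreeCGA V) n).restrictScalars ℚ ∘ₗ (grd V).toLinearMap

theorem comp_apply (n : ℕ) (a : FreeCGA V) : comp V n a = (grd V a).coeff n := rfl

theorem comp_of_deg {n : ℕ} {a : FreeCGA V} (ha : a ∈ deg V n) (m : ℕ) :
    comp V m a = if n = m then a else 0 := by
  rw [comp_apply, grd_of_deg ha, Polynomial.coeff_monomial]

theorem comp_mem (n : ℕ) (a : FreeCGA V) : comp V n a ∈ deg V n := by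
  have : (⊤ : Submodule ℚ (FreeCGA V)) ≤ (deg V n).comap (comp V n) := by
    rw [← iSup_deg]
    refine iSup_le fun m a ha => ?_
    rw [Submodule.mem_comap, comp_of_deg ha]
    split_ifs with h
    · exact h ▸ ha
    · exact zero_mem _
  exact this trivial

/-- Setting `t = 1` in `grd V a` returns `a`, as is visible on homogeneous elements. -/
theorem sum_comp (a : FreeCGA V) : ∑ n ∈ (grd V a).support, comp V n a = a := by
  have h1 : ∑ n ∈ (grd V a).support, comp V n a = (grd V a).eval 1 := by
    rw [Polynomial.eval_eq_sum, Polynomial.sum_def]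
    simp [comp_apply]
  have : (⊤ : Submodule ℚ (FreeCGA V)) ≤
      LinearMap.eqLocus ((Polynomial.leval (1 : FreeCGA V)).restrictScalars ℚ ∘ₗ
        (grd V).toLinearMap) LinearMap.id := by
    rw [← iSup_deg]
    refine iSup_le fun m a ha => ?_
    show (grd V a).eval 1 = a
    rw [grd_of_deg ha]; simp
  rw [h1]
  exact this trivial

theorem eq_sum_lof (v : ⨁ i, V i) : ∃ s : Finset ℕ, v = ∑ i ∈ s, DirectSum.lof ℚ ℕ V i (v i) := by
  classical
  exact ⟨DFinsupp.support v, (DirectSum.sum_support_of v).symm⟩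

theorem comp_ι (n : ℕ) (v : ⨁ i, V i) : comp V n (ι V v) = gen V n (v n) := by
  induction v using DirectSum.induction_on with
  | zero => simp
  | of i v =>
    rw [← DirectSum.lof_eq_of ℚ, ι_lof, comp_of_deg (gen_mem_deg i v)]
    split_ifs with h
    · subst h; simp [DirectSum.lof_apply]
    · rw [DirectSum.lof_eq_of, DirectSum.of_eq_of_ne _ _ _ (Ne.symm h), map_zero]
  | add v w hv hw => rw [map_add, map_add, hv, hw, DirectSum.add_apply, map_add]

end FreeCGA

/-- Integer degrees make the statement uniform: a contraction that would lead below degree `0` lands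
in a zero space. -/
theorem ctr_mem_degZ {p : ℕ} {x : HLie V} (hx : x ∈ HLie.deg p) {k : ℤ} {a : FreeCGA V}
    (ha : a ∈ degZ V k) : ctr V x a ∈ degZ V (k - (p + 1)) := by
  refine degZ_le (M := fun k => (degZ V (k - (p + 1))).comap (ctr V x)) ?_ ?_ k ha
  · simp
  · intro k i v a ha ha'
    rw [Submodule.mem_comap] at ha ⊢
    rw [ctr_gen_mul, HLie.comp_sgn_pow hx, ctr_smul, mul_smul_comm]
    refine add_mem ?_ (Submodule.smul_mem _ _ ?_)
    · by_cases h : i = p + 1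
      · have : k + (i : ℤ) - (p + 1) = k := by rw [h]; push_cast; ring
        rw [this]; exact Submodule.smul_mem _ _ ha'
      · rw [hx i h v, zero_smul]; exact zero_mem _
    · have : k + (i : ℤ) - (p + 1) = k - (p + 1) + i := by ring
      rw [this]
      exact gen_mul_mem_degZ i v ha

/-- A graded subspace contains the homogeneous components of its elements. -/
def IsHomog (S : Submodule ℚ (⨁ i, V i)) : Prop :=
  ∀ v ∈ S, ∀ i, DirectSum.lof ℚ ℕ V i (v i) ∈ S

theorem IsHomog.sup {S T : Submodule ℚ (⨁ i, V i)} (hS : IsHomog S) (hT : IsHomog T) :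
    IsHomog (S ⊔ T) := by
  intro v hv i
  obtain ⟨s, hs, t, ht, rfl⟩ := Submodule.mem_sup.1 hv
  rw [DirectSum.add_apply, map_add]
  exact Submodule.add_mem_sup (hS s hs i) (hT t ht i)

theorem lmap_apply' (f : ∀ i, V i →ₗ[ℚ] W i) (v : ⨁ i, V i) (i : ℕ) :
    DirectSum.lmap f v i = f i (v i) := DirectSum.lmap_apply f v i

theorem IsHomog.map {S : Submodule ℚ (⨁ i, V i)} (hS : IsHomog S) (f : ∀ i, V i →ₗ[ℚ] W i) :
    IsHomog (S.map (DirectSum.lmap f)) := by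
  rintro _ ⟨v, hv, rfl⟩ i
  refine ⟨_, hS v hv i, ?_⟩
  rw [DirectSum.lmap_lof, lmap_apply']

theorem isHomog_span_lof (i : ℕ) (v : V i) :
    IsHomog (Submodule.span ℚ {DirectSum.lof ℚ ℕ V i v}) := by
  intro w hw j
  obtain ⟨c, rfl⟩ := Submodule.mem_span_singleton.1 hw
  rw [DirectSum.smul_apply, map_smul]
  refine Submodule.smul_mem _ _ ?_
  by_cases h : i = j
  · subst h
    rw [DirectSum.lof_apply]
    exact Submodule.mem_span_singleton_self _
  · rw [DirectSum.lof_eq_of, DirectSum.of_eq_of_ne _ _ _ (Ne.symm h), map_zero]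
    exact zero_mem _

theorem IsHomog.sgn_mem {S : Submodule ℚ (⨁ i, V i)} (hS : IsHomog S) {v : ⨁ i, V i}
    (hv : v ∈ S) : sgn V v ∈ S := by
  obtain ⟨s, hs⟩ := eq_sum_lof v
  rw [hs, map_sum]
  refine Submodule.sum_mem _ fun i _ => ?_
  rw [sgn_lof]
  exact Submodule.smul_mem _ _ (hS v hv i)

/-- Induction principle for `⋀S`, `S` a graded subspace. -/
theorem sub_le {S : Submodule ℚ (⨁ i, V i)} (hS : IsHomog S) (M : Submodule ℚ (FreeCGA V))
    (h1 : 1 ∈ M) (hm : ∀ i (v : V i), DirectSum.lof ℚ ℕ V i v ∈ S → ∀ a ∈ M,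
      a ∈ FreeCGA.sub (S : Set (⨁ i, V i)) → gen V i v * a ∈ M)
    {a : FreeCGA V} (ha : a ∈ FreeCGA.sub (S : Set (⨁ i, V i))) : a ∈ M := by
  -- Membership in `M` is not multiplicative in `a`, but preserving `M ∩ ⋀S` under left
  -- multiplication by `a` is.
  have key : ∀ b ∈ M, b ∈ FreeCGA.sub (S : Set (⨁ i, V i)) → a * b ∈ M := by
    refine Algebra.adjoin_induction ?_ ?_ ?_ ?_ ha
    · rintro _ ⟨v, hv, rfl⟩ b hb hb'
      obtain ⟨s, hs⟩ := eq_sum_lof v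
      rw [hs, map_sum, Finset.sum_mul]
      exact Submodule.sum_mem _ fun i _ => hm i (v i) (hS v hv i) b hb hb'
    · intro r b hb _
      rw [← Algebra.smul_def]; exact M.smul_mem r hb
    · intro x y _ _ hx hy b hb hb'
      rw [add_mul]; exact M.add_mem (hx b hb hb') (hy b hb hb')
    · intro x y hx' hy' hx hy b hb hb'
      rw [mul_assoc]
      exact hx _ (hy b hb hb') (Subalgebra.mul_mem _ hy' hb')
  simpa using key 1 h1 (Subalgebra.one_mem _)

theorem ι_mem_sub {S : Set (⨁ i, V i)} {v : ⨁ i, V i} (hv : v ∈ S) :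
    ι V v ∈ FreeCGA.sub S := Algebra.subset_adjoin ⟨v, hv, rfl⟩

theorem sub_mono {S T : Set (⨁ i, V i)} (h : S ⊆ T) : FreeCGA.sub S ≤ FreeCGA.sub T :=
  Algebra.adjoin_mono (Set.image_mono h)

theorem ctr_mem_sub {S : Submodule ℚ (⨁ i, V i)} (hS : IsHomog S) {a : FreeCGA V}
    (ha : a ∈ FreeCGA.sub (S : Set (⨁ i, V i))) (x : HLie V) :
    ctr V x a ∈ FreeCGA.sub (S : Set (⨁ i, V i)) := by
  let M : Submodule ℚ (FreeCGA V) :=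
    { carrier := {a | ∀ x, ctr V x a ∈ FreeCGA.sub (S : Set (⨁ i, V i))}
      zero_mem' := by intro x; rw [map_zero]; exact zero_mem _
      add_mem' := by intro a b ha hb x; rw [map_add]; exact add_mem (ha x) (hb x)
      smul_mem' := by intro c a ha x; rw [map_smul]; exact Subalgebra.smul_mem _ (ha x) c }
  refine sub_le hS M ?_ ?_ ha x
  · intro x; rw [ctr_one]; exact zero_mem _
  · intro i v hv a ha ha' x
    rw [ctr_gen_mul]
    exact add_mem (Subalgebra.smul_mem _ ha' _) (Subalgebra.mul_mem _ (ι_mem_sub hv) (ha _))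

/-- On `⋀S` the contraction depends only on the restriction of `x` to `S`. Homogeneity of `S`
ensures that the twisted functionals `x ∘ sgn ^ i` vanish on `S` as well. -/
theorem ctr_eq_zero {S : Submodule ℚ (⨁ i, V i)} (hS : IsHomog S) {a : FreeCGA V}
    (ha : a ∈ FreeCGA.sub (S : Set (⨁ i, V i))) {x : HLie V} (hx : ∀ v ∈ S, x v = 0) :
    ctr V x a = 0 := by
  let M : Submodule ℚ (FreeCGA V) :=
    { carrier := {a | ∀ x : HLie V, (∀ v ∈ S, x v = 0) → ctr V x a = 0}
      zero_mem' := by intro x _; rw [map_zero]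
      add_mem' := by intro a b ha hb x hx; rw [map_add, ha x hx, hb x hx, add_zero]
      smul_mem' := by intro c a ha x hx; rw [map_smul, ha x hx, smul_zero] }
  refine sub_le hS M ?_ ?_ ha x hx
  · intro x _; rw [ctr_one]
  · intro i v hv a ha ha' x hx
    rw [ctr_gen_mul, hx _ hv, zero_smul, zero_add, ha, mul_zero]
    intro w hw
    have : ∀ k, (sgn V ^ k) w ∈ S := by
      intro k
      induction k with
      | zero => exact hw
      | succ k ih => rw [pow_succ']; exact hS.sgn_mem ih
    exact hx _ (this i)

theorem lin_mem {S : Submodule ℚ (⨁ i, V i)} (hS : IsHomog S) {a : FreeCGA V}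
    (ha : a ∈ FreeCGA.sub (S : Set (⨁ i, V i))) : lin V a ∈ S := by
  refine sub_le hS (S.comap (lin V)) ?_ ?_ ha
  · simp
  · intro i v hv a _ _
    rw [Submodule.mem_comap, lin_gen_mul]
    exact S.smul_mem _ hv

theorem comp_mem_sub {S : Submodule ℚ (⨁ i, V i)} (hS : IsHomog S) {a : FreeCGA V}
    (ha : a ∈ FreeCGA.sub (S : Set (⨁ i, V i))) (n : ℕ) :
    comp V n a ∈ FreeCGA.sub (S : Set (⨁ i, V i)) := by
  let M : Submodule ℚ (FreeCGA V) :=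
    ⨅ n, (Subalgebra.toSubmodule (FreeCGA.sub (S : Set (⨁ i, V i)))).comap (comp V n)
  have : a ∈ M := by
    refine sub_le hS M ?_ ?_ ha
    · refine (Submodule.mem_iInf _).2 fun n => ?_
      rw [Submodule.mem_comap, comp_apply, map_one, Polynomial.coeff_one]
      split_ifs
      · exact Subalgebra.one_mem _
      · exact zero_mem _
    · intro i v hv a ha _
      refine (Submodule.mem_iInf _).2 fun n => ?_
      rw [Submodule.mem_comap, comp_apply, map_mul, grd_gen]
      rcases le_or_gt i n with h | h
      · obtain ⟨m, rfl⟩ := Nat.exists_eq_add_of_le' h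
        rw [Polynomial.coeff_monomial_mul]
        exact Subalgebra.mul_mem _ (ι_mem_sub hv) ((Submodule.mem_iInf _).1 ha m)
      · have h2 : (Polynomial.monomial i (gen V i v) * grd V a).coeff n = 0 := by
          rw [← Polynomial.C_mul_X_pow_eq_monomial, mul_assoc, Polynomial.coeff_C_mul,
            Polynomial.X_pow_mul, Polynomial.coeff_mul_X_pow', if_neg (not_le.2 h), mul_zero]
        rw [h2]; exact zero_mem _
  exact (Submodule.mem_iInf _).1 this n

theorem map_mem_sub (f : ∀ i, V i →ₗ[ℚ] W i) {S : Set (⨁ i, V i)} {a : FreeCGA V}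
    (ha : a ∈ FreeCGA.sub S) :
    FreeCGA.map f a ∈ FreeCGA.sub (DirectSum.lmap f '' S) := by
  have : (FreeCGA.sub S).map (FreeCGA.map f) = FreeCGA.sub (DirectSum.lmap f '' S) := by
    rw [FreeCGA.sub, AlgHom.map_adjoin, FreeCGA.sub]
    congr 1
    ext b
    simp only [Set.mem_image, exists_exists_and_eq_and, map_ι]
  rw [← this]
  exact ⟨a, ha, rfl⟩

end Degrees

/-! ### Homogeneous components of functionals -/

section Components

variable {V : ℕ → Type*} [∀ i, AddCommGroup (V i)] [∀ i, Module ℚ (V i)]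

/-- The component of degree `p` of an element of `L_V`. -/
def HLie.comp (p : ℕ) (x : HLie V) : HLie V :=
  x ∘ₗ DirectSum.lof ℚ ℕ V (p + 1) ∘ₗ DirectSum.component ℚ ℕ V (p + 1)

theorem HLie.comp_mem (p : ℕ) (x : HLie V) : HLie.comp p x ∈ HLie.deg p := by
  intro i hi v
  simp only [HLie.comp, LinearMap.comp_apply, DirectSum.component.of]
  rw [dif_neg (Ne.symm (fun h => hi h.symm)), map_zero, map_zero]

theorem HLie.comp_comp_sgn (p : ℕ) (x : HLie V) :
    HLie.comp p (x ∘ₗ sgn V) = HLie.comp p x ∘ₗ sgn V := by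
  refine DirectSum.linearMap_ext _ fun j => LinearMap.ext fun v => ?_
  simp only [HLie.comp, LinearMap.comp_apply, sgn_lof, map_smul, DirectSum.component.of]
  split_ifs with h
  · subst h; simp
  · simp

/-- `L_V` is the product of its homogeneous parts, but a given vector meets only finitely many of
them, with a bound independent of `x`. Since degree `p` means concentration on `V^{p+1}`, no
component sees `V^0`, which has to vanish. -/
theorem HLie.apply_eq_sum (h0 : Subsingleton (V 0)) (v : ⨁ i, V i) :
    ∃ N, ∀ n ≥ N, ∀ x : HLie V, x v = ∑ p ∈ Finset.range n, HLie.comp p x v := by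
  induction v using DirectSum.induction_on with
  | zero => exact ⟨0, fun n _ x => by simp⟩
  | of i v =>
    refine ⟨i + 1, fun n hn x => ?_⟩
    rw [← DirectSum.lof_eq_of ℚ]
    cases i with
    | zero => rw [Subsingleton.elim v 0]; simp
    | succ j =>
      rw [Finset.sum_eq_single j]
      · simp [HLie.comp]
      · intro b _ hb
        exact HLie.comp_mem b x (j + 1) (by omega) v
      · intro h
        exact absurd (Finset.mem_range.2 (by omega)) h
  | add v w hv hw =>
    obtain ⟨N, hN⟩ := hv
    obtain ⟨M, hM⟩ := hw
    refine ⟨max N M, fun n hn x => ?_⟩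
    rw [map_add, hN n (le_trans (le_max_left _ _) hn) x, hM n (le_trans (le_max_right _ _) hn) x,
      ← Finset.sum_add_distrib]
    simp

theorem contract_eq_sum (h0 : Subsingleton (V 0)) {M : Type*} [AddCommGroup M] [Module ℚ M]
    (t : (⨁ i, V i) ⊗[ℚ] M) : ∃ N, ∀ n ≥ N, ∀ x : HLie V,
      contract x t = ∑ p ∈ Finset.range n, contract (HLie.comp p x) t := by
  induction t using TensorProduct.induction_on with
  | zero => exact ⟨0, fun n _ x => by simp⟩
  | tmul v m =>
    obtain ⟨N, hN⟩ := HLie.apply_eq_sum h0 v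
    refine ⟨N, fun n hn x => ?_⟩
    simp only [contract_tmul]
    rw [hN n hn x, Finset.sum_smul]
  | add v w hv hw =>
    obtain ⟨N, hN⟩ := hv
    obtain ⟨M, hM⟩ := hw
    refine ⟨max N M, fun n hn x => ?_⟩
    rw [map_add, hN n (le_trans (le_max_left _ _) hn) x, hM n (le_trans (le_max_right _ _) hn) x,
      ← Finset.sum_add_distrib]
    simp

theorem ctr_eq_sum (h0 : Subsingleton (V 0)) (a : FreeCGA V) : ∃ N, ∀ n ≥ N, ∀ x : HLie V,
    ctr V x a = ∑ p ∈ Finset.range n, ctr V (HLie.comp p x) a :=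
  contract_eq_sum h0 _

end Components

end

section

open FreeCGA

/-! ### Commutators with `d`, the coadjoint action and the bracket -/

section Differential

variable {V : ℕ → Type*} [∀ i, AddCommGroup (V i)] [∀ i, Module ℚ (V i)]
  {d : FreeCGA V →ₗ[ℚ] FreeCGA V}

/-- Writing the sign as the involution `tw V 1` makes the Leibniz rule linear in `a`, so the
homogeneous case suffices. -/
theorem isDer_of_deg (hdeg : ∀ n, ∀ a ∈ deg V n, d a ∈ deg V (n + 1))
    (hmul : ∀ n, ∀ a ∈ deg V n, ∀ b, d (a * b) = d a * b + (-1 : ℚ) ^ n • (a * d b)) :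
    IsDer 1 d where
  mul a b := by
    have := linearMap_ext_deg (f := d ∘ₗ LinearMap.mulRight ℚ b)
      (g := LinearMap.mulRight ℚ b ∘ₗ d + LinearMap.mulRight ℚ (d b) ∘ₗ (tw V 1).toLinearMap) (by
        intro n a ha
        simp [hmul n a ha b, tw_of_deg ha])
    exact LinearMap.congr_fun this a
  tw j a := by
    have := linearMap_ext_deg (f := d ∘ₗ (tw V j).toLinearMap)
      (g := (-1 : ℚ) ^ (j * 1) • (tw V j).toLinearMap ∘ₗ d) (by
        intro n a ha
        simp only [LinearMap.comp_apply, AlgHom.toLinearMap_apply, LinearMap.smul_apply,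
          tw_of_deg ha, tw_of_deg (hdeg n a ha), map_smul, smul_smul, ← pow_add]
        congr 1
        have : j * 1 + j * (n + 1) = j * n + 2 * j := by ring
        rw [this, pow_add, pow_mul]; simp)
    exact LinearMap.congr_fun this a

theorem wedgeGE_two_le {a : FreeCGA V} (ha : a ∈ wedgeGE V 2) : aug V a = 0 ∧ lin V a = 0 := by
  have : wedgeGE V 2 ≤ LinearMap.ker (aug V).toLinearMap ⊓ LinearMap.ker (lin V) := by
    refine iSup₂_le fun q hq => ?_
    obtain ⟨m, rfl⟩ := Nat.exists_eq_add_of_le' hq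
    rw [pow_succ, pow_succ, Submodule.mul_le]
    rintro b hb _ ⟨w, rfl⟩
    have hb' : aug V b = 0 := by
      have : LinearMap.range (ι V) ^ m * LinearMap.range (ι V) ≤
          LinearMap.ker (aug V).toLinearMap := by
        rw [Submodule.mul_le]
        rintro c _ _ ⟨w, rfl⟩
        simp
      exact this hb
    simp [lin_mul, hb']
  exact this ha

namespace IsMinimalSullivan

theorem isDer (hd : IsMinimalSullivan d) : IsDer 1 d := isDer_of_deg hd.degree hd.leibniz

theorem aug_gen (hd : IsMinimalSullivan d) (i : ℕ) (v : V i) : aug V (d (gen V i v)) = 0 :=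
  (wedgeGE_two_le (hd.minimal (DirectSum.lof ℚ ℕ V i v))).1

theorem aug_d (hd : IsMinimalSullivan d) (a : FreeCGA V) : aug V (d a) = 0 :=
  hd.isDer.aug_eq hd.aug_gen a

/-- Minimality concerns generators only; it propagates because the linear part of a derivation is
determined on the linear part of its argument. -/
theorem lin_d (hd : IsMinimalSullivan d) (a : FreeCGA V) : lin V (d a) = 0 := by
  rw [hd.isDer.lin_eq hd.aug_gen]
  exact (wedgeGE_two_le (hd.minimal _)).2

theorem algebraMap (hd : IsMinimalSullivan d) (c : ℚ) :
    d (algebraMap ℚ (FreeCGA V) c) = 0 := by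
  rw [Algebra.algebraMap_eq_smul_one, map_smul, hd.isDer.one, smul_zero]

theorem degZ (hd : IsMinimalSullivan d) {k : ℤ} {a : FreeCGA V} (ha : a ∈ degZ V k) :
    d a ∈ FreeCGA.degZ V (k + 1) := by
  rcases lt_or_ge k 0 with hk | hk
  · rw [degZ_of_neg hk, Submodule.mem_bot] at ha
    rw [ha, map_zero]; exact zero_mem _
  · obtain ⟨n, rfl⟩ := Int.eq_ofNat_of_zero_le hk
    have h := hd.degree n a (by rwa [← degZ_natCast])
    rw [← degZ_natCast] at h
    exact_mod_cast h

theorem comp_d (hd : IsMinimalSullivan d) (n : ℕ) (a : FreeCGA V) :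
    comp V (n + 1) (d a) = d (comp V n a) := by
  have := linearMap_ext_deg (f := comp V (n + 1) ∘ₗ d) (g := d ∘ₗ comp V n) (by
    intro m a ha
    simp only [LinearMap.comp_apply, comp_of_deg ha, comp_of_deg (hd.degree m a ha)]
    split_ifs with h1 h2 h2 <;> first | rfl | omega | simp)
  exact LinearMap.congr_fun this a

end IsMinimalSullivan

/-- The graded commutator of `I_x` and `d`. -/
def lieDer (d : FreeCGA V →ₗ[ℚ] FreeCGA V) (x : HLie V) : FreeCGA V →ₗ[ℚ] FreeCGA V :=
  ctr V x ∘ₗ d - d ∘ₗ ctr V (x ∘ₗ sgn V)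

theorem lieDer_apply (x : HLie V) (a : FreeCGA V) :
    lieDer d x a = ctr V x (d a) - d (ctr V (x ∘ₗ sgn V) a) := rfl

theorem lieDer_add (x y : HLie V) (a : FreeCGA V) :
    lieDer d (x + y) a = lieDer d x a + lieDer d y a := by
  simp only [lieDer_apply, LinearMap.add_comp, ctr_add, map_add]; abel

theorem lieDer_smul (c : ℚ) (x : HLie V) (a : FreeCGA V) :
    lieDer d (c • x) a = c • lieDer d x a := by
  simp only [lieDer_apply, LinearMap.smul_comp, ctr_smul, map_smul, smul_sub]

theorem lieDer_of_deg {p : ℕ} {x : HLie V} (hx : x ∈ HLie.deg p) :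
    lieDer d x = ctr V x ∘ₗ d - (-1 : ℚ) ^ (p + 1) • d ∘ₗ ctr V x := by
  refine LinearMap.ext fun a => ?_
  simp only [lieDer_apply, LinearMap.sub_apply, LinearMap.smul_apply, LinearMap.comp_apply,
    HLie.comp_sgn hx, ctr_smul, map_smul]

theorem lieDer_eq_sum (h0 : Subsingleton (V 0)) (a : FreeCGA V) : ∃ N, ∀ x : HLie V,
    lieDer d x a = ∑ p ∈ Finset.range N, lieDer d (HLie.comp p x) a := by
  obtain ⟨N, hN⟩ := ctr_eq_sum h0 a
  obtain ⟨M, hM⟩ := ctr_eq_sum h0 (d a)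
  refine ⟨max N M, fun x => ?_⟩
  simp only [lieDer_apply, Finset.sum_sub_distrib, ← map_sum]
  rw [hN (max N M) (le_max_left _ _), hM (max N M) (le_max_right _ _)]
  simp only [HLie.comp_comp_sgn]

/-- The (left) coadjoint action of `L_V` on `V`, `x · v = (sx ∘ sgn ⊗ 1)(d₁ v)`. -/
def coad (d : FreeCGA V →ₗ[ℚ] FreeCGA V) (x : HLie V) : (⨁ i, V i) →ₗ[ℚ] ⨁ i, V i :=
  lin V ∘ₗ ctr V (x ∘ₗ sgn V) ∘ₗ d ∘ₗ ι V

theorem coad_apply (x : HLie V) (v : ⨁ i, V i) :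
    coad d x v = lin V (ctr V (x ∘ₗ sgn V) (d (ι V v))) := rfl

/-- The right adjoint action of `y` is the transpose of its coadjoint action. All statements on
`L_V` are reduced in this way to statements on `V`. -/
theorem bracket_apply (x y : HLie V) (v : ⨁ i, V i) :
    HLie.bracket d x y v = x (coad d y v) := by
  rw [coad_apply, ← quad_eq]; rfl

theorem coad_add (x y : HLie V) (v : ⨁ i, V i) :
    coad d (x + y) v = coad d x v + coad d y v := by
  simp only [coad_apply, LinearMap.add_comp, ctr_add, map_add]

theorem coad_smul (c : ℚ) (x : HLie V) (v : ⨁ i, V i) :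
    coad d (c • x) v = c • coad d x v := by
  simp only [coad_apply, LinearMap.smul_comp, ctr_smul, map_smul]

theorem coad_eq_sum (h0 : Subsingleton (V 0)) (v : ⨁ i, V i) : ∃ N, ∀ n ≥ N, ∀ x : HLie V,
    coad d x v = ∑ p ∈ Finset.range n, coad d (HLie.comp p x) v := by
  obtain ⟨N, hN⟩ := ctr_eq_sum h0 (d (ι V v))
  refine ⟨N, fun n hn x => ?_⟩
  simp only [coad_apply, ← map_sum]
  rw [hN _ hn]
  simp only [HLie.comp_comp_sgn]

/-- On a generator the term `d I_x v` vanishes, because `I_x v` is a scalar; the sign comes from `x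
∘ sgn`. -/
theorem coad_of_deg (hd : IsMinimalSullivan d) {p : ℕ} {x : HLie V} (hx : x ∈ HLie.deg p)
    (v : ⨁ i, V i) : coad d x v = (-1 : ℚ) ^ (p + 1) • lin V (lieDer d x (ι V v)) := by
  rw [coad_apply, HLie.comp_sgn hx, ctr_smul, map_smul, lieDer_apply, ctr_ι, hd.algebraMap,
    sub_zero]

theorem isDer_lieDer (hd : IsMinimalSullivan d) {p : ℕ} {x : HLie V} (hx : x ∈ HLie.deg p) :
    IsDer (p + 1 + 1) (lieDer d x) := by
  have := (isDer_ctr hx).comm hd.isDer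
  rwa [mul_one, ← lieDer_of_deg hx] at this

/-- The constant term of `I_x d v` is `x` applied to the linear part of `d v`, which is zero by
minimality. -/
theorem aug_lieDer_gen (hd : IsMinimalSullivan d) (x : HLie V) (i : ℕ) (v : V i) :
    aug V (lieDer d x (gen V i v)) = 0 := by
  rw [lieDer_apply, ctr_gen, hd.algebraMap, sub_zero, ← lin_eq, hd.lin_d, map_zero]

theorem lieDer_d (hd : IsMinimalSullivan d) (x : HLie V) (a : FreeCGA V) :
    lieDer d x (d a) = - d (lieDer d (x ∘ₗ sgn V) a) := by
  simp [lieDer_apply, hd.square_zero]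

theorem lieDer_mem_sub {S : Submodule ℚ (⨁ i, V i)} (hS : IsHomog S)
    (hst : ∀ a ∈ FreeCGA.sub (S : Set (⨁ i, V i)), d a ∈ FreeCGA.sub (S : Set (⨁ i, V i)))
    {a : FreeCGA V} (ha : a ∈ FreeCGA.sub (S : Set (⨁ i, V i))) (x : HLie V) :
    lieDer d x a ∈ FreeCGA.sub (S : Set (⨁ i, V i)) :=
  sub_mem (ctr_mem_sub hS (hst a ha) _) (hst _ (ctr_mem_sub hS ha _))

theorem comp_sgn_apply_eq_zero {S : Submodule ℚ (⨁ i, V i)} (hS : IsHomog S) {x : HLie V}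
    (hx : ∀ v ∈ S, x v = 0) : ∀ v ∈ S, (x ∘ₗ sgn V) v = 0 :=
  fun _ hv => hx _ (hS.sgn_mem hv)

theorem lieDer_eq_zero {S : Submodule ℚ (⨁ i, V i)} (hS : IsHomog S)
    (hst : ∀ a ∈ FreeCGA.sub (S : Set (⨁ i, V i)), d a ∈ FreeCGA.sub (S : Set (⨁ i, V i)))
    {a : FreeCGA V} (ha : a ∈ FreeCGA.sub (S : Set (⨁ i, V i))) {x : HLie V}
    (hx : ∀ v ∈ S, x v = 0) : lieDer d x a = 0 := by
  rw [lieDer_apply, ctr_eq_zero hS (hst a ha) hx, ctr_eq_zero hS ha (comp_sgn_apply_eq_zero hS hx),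
    map_zero, sub_zero]

theorem coad_eq_zero {S : Submodule ℚ (⨁ i, V i)} (hS : IsHomog S)
    (hst : ∀ a ∈ FreeCGA.sub (S : Set (⨁ i, V i)), d a ∈ FreeCGA.sub (S : Set (⨁ i, V i)))
    {w : ⨁ i, V i} (hw : w ∈ S) {x : HLie V} (hx : ∀ v ∈ S, x v = 0) : coad d x w = 0 := by
  rw [coad_apply, ctr_eq_zero hS (hst _ (ι_mem_sub hw)) (comp_sgn_apply_eq_zero hS hx), map_zero]

theorem coad_mem {S : Submodule ℚ (⨁ i, V i)} (hS : IsHomog S) {v : ⨁ i, V i}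
    (hst : d (ι V v) ∈ FreeCGA.sub (S : Set (⨁ i, V i))) (x : HLie V) : coad d x v ∈ S :=
  lin_mem hS (ctr_mem_sub hS hst _)

/-- For `v` of degree `i`, the value is up to sign the constant term of an element of degree `i + 1
- (p + 1) - (q + 1)`; it can be nonzero only for `i = p + q + 1`. -/
theorem bracket_mem_deg (hd : IsMinimalSullivan d) {p q : ℕ} {x y : HLie V}
    (hx : x ∈ HLie.deg p) (hy : y ∈ HLie.deg q) : HLie.bracket d x y ∈ HLie.deg (p + q) := by
  intro i hi v
  rw [bracket_apply, coad_apply, HLie.comp_sgn hy, ctr_smul, map_smul, map_smul, lin_eq, ι_lof]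
  have h1 : gen V i v ∈ degZ V i := by rw [degZ_natCast]; exact gen_mem_deg i v
  rw [aug_eq_zero_of_degZ _ (ctr_mem_degZ hx (ctr_mem_degZ hy (hd.degZ h1))), smul_zero]
  omega

/-- Antisymmetry of the bracket, for `x` homogeneous. -/
theorem bracket_symm {p q : ℕ} {x y : HLie V} (hx : x ∈ HLie.deg p) (hy : y ∈ HLie.deg q) :
    HLie.bracket d x y = -(-1 : ℚ) ^ (p * q) • HLie.bracket d y x := by
  refine LinearMap.ext fun v => ?_
  simp only [LinearMap.smul_apply, bracket_apply, coad_apply, HLie.comp_sgn hx, HLie.comp_sgn hy,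
    ctr_smul, map_smul, lin_eq, smul_eq_mul]
  rw [ctr_ctr hx hy, map_smul, smul_eq_mul, ← mul_assoc, ← mul_assoc]
  congr 1
  have h : (-1 : ℚ) ^ q * (-1) ^ q = 1 := by rw [← mul_pow]; simp
  rw [add_mul, mul_add]
  simp only [pow_add, pow_one, mul_one, one_mul]
  linear_combination ((-1 : ℚ) ^ (p * q) * (-1) ^ p) * h

/-- Up to a graded commutator with `d`, `x ↦ -L_x` is a representation of the graded Lie algebra. -/
theorem lieDer_lieDer (hd : IsMinimalSullivan d) {p q : ℕ} {x y : HLie V}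
    (hx : x ∈ HLie.deg p) (hy : y ∈ HLie.deg q) :
    ∃ (K : FreeCGA V →ₗ[ℚ] FreeCGA V) (k : ℕ) (s : ℚ), IsDer k K ∧
      (∀ i (v : V i), aug V (K (gen V i v)) = 0) ∧
      (∀ P : Submodule ℚ (FreeCGA V), (∀ a ∈ P, d a ∈ P) → (∀ z, ∀ a ∈ P, ctr V z a ∈ P) →
        ∀ a ∈ P, K a ∈ P) ∧
      ∀ a, lieDer d x (lieDer d y a) = (-1 : ℚ) ^ (p * q) • lieDer d y (lieDer d x a) -
        lieDer d (HLie.bracket d x y) a + (K (d a) + s • d (K a)) := by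
  set e : ℚ := (-1) ^ p with he
  set f : ℚ := (-1) ^ q with hf
  set g : ℚ := (-1) ^ (p * q) with hg
  have hee : e * e = 1 := by rw [he, ← mul_pow]; simp
  have hff : f * f = 1 := by rw [hf, ← mul_pow]; simp
  have hgg : g * g = 1 := by rw [hg, ← mul_pow]; simp
  have hb := bracket_mem_deg hd hx hy
  -- the graded commutator of `L_y` and `I_x`
  have hK := (isDer_lieDer hd hy).comm (isDer_ctr hx)
  have hsgn : (-1 : ℚ) ^ ((q + 1 + 1) * (p + 1)) = g * f := by
    rw [hg, hf]
    have : (q + 1 + 1) * (p + 1) = p * q + q + 2 * (p + 1) := by ring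
    rw [this, pow_add, pow_add, pow_mul (-1 : ℚ) 2]; simp
  rw [hsgn] at hK
  have hB : IsDer (q + 1 + 1 + (p + 1)) (ctr V (HLie.bracket d x y)) :=
    (isDer_ctr hb).congr (by
      have : q + 1 + 1 + (p + 1) = (p + q + 1) + 2 * 1 := by ring
      rw [this, pow_add _ (p + q + 1), pow_mul]; simp)
  -- Up to sign `K` is the difference between the commutator of `L_y` with `I_x` and a multiple of
  -- `I_{[x,y]}`. It would vanish for a purely quadratic `d`; the higher terms of `d` contribute in
  -- general, but the multiple is chosen so that the constant terms on generators cancel. Commuting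
  -- `K` with `d` then produces the identity.
  refine ⟨-g • (lieDer d y ∘ₗ ctr V x - (g * f) • ctr V x ∘ₗ lieDer d y +
      (-g) • ctr V (HLie.bracket d x y)), q + 1 + 1 + (p + 1), e * f,
      (hK.add (hB.smul _)).smul _, ?_, ?_, ?_⟩
  · intro i v
    simp only [LinearMap.smul_apply, LinearMap.add_apply, LinearMap.sub_apply,
      LinearMap.comp_apply, map_smul, map_add, map_sub, ctr_gen, AlgHom.commutes]
    have h1 : ∀ c : ℚ, lieDer d y (algebraMap ℚ _ c) = 0 := by
      intro c
      rw [Algebra.algebraMap_eq_smul_one, map_smul, (isDer_lieDer hd hy).one, smul_zero]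
    rw [h1, map_zero, lieDer_apply, ctr_gen, hd.algebraMap, sub_zero, bracket_apply, coad_apply,
      HLie.comp_sgn hy, ctr_smul, map_smul, map_smul, lin_eq, ι_lof, pow_succ, ← hf]
    simp only [smul_eq_mul, Algebra.algebraMap_self, RingHom.id_apply]
    ring
  · intro P hPd hPc a ha
    simp only [LinearMap.smul_apply, LinearMap.add_apply, LinearMap.sub_apply,
      LinearMap.comp_apply, lieDer_apply]
    refine P.smul_mem _ (P.add_mem (P.sub_mem (P.sub_mem ?_ ?_) (P.smul_mem _ ?_))
      (P.smul_mem _ ?_))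
    · exact hPc _ _ (hPd _ (hPc _ _ ha))
    · exact hPd _ (hPc _ _ (hPc _ _ ha))
    · exact hPc _ _ (P.sub_mem (hPc _ _ (hPd _ ha)) (hPd _ (hPc _ _ ha)))
    · exact hPc _ _ ha
  · intro a
    simp only [lieDer_of_deg hx, lieDer_of_deg hy, lieDer_of_deg hb, LinearMap.smul_apply,
      LinearMap.add_apply, LinearMap.sub_apply, LinearMap.comp_apply, map_sub, map_add, map_smul,
      hd.square_zero, map_zero, map_neg, smul_zero, sub_zero, zero_sub, pow_succ, pow_add]
    rw [← he, ← hf]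
    clear_value e f g
    clear he hf hg hsgn hK
    -- After expansion only the signs `(-1)^p`, `(-1)^q` and `(-1)^{pq}` occur. Treated as
    -- independent, they leave eight linear identities.
    rcases mul_self_eq_one_iff.1 hee with rfl | rfl <;>
    rcases mul_self_eq_one_iff.1 hff with rfl | rfl <;>
    rcases mul_self_eq_one_iff.1 hgg with rfl | rfl <;>
    module

/-- The coadjoint action is a representation of the graded Lie algebra `L_V`. -/
theorem coad_coad (hd : IsMinimalSullivan d) {p q : ℕ} {x y : HLie V}
    (hx : x ∈ HLie.deg p) (hy : y ∈ HLie.deg q) (v : ⨁ i, V i) :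
    coad d x (coad d y v) = (-1 : ℚ) ^ (p * q) • coad d y (coad d x v) +
      coad d (HLie.bracket d x y) v := by
  obtain ⟨K, k, s, hK, hK0, -, h⟩ := lieDer_lieDer hd hx hy
  have key := congrArg (lin V) (h (ι V v))
  -- The homotopy terms have no linear part: `d` has none by minimality, and `K` has no constant
  -- term on generators, so the linear part of `K (d v)` is governed by that of `d v`.
  have h1 : lin V (K (d (ι V v))) = 0 := by
    rw [hK.lin_eq hK0, hd.lin_d]; simp
  have h2 : ∀ {p : ℕ} {x : HLie V} (_ : x ∈ HLie.deg p) (a : FreeCGA V),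
      lin V (lieDer d x (ι V (lin V a))) = lin V (lieDer d x a) := fun hx a =>
    ((isDer_lieDer hd hx).lin_eq (aug_lieDer_gen hd _) a).symm
  simp only [map_add, map_sub, map_smul, h1, hd.lin_d, smul_zero, add_zero] at key
  simp only [coad_of_deg hd hx, coad_of_deg hd hy, coad_of_deg hd (bracket_mem_deg hd hx hy),
    map_smul, h2 hx, h2 hy, key, pow_succ, pow_add]
  module

end Differential

end

section

open FreeCGA

/-! ### Exhaustion by finite dimensional stable subspaces, and local nilpotence -/

section Exhaustion

variable {V : ℕ → Type*} [∀ i, AddCommGroup (V i)] [∀ i, Module ℚ (V i)]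
  {d : FreeCGA V →ₗ[ℚ] FreeCGA V}

/-- For a derivation `d`, stability of `⋀C` may be checked on `C`. -/
def Idx.ofGenerators (hd : IsDer 1 d) (C : Submodule ℚ (⨁ i, V i)) (hf : FiniteDimensional ℚ C)
    (hC : IsHomog C) (h : ∀ v ∈ C, d (FreeCGA.ι V v) ∈ FreeCGA.sub (C : Set (⨁ i, V i))) :
    Idx d where
  carrier := C
  finite := hf
  homogeneous := hC
  stable := fun a ha => by
    refine sub_le hC ((Subalgebra.toSubmodule (FreeCGA.sub (C : Set (⨁ i, V i)))).comap d)
      ?_ ?_ ha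
    · rw [Submodule.mem_comap, hd.one]; exact zero_mem _
    · intro i v hv a ha ha'
      rw [Submodule.mem_comap, hd.gen_mul]
      exact add_mem (Subalgebra.mul_mem _ (h _ hv) ha')
        (Subalgebra.smul_mem _ (Subalgebra.mul_mem _ (ι_mem_sub hv) ha) _)

theorem Idx.homog (S : Idx d) : IsHomog S.1 := S.homogeneous

/-- The index set is directed. -/
def Idx.sup (hd : IsDer 1 d) (S T : Idx d) : Idx d :=
  Idx.ofGenerators hd (S.1 ⊔ T.1)
    (by have := S.finite; have := T.finite; infer_instance) (S.homog.sup T.homog) (by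
      intro v hv
      obtain ⟨s, hs, t, ht, rfl⟩ := Submodule.mem_sup.1 hv
      rw [map_add, map_add]
      exact add_mem (sub_mono (le_sup_left : S.1 ≤ S.1 ⊔ T.1) (S.stable _ (ι_mem_sub hs)))
        (sub_mono (le_sup_right : T.1 ≤ S.1 ⊔ T.1) (T.stable _ (ι_mem_sub ht))))

theorem Idx.le_sup_left (hd : IsDer 1 d) (S T : Idx d) : S.1 ≤ (Idx.sup hd S T).1 :=
  _root_.le_sup_left

theorem Idx.le_sup_right (hd : IsDer 1 d) (S T : Idx d) : T.1 ≤ (Idx.sup hd S T).1 :=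
  _root_.le_sup_right

/-- The zero subspace. -/
def Idx.zero (hd : IsDer 1 d) : Idx d :=
  Idx.ofGenerators hd ⊥ inferInstance
    (by intro v hv i; rw [Submodule.mem_bot] at hv; subst hv; simp)
    (by intro v hv; rw [Submodule.mem_bot] at hv; subst hv; simp)

/-- The differential of the degree `i` component of `v` is the degree `i + 1` component of `d v`,
and `⋀V(n)` is closed under taking components. -/
theorem sullivanFiltration_isHomog (hd : IsMinimalSullivan d) (n : ℕ) :
    IsHomog (sullivanFiltration d n) := by
  have hc : ∀ (v : ⨁ i, V i) i, d (FreeCGA.ι V (DirectSum.lof ℚ ℕ V i (v i))) =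
      FreeCGA.comp V (i + 1) (d (FreeCGA.ι V v)) := by
    intro v i
    rw [hd.comp_d, comp_ι]; rfl
  induction n with
  | zero =>
    intro v hv i
    have hv' : d (FreeCGA.ι V v) = 0 := hv
    show d (FreeCGA.ι V _) = 0
    rw [hc, hv', map_zero]
  | succ n ih =>
    intro v hv i
    have hv' : d (FreeCGA.ι V v) ∈ FreeCGA.sub (sullivanFiltration d n : Set (⨁ i, V i)) := hv
    show d (FreeCGA.ι V _) ∈ FreeCGA.sub (sullivanFiltration d n : Set (⨁ i, V i))
    rw [hc]
    exact comp_mem_sub ih hv' _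

theorem sullivanFiltration_succ {n : ℕ} {v : ⨁ i, V i} :
    v ∈ sullivanFiltration d (n + 1) ↔
      d (FreeCGA.ι V v) ∈ FreeCGA.sub (sullivanFiltration d n : Set (⨁ i, V i)) := Iff.rfl

theorem sullivanFiltration_mono : Monotone (sullivanFiltration d) := by
  refine monotone_nat_of_le_succ fun n => ?_
  induction n with
  | zero =>
    intro v hv
    have hv' : d (FreeCGA.ι V v) = 0 := hv
    rw [sullivanFiltration_succ, hv']
    exact zero_mem _
  | succ n ih =>
    intro v hv
    exact sub_mono ih hv

/-- An element of `⋀U` involves finitely many generators, and the index set is directed. -/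
theorem exists_idx_sub {U : Submodule ℚ (⨁ i, V i)} (hd : IsDer 1 d)
    (hU : ∀ v ∈ U, ∃ S : Idx d, v ∈ S.1) {a : FreeCGA V}
    (ha : a ∈ FreeCGA.sub (U : Set (⨁ i, V i))) :
    ∃ S : Idx d, a ∈ FreeCGA.sub (S.1 : Set (⨁ i, V i)) := by
  refine Algebra.adjoin_induction ?_ ?_ ?_ ?_ ha
  · rintro _ ⟨v, hv, rfl⟩
    obtain ⟨S, hS⟩ := hU v hv
    exact ⟨S, ι_mem_sub hS⟩
  · intro r
    exact ⟨Idx.zero hd, Subalgebra.algebraMap_mem _ r⟩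
  · rintro x y _ _ ⟨S, hS⟩ ⟨T, hT⟩
    exact ⟨Idx.sup hd S T, add_mem (sub_mono (Idx.le_sup_left hd S T) hS)
      (sub_mono (Idx.le_sup_right hd S T) hT)⟩
  · rintro x y _ _ ⟨S, hS⟩ ⟨T, hT⟩
    exact ⟨Idx.sup hd S T, mul_mem (sub_mono (Idx.le_sup_left hd S T) hS)
      (sub_mono (Idx.le_sup_right hd S T) hT)⟩

/-- `V` is the union of the index set. -/
theorem exists_idx_mem (hd : IsMinimalSullivan d) (v : ⨁ i, V i) : ∃ S : Idx d, v ∈ S.1 := by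
  have hsum : ∀ v : ⨁ i, V i, (∀ i, ∃ S : Idx d, DirectSum.lof ℚ ℕ V i (v i) ∈ S.1) →
      ∃ S : Idx d, v ∈ S.1 := by
    intro v hv
    obtain ⟨s, hs⟩ := eq_sum_lof v
    rw [hs]
    clear hs
    classical
    induction s using Finset.induction_on with
    | empty => exact ⟨Idx.zero hd.isDer, by simp⟩
    | insert i s hi ih =>
      obtain ⟨S, hS⟩ := ih
      obtain ⟨T, hT⟩ := hv i
      rw [Finset.sum_insert hi]
      exact ⟨Idx.sup hd.isDer S T, add_mem (Idx.le_sup_right hd.isDer S T hT)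
        (Idx.le_sup_left hd.isDer S T hS)⟩
  -- A homogeneous generator whose differential lies in `⋀S` may be adjoined to `S`. For `v ∈
  -- V(n+1)` such an `S` is found by induction, since `d v` lies in `⋀V(n)`.
  have hadd : ∀ (i : ℕ) (v : V i) (S : Idx d),
      d (FreeCGA.ι V (DirectSum.lof ℚ ℕ V i v)) ∈ FreeCGA.sub (S.1 : Set (⨁ i, V i)) →
      ∃ S : Idx d, DirectSum.lof ℚ ℕ V i v ∈ S.1 := by
    intro i v S hS
    refine ⟨Idx.ofGenerators hd.isDer (S.1 ⊔ Submodule.span ℚ {DirectSum.lof ℚ ℕ V i v})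
      (by have := S.finite; infer_instance) (S.homog.sup (isHomog_span_lof i v)) ?_,
      Submodule.mem_sup_right (Submodule.mem_span_singleton_self _)⟩
    intro w hw
    obtain ⟨s, hs, t, ht, rfl⟩ := Submodule.mem_sup.1 hw
    obtain ⟨c, rfl⟩ := Submodule.mem_span_singleton.1 ht
    rw [map_add, map_add, map_smul, map_smul]
    refine add_mem (sub_mono (le_sup_left : S.1 ≤ S.1 ⊔ _) (S.stable _ (ι_mem_sub hs)))
      (Subalgebra.smul_mem _ (sub_mono (le_sup_left : S.1 ≤ S.1 ⊔ _) hS) _)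
  obtain ⟨n, hn⟩ := hd.sullivan v
  induction n generalizing v with
  | zero =>
    refine hsum v fun i => hadd i (v i) (Idx.zero hd.isDer) ?_
    have h : d (FreeCGA.ι V _) = 0 := sullivanFiltration_isHomog hd 0 v hn i
    rw [h]; exact zero_mem _
  | succ n ih =>
    refine hsum v fun i => ?_
    have h := sullivanFiltration_succ.1 (sullivanFiltration_isHomog hd (n + 1) v hn i)
    obtain ⟨S, hS⟩ := exists_idx_sub hd.isDer ih h
    exact hadd i (v i) S hS

theorem exists_idx_le (hd : IsMinimalSullivan d) (U : Submodule ℚ (⨁ i, V i)) (hU : U.FG) :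
    ∃ S : Idx d, U ≤ S.1 := by
  refine Submodule.fg_induction (motive := fun U _ => ∃ S : Idx d, U ≤ S.1) ?_ ?_ U hU
  · intro v
    obtain ⟨S, hS⟩ := exists_idx_mem hd v
    exact ⟨S, (Submodule.span_singleton_le_iff_mem _ _).2 hS⟩
  · rintro M N - - ⟨S, hS⟩ ⟨T, hT⟩
    exact ⟨Idx.sup hd.isDer S T, sup_le_sup hS hT⟩

theorem exists_idx_mem_sub (hd : IsMinimalSullivan d) (a : FreeCGA V) :
    ∃ S : Idx d, a ∈ FreeCGA.sub (S.1 : Set (⨁ i, V i)) := by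
  refine exists_idx_sub (U := ⊤) hd.isDer (fun v _ => exists_idx_mem hd v) ?_
  refine mem_of_gen_mul (Subalgebra.toSubmodule (FreeCGA.sub ((⊤ : Submodule ℚ (⨁ i, V i)) : Set (⨁ i, V i))))
      (Subalgebra.one_mem _) ?_ a
  intro i v a ha
  exact Subalgebra.mul_mem _ (ι_mem_sub (by trivial)) ha

theorem exists_le_sullivanFiltration (hd : IsMinimalSullivan d) (S : Idx d) :
    ∃ n, S.1 ≤ sullivanFiltration d n := by
  have := S.finite
  refine Submodule.fg_induction (motive := fun U _ => ∃ n, U ≤ sullivanFiltration d n) ?_ ?_ S.1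
    (Module.Finite.iff_fg.1 S.finite)
  · intro v
    obtain ⟨n, hn⟩ := hd.sullivan v
    exact ⟨n, (Submodule.span_singleton_le_iff_mem _ _).2 hn⟩
  · rintro M N - - ⟨m, hm⟩ ⟨n, hn⟩
    exact ⟨max m n, sup_le (hm.trans (sullivanFiltration_mono (le_max_left _ _)))
      (hn.trans (sullivanFiltration_mono (le_max_right _ _)))⟩

/-- The filtration `0 ⊆ V(0) ⊆ V(1) ⊆ ⋯`, lowered by the coadjoint action. -/
def coadFiltration (d : FreeCGA V →ₗ[ℚ] FreeCGA V) : ℕ → Submodule ℚ (⨁ i, V i)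
  | 0 => ⊥
  | n + 1 => sullivanFiltration d n

theorem coadFiltration_mono : Monotone (coadFiltration d) := by
  refine monotone_nat_of_le_succ fun n => ?_
  cases n with
  | zero => exact bot_le
  | succ n => exact sullivanFiltration_mono (Nat.le_succ n)

theorem coad_mem_coadFiltration (hd : IsMinimalSullivan d) (x : HLie V) {n : ℕ} {v : ⨁ i, V i}
    (hv : v ∈ coadFiltration d (n + 1)) : coad d x v ∈ coadFiltration d n := by
  cases n with
  | zero =>
    have hv' : d (FreeCGA.ι V v) = 0 := hv
    rw [coad_apply, hv', map_zero, map_zero]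
    exact zero_mem _
  | succ n => exact coad_mem (sullivanFiltration_isHomog hd n) (sullivanFiltration_succ.1 hv) x

/-- The elements of `⋀V` killed by all the `n`-fold products of operators `L_x`. -/
def lieNil (d : FreeCGA V →ₗ[ℚ] FreeCGA V) : ℕ → Submodule ℚ (FreeCGA V)
  | 0 => ⊥
  | n + 1 => ⨅ p : ℕ, ⨅ x : HLie.deg (V := V) p, (lieNil d n).comap (lieDer d x.1)

theorem mem_lieNil_succ {n : ℕ} {a : FreeCGA V} :
    a ∈ lieNil d (n + 1) ↔ ∀ p, ∀ x ∈ HLie.deg (V := V) p, lieDer d x a ∈ lieNil d n := by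
  simp [lieNil]

theorem lieNil_mono : Monotone (lieNil d) := by
  refine monotone_nat_of_le_succ fun n => ?_
  induction n with
  | zero => exact bot_le
  | succ n ih =>
    intro a ha
    rw [mem_lieNil_succ] at ha ⊢
    exact fun p x hx => ih (ha p x hx)

/-- `lieNil` quantifies over homogeneous `x`, for which `L_x` is a derivation; on a fixed `a` any
`L_x` is a finite sum of these. -/
theorem lieDer_mem_lieNil (hd : IsMinimalSullivan d) {n : ℕ} {a : FreeCGA V}
    (ha : a ∈ lieNil d (n + 1)) (x : HLie V) : lieDer d x a ∈ lieNil d n := by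
  obtain ⟨N, hN⟩ := lieDer_eq_sum (d := d) hd.connected a
  rw [hN]
  exact Submodule.sum_mem _ fun p _ => mem_lieNil_succ.1 ha p _ (HLie.comp_mem p x)

theorem tw_mem_lieNil (hd : IsMinimalSullivan d) (k : ℕ) {n : ℕ} {a : FreeCGA V}
    (ha : a ∈ lieNil d n) : tw V k a ∈ lieNil d n := by
  induction n generalizing a with
  | zero =>
    have : a = 0 := ha
    rw [this, map_zero]; exact zero_mem _
  | succ n ih =>
    rw [mem_lieNil_succ] at ha ⊢
    intro p x hx
    rw [(isDer_lieDer hd hx).tw]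
    exact Submodule.smul_mem _ _ (ih (ha p x hx))

/-- By the Leibniz rule each operator lowers the level of one of the two factors, until one of them
is zero. -/
theorem mul_mem_lieNil (hd : IsMinimalSullivan d) {m n k : ℕ} (hk : m + n ≤ k) {a b : FreeCGA V}
    (ha : a ∈ lieNil d m) (hb : b ∈ lieNil d n) : a * b ∈ lieNil d k := by
  induction k generalizing m n a b with
  | zero =>
    have : m = 0 := by omega
    subst this
    have : a = 0 := ha
    rw [this, zero_mul]; exact zero_mem _
  | succ k ih =>
    cases m with
    | zero =>
      have : a = 0 := ha
      rw [this, zero_mul]; exact zero_mem _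
    | succ m =>
      cases n with
      | zero =>
        have : b = 0 := hb
        rw [this, mul_zero]; exact zero_mem _
      | succ n =>
        rw [mem_lieNil_succ]
        intro p x hx
        rw [(isDer_lieDer hd hx).mul]
        exact add_mem (ih (m := m) (n := n + 1) (by omega) (mem_lieNil_succ.1 ha p x hx) hb)
          (ih (m := m + 1) (n := n) (by omega) (tw_mem_lieNil hd _ ha)
            (mem_lieNil_succ.1 hb p x hx))

theorem one_mem_lieNil (hd : IsMinimalSullivan d) : (1 : FreeCGA V) ∈ lieNil d 1 := by
  rw [mem_lieNil_succ]
  intro p x hx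
  rw [(isDer_lieDer hd hx).one]; exact zero_mem _

/-- `split` of `a` is a finite sum of tensors, whose second factors span such a `P`. Finiteness
uniform in `x` is what makes nilpotence uniform in `x`. -/
theorem exists_fg_ctr (a : FreeCGA V) : ∃ P : Submodule ℚ (FreeCGA V), P.FG ∧
    ∀ x, ctr V x a ∈ P := by
  simp only [ctr, LinearMap.comp_apply]
  generalize split (fun _ => LinearMap.id) (fun _ => LinearMap.id) a = t
  induction t using TensorProduct.induction_on with
  | zero => exact ⟨⊥, Submodule.fg_bot, fun x => by simp⟩
  | tmul u m =>
    refine ⟨Submodule.span ℚ {m}, Submodule.fg_span_singleton m, fun x => ?_⟩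
    rw [contract_tmul]
    exact Submodule.smul_mem _ _ (Submodule.mem_span_singleton_self m)
  | add s t hs ht =>
    obtain ⟨P, hP, hP'⟩ := hs
    obtain ⟨Q, hQ, hQ'⟩ := ht
    refine ⟨P ⊔ Q, hP.sup hQ, fun x => ?_⟩
    rw [map_add]
    exact Submodule.add_mem_sup (hP' x) (hQ' x)

theorem exists_le_lieNil {P : Submodule ℚ (FreeCGA V)} (hP : P.FG)
    (h : ∀ a ∈ P, ∃ n, a ∈ lieNil d n) : ∃ n, P ≤ lieNil d n := by
  revert h
  refine Submodule.fg_induction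
    (motive := fun P _ => (∀ a ∈ P, ∃ n, a ∈ lieNil d n) → ∃ n, P ≤ lieNil d n) ?_ ?_ P hP
  · intro a h
    obtain ⟨n, hn⟩ := h a (Submodule.mem_span_singleton_self a)
    exact ⟨n, (Submodule.span_singleton_le_iff_mem _ _).2 hn⟩
  · intro M N _ _ hM hN h
    obtain ⟨m, hm⟩ := hM fun a ha => h a (Submodule.mem_sup_left ha)
    obtain ⟨n, hn⟩ := hN fun a ha => h a (Submodule.mem_sup_right ha)
    exact ⟨max m n, sup_le (hm.trans (lieNil_mono (le_max_left _ _)))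
      (hn.trans (lieNil_mono (le_max_right _ _)))⟩

theorem exists_mem_lieNil_of_sub (hd : IsMinimalSullivan d) {U : Submodule ℚ (⨁ i, V i)}
    (hU : ∀ v ∈ U, ∃ n, FreeCGA.ι V v ∈ lieNil d n) {a : FreeCGA V}
    (ha : a ∈ FreeCGA.sub (U : Set (⨁ i, V i))) : ∃ n, a ∈ lieNil d n := by
  refine Algebra.adjoin_induction ?_ ?_ ?_ ?_ ha
  · rintro _ ⟨v, hv, rfl⟩
    exact hU v hv
  · intro r
    rw [Algebra.algebraMap_eq_smul_one]
    exact ⟨1, Submodule.smul_mem _ _ (one_mem_lieNil hd)⟩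
  · rintro x y _ _ ⟨m, hm⟩ ⟨n, hn⟩
    exact ⟨max m n, add_mem (lieNil_mono (le_max_left _ _) hm)
      (lieNil_mono (le_max_right _ _) hn)⟩
  · rintro x y _ _ ⟨m, hm⟩ ⟨n, hn⟩
    exact ⟨m + n, mul_mem_lieNil hd le_rfl hm hn⟩

/-- The operators `L_x` are locally nilpotent on `⋀V`. -/
theorem exists_mem_lieNil (hd : IsMinimalSullivan d) (a : FreeCGA V) : ∃ n, a ∈ lieNil d n := by
  have hL : ∀ (x : HLie V) (v : ⨁ i, V i),
      lieDer d x (FreeCGA.ι V v) = ctr V x (d (FreeCGA.ι V v)) := by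
    intro x v
    rw [lieDer_apply, ctr_ι, hd.algebraMap, sub_zero]
  have hfilt : ∀ n, ∀ v ∈ sullivanFiltration d n, ∃ m, FreeCGA.ι V v ∈ lieNil d m := by
    intro n
    induction n with
    | zero =>
      intro v hv
      have hv' : d (FreeCGA.ι V v) = 0 := hv
      refine ⟨1, mem_lieNil_succ.2 fun p x hx => ?_⟩
      rw [hL, hv', map_zero]; exact zero_mem _
    | succ n ih =>
      intro v hv
      have hv' := sullivanFiltration_succ.1 hv
      obtain ⟨P, hP, hPx⟩ := exists_fg_ctr (d (FreeCGA.ι V v))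
      -- As `x` varies, `L_x v = I_x d v` stays in a finite dimensional subspace of `⋀V(n)`, so one
      -- exponent given by induction serves all `x`.
      have hR : (P ⊓ Subalgebra.toSubmodule
          (FreeCGA.sub (sullivanFiltration d n : Set (⨁ i, V i)))).FG := by
        have : FiniteDimensional ℚ P := Module.Finite.iff_fg.2 hP
        have := Submodule.finiteDimensional_of_le
          (inf_le_left : P ⊓ Subalgebra.toSubmodule
            (FreeCGA.sub (sullivanFiltration d n : Set (⨁ i, V i))) ≤ P)
        exact Module.Finite.iff_fg.1 this
      obtain ⟨m, hm⟩ := exists_le_lieNil (d := d) hR fun a ha =>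
        exists_mem_lieNil_of_sub hd ih ha.2
      refine ⟨m + 1, mem_lieNil_succ.2 fun p x _ => ?_⟩
      rw [hL]
      exact hm ⟨hPx x, ctr_mem_sub (sullivanFiltration_isHomog hd n) hv' x⟩
  refine exists_mem_lieNil_of_sub (U := ⊤) hd (fun v _ => ?_) ?_
  · obtain ⟨n, hn⟩ := hd.sullivan v
    exact hfilt n v hn
  · refine mem_of_gen_mul (Subalgebra.toSubmodule (FreeCGA.sub ((⊤ : Submodule ℚ (⨁ i, V i)) : Set (⨁ i, V i))))
      (Subalgebra.one_mem _) ?_ a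
    intro i v a ha
    exact Subalgebra.mul_mem _ (ι_mem_sub (by trivial)) ha

end Exhaustion

end

section

open FreeCGA

/-! ### Density of the free algebra on `L_V` and extension of representations to the completion -/

section Density

variable {V : ℕ → Type*} [∀ i, AddCommGroup (V i)] [∀ i, Module ℚ (V i)]
  {d : FreeCGA V →ₗ[ℚ] FreeCGA V}

theorem Idx.res_surjective (S : Idx d) : Function.Surjective S.res :=
  LinearMap.dualMap_surjective_of_injective S.1.injective_subtype

theorem Idx.res_eq_zero {S : Idx d} {x : HLie V} : S.res x = 0 ↔ ∀ v ∈ S.1, x v = 0 := by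
  refine ⟨fun h v hv => LinearMap.congr_fun h ⟨v, hv⟩, fun h => LinearMap.ext fun v => h v v.2⟩

/-- The morphism from the free algebra on `L_V` to `UL_S`. -/
def UEnv.ofFree (S : Idx d) : TensorAlgebra ℚ (HLie V) →ₐ[ℚ] UEnv S :=
  TensorAlgebra.lift ℚ (UEnv.ι S ∘ₗ S.res)

@[simp] theorem UEnv.ofFree_ι (S : Idx d) (x : HLie V) :
    UEnv.ofFree S (TensorAlgebra.ι ℚ x) = UEnv.ι S (S.res x) := by
  simp [UEnv.ofFree]

theorem UEnv.ofFree_surjective (S : Idx d) : Function.Surjective (UEnv.ofFree S) := by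
  let mk : TensorAlgebra ℚ S.Lie →ₐ[ℚ] UEnv S := RingQuot.mkAlgHom ℚ (EnvRel S)
  have hmk : ∀ x, mk (TensorAlgebra.ι ℚ x) = UEnv.ι S x := fun x => rfl
  have key : ∀ t : TensorAlgebra ℚ S.Lie, mk t ∈ (UEnv.ofFree S).range := by
    intro t
    induction t using TensorAlgebra.induction with
    | algebraMap r => rw [AlgHom.commutes]; exact Subalgebra.algebraMap_mem _ r
    | ι x =>
      obtain ⟨y, rfl⟩ := S.res_surjective x
      exact ⟨TensorAlgebra.ι ℚ y, by rw [hmk]; exact UEnv.ofFree_ι S y⟩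
    | mul x y hx hy => rw [map_mul]; exact mul_mem hx hy
    | add x y hx hy => rw [map_add]; exact add_mem hx hy
  intro u
  obtain ⟨t, rfl⟩ := RingQuot.mkAlgHom_surjective ℚ (EnvRel S) u
  exact key t

/-- The morphism from the free algebra on `L_V` to `UL_S / I^n`. -/
def UQuot.ofFree (S : Idx d) (n : ℕ) : TensorAlgebra ℚ (HLie V) →ₐ[ℚ] UQuot S n :=
  (Ideal.Quotient.mkₐ ℚ (UEnv.augIdeal S ^ n)).comp (UEnv.ofFree S)

theorem UQuot.ofFree_apply (S : Idx d) (n : ℕ) (f : TensorAlgebra ℚ (HLie V)) :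
    UQuot.ofFree S n f = Ideal.Quotient.mkₐ ℚ (UEnv.augIdeal S ^ n) (UEnv.ofFree S f) := rfl

theorem UQuot.ofFree_surjective (S : Idx d) (n : ℕ) :
    Function.Surjective (UQuot.ofFree S n) :=
  (Ideal.Quotient.mkₐ_surjective ℚ _).comp (UEnv.ofFree_surjective S)

variable (d) in
/-- The morphism from the free algebra on `L_V` to the Sullivan completion. -/
def UBar.ofFree : TensorAlgebra ℚ (HLie V) →ₐ[ℚ] UBar d :=
  TensorAlgebra.lift ℚ UBar.ι

@[simp] theorem UBar.ofFree_ι (x : HLie V) :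
    UBar.ofFree d (TensorAlgebra.ι ℚ x) = UBar.ι x := by
  simp [UBar.ofFree]

theorem UBar.ofFree_apply (f : TensorAlgebra ℚ (HLie V)) (S : Idx d) (n : ℕ) :
    (UBar.ofFree d f).1 S n = UQuot.ofFree S n f := by
  have : (((Pi.evalAlgHom ℚ _ n).comp (Pi.evalAlgHom ℚ _ S)).comp (UBar d).val).comp
      (UBar.ofFree d) = UQuot.ofFree S n := by
    refine TensorAlgebra.hom_ext (LinearMap.ext fun x => ?_)
    show (UBar.ofFree d (TensorAlgebra.ι ℚ x)).1 S n = _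
    rw [UBar.ofFree_ι, LinearMap.comp_apply, AlgHom.toLinearMap_apply, UQuot.ofFree_apply,
      UEnv.ofFree_ι]
    rfl
  exact DFunLike.congr_fun this f

/-- The density statement: the free algebra already surjects onto every `UL_S / I^n`. -/
theorem UBar.exists_ofFree (a : UBar d) (S : Idx d) (n : ℕ) :
    ∃ f, (UBar.ofFree d f).1 S n = a.1 S n := by
  obtain ⟨f, hf⟩ := UQuot.ofFree_surjective S n (a.1 S n)
  exact ⟨f, by rw [UBar.ofFree_apply, hf]⟩

theorem UBar.eq_zero_of_le {a : UBar d} {S S' : Idx d} {n n' : ℕ} (h : S.1 ≤ S'.1) (hn : n ≤ n')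
    (ha : a.1 S' n' = 0) : a.1 S n = 0 := by
  rw [← a.2 S S' n n' h hn, ha, map_zero]

/-- A linear map on the Sullivan completion with discrete target is continuous if it factors
through some `UL_S / I^n`. -/
def IsCont {N : Type*} [AddCommGroup N] [Module ℚ N] (E : UBar d →ₗ[ℚ] N) : Prop :=
  ∃ (S : Idx d) (n : ℕ), ∀ a : UBar d, a.1 S n = 0 → E a = 0

namespace IsCont

variable {N N' : Type*} [AddCommGroup N] [Module ℚ N] [AddCommGroup N'] [Module ℚ N']
  {E E' : UBar d →ₗ[ℚ] N}

theorem add (hd : IsDer 1 d) (hE : IsCont E) (hE' : IsCont E') : IsCont (E + E') := by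
  obtain ⟨S, n, h⟩ := hE
  obtain ⟨S', n', h'⟩ := hE'
  refine ⟨Idx.sup hd S S', max n n', fun a ha => ?_⟩
  rw [LinearMap.add_apply,
    h a (UBar.eq_zero_of_le (Idx.le_sup_left hd S S') (le_max_left _ _) ha),
    h' a (UBar.eq_zero_of_le (Idx.le_sup_right hd S S') (le_max_right _ _) ha), add_zero]

theorem smul (hE : IsCont E) (c : ℚ) : IsCont (c • E) := by
  obtain ⟨S, n, h⟩ := hE
  exact ⟨S, n, fun a ha => by rw [LinearMap.smul_apply, h a ha, smul_zero]⟩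

theorem sub (hd : IsDer 1 d) (hE : IsCont E) (hE' : IsCont E') : IsCont (E - E') := by
  have := hE.add hd (hE'.smul (-1))
  rwa [neg_one_smul, ← sub_eq_add_neg] at this

theorem comp (hE : IsCont E) (g : N →ₗ[ℚ] N') : IsCont (g ∘ₗ E) := by
  obtain ⟨S, n, h⟩ := hE
  exact ⟨S, n, fun a ha => by rw [LinearMap.comp_apply, h a ha, map_zero]⟩

theorem mem (hE : IsCont E) (P : Submodule ℚ N) (h : ∀ f, E (UBar.ofFree d f) ∈ P)
    (a : UBar d) : E a ∈ P := by
  obtain ⟨S, n, hS⟩ := hE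
  obtain ⟨f, hf⟩ := UBar.exists_ofFree a S n
  have h0 : E (UBar.ofFree d f - a) = 0 := hS _ (by
    show (UBar.ofFree d f).1 S n - a.1 S n = 0
    rw [hf, sub_self])
  rw [map_sub, sub_eq_zero] at h0
  rw [← h0]
  exact h f

theorem ext (hd : IsDer 1 d) (hE : IsCont E) (hE' : IsCont E')
    (h : ∀ f, E (UBar.ofFree d f) = E' (UBar.ofFree d f)) : E = E' := by
  refine LinearMap.ext fun a => ?_
  have := (hE.sub hd hE').mem ⊥ (fun f => by simp [h f]) a
  rwa [Submodule.mem_bot, LinearMap.sub_apply, sub_eq_zero] at this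

end IsCont

/-- The map `e` descends to `UL_S / I^n`. It is evaluated through a linear section, whose choice
does not matter because `e` kills the kernel. -/
theorem exists_isCont {N : Type*} [AddCommGroup N] [Module ℚ N]
    (e : TensorAlgebra ℚ (HLie V) →ₗ[ℚ] N)
    (he : ∃ (S : Idx d) (n : ℕ), ∀ f, UQuot.ofFree S n f = 0 → e f = 0) :
    ∃ E : UBar d →ₗ[ℚ] N, IsCont E ∧ ∀ f, E (UBar.ofFree d f) = e f := by
  obtain ⟨S, n, h⟩ := he
  obtain ⟨s, hs⟩ := LinearMap.exists_rightInverse_of_surjective (UQuot.ofFree S n).toLinearMap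
    (LinearMap.range_eq_top.2 (UQuot.ofFree_surjective S n))
  let pr : UBar d →ₗ[ℚ] UQuot S n :=
    { toFun := fun a => a.1 S n
      map_add' := fun _ _ => rfl
      map_smul' := fun _ _ => rfl }
  refine ⟨e ∘ₗ s ∘ₗ pr, ⟨S, n, fun a ha => ?_⟩, fun f => ?_⟩
  · show e (s (a.1 S n)) = 0
    rw [ha, map_zero, map_zero]
  · show e (s ((UBar.ofFree d f).1 S n)) = e f
    rw [UBar.ofFree_apply, ← sub_eq_zero, ← map_sub]
    refine h _ ?_
    have h1 := LinearMap.congr_fun hs (UQuot.ofFree S n f)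
    have h2 : UQuot.ofFree S n (s (UQuot.ofFree S n f)) = UQuot.ofFree S n f := h1
    rw [map_sub, h2, sub_self]

/-- The evaluation of a representation at a vector, as a linear map. -/
def evalAt {M : Type*} [AddCommGroup M] [Module ℚ M] (R : UBar d →ₐ[ℚ] Module.End ℚ M) (m : M) :
    UBar d →ₗ[ℚ] M := LinearMap.applyₗ m ∘ₗ R.toLinearMap

theorem evalAt_apply {M : Type*} [AddCommGroup M] [Module ℚ M] (R : UBar d →ₐ[ℚ] Module.End ℚ M)
    (m : M) (a : UBar d) : evalAt R m a = R a m := rfl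

/-- A representation of the free algebra on `L_V` that is continuous for the topology of the
Sullivan completion extends to the completion. -/
theorem exists_rep (hd : IsDer 1 d) {M : Type*} [AddCommGroup M] [Module ℚ M]
    (A : TensorAlgebra ℚ (HLie V) →ₐ[ℚ] Module.End ℚ M)
    (hA : ∀ m, ∃ (S : Idx d) (n : ℕ), ∀ f, UQuot.ofFree S n f = 0 → A f m = 0) :
    ∃ R : UBar d →ₐ[ℚ] Module.End ℚ M, (∀ f, R (UBar.ofFree d f) = A f) ∧
      ∀ m, IsCont (evalAt R m) := by
  have hE := fun m => exists_isCont (d := d) (LinearMap.applyₗ m ∘ₗ A.toLinearMap) (hA m)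
  choose E hEc hEf using hE
  simp only [LinearMap.comp_apply, LinearMap.applyₗ_apply_apply,
    AlgHom.toLinearMap_apply] at hEf
  -- Two density arguments: for `a` from the free algebra both sides are continuous in `b`, and then
  -- for fixed `b` both are continuous in `a`.
  have hmul : ∀ m a b, E m (a * b) = E (E m b) a := by
    intro m a b
    have h1 : IsCont (E m ∘ₗ LinearMap.mulRight ℚ b) := by
      obtain ⟨S, n, h⟩ := hEc m
      refine ⟨S, n, fun c hc => h _ ?_⟩
      show c.1 S n * b.1 S n = 0
      rw [hc, zero_mul]
    have h2 := h1.ext hd (hEc (E m b)) (fun f => by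
      have h3 : IsCont (E m ∘ₗ LinearMap.mulLeft ℚ (UBar.ofFree d f)) := by
        obtain ⟨S, n, h⟩ := hEc m
        refine ⟨S, n, fun c hc => h _ ?_⟩
        show (UBar.ofFree d f).1 S n * c.1 S n = 0
        rw [hc, mul_zero]
      have h4 := h3.ext hd ((hEc m).comp (A f)) (fun g => by
        simp only [LinearMap.comp_apply, LinearMap.mulLeft_apply, ← map_mul, hEf]
        rw [map_mul]; rfl)
      have h5 := LinearMap.congr_fun h4 b
      rw [hEf]
      exact h5)
    exact LinearMap.congr_fun h2 a
  have hadd : ∀ m m', E (m + m') = E m + E m' := fun m m' =>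
    (hEc _).ext hd ((hEc m).add hd (hEc m')) fun f => by
      simp only [LinearMap.add_apply, hEf, map_add]
  have hsmul : ∀ (c : ℚ) m, E (c • m) = c • E m := fun c m =>
    (hEc _).ext hd ((hEc m).smul c) fun f => by
      simp only [LinearMap.smul_apply, hEf, map_smul]
  let R : UBar d →ₗ[ℚ] Module.End ℚ M :=
    { toFun := fun a =>
        { toFun := fun m => E m a
          map_add' := fun m m' => by rw [hadd]; rfl
          map_smul' := fun c m => by rw [hsmul]; rfl }
      map_add' := fun a b => LinearMap.ext fun m => map_add (E m) a b
      map_smul' := fun c a => LinearMap.ext fun m => map_smul (E m) c a }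
  have hRf : ∀ f, R (UBar.ofFree d f) = A f := fun f => LinearMap.ext fun m => hEf m f
  refine ⟨AlgHom.ofLinearMap R ?_ ?_, hRf, fun m => hEc m⟩
  · rw [← map_one (UBar.ofFree d), hRf, map_one]
  · exact fun a b => LinearMap.ext fun m => hmul m a b

/-- Two continuous representations intertwined on `L_V` are intertwined. -/
theorem intertwine (hd : IsDer 1 d) {M M' : Type*} [AddCommGroup M] [Module ℚ M]
    [AddCommGroup M'] [Module ℚ M'] {R : UBar d →ₐ[ℚ] Module.End ℚ M}
    {R' : UBar d →ₐ[ℚ] Module.End ℚ M'} (hR : ∀ m, IsCont (evalAt R m))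
    (hR' : ∀ m, IsCont (evalAt R' m)) (g : M →ₗ[ℚ] M')
    (h : ∀ x m, g (R (UBar.ι x) m) = R' (UBar.ι x) (g m)) (a : UBar d) (m : M) :
    g (R a m) = R' a (g m) := by
  have hf : ∀ f m, g (R (UBar.ofFree d f) m) = R' (UBar.ofFree d f) (g m) := by
    intro f
    induction f using TensorAlgebra.induction with
    | algebraMap r => intro m; simp [Module.algebraMap_end_apply]
    | ι x => intro m; rw [UBar.ofFree_ι, h]
    | mul x y hx hy =>
      intro m
      simp only [map_mul, Module.End.mul_apply, hx, hy]
    | add x y hx hy => intro m; simp only [map_add, LinearMap.add_apply, hx, hy]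
  exact LinearMap.congr_fun (((hR m).comp g).ext hd (hR' (g m)) fun f => hf f m) a

theorem rep_ext (hd : IsDer 1 d) {M : Type*} [AddCommGroup M] [Module ℚ M]
    {R R' : UBar d →ₐ[ℚ] Module.End ℚ M} (hR : ∀ m, IsCont (evalAt R m))
    (hR' : ∀ m, IsCont (evalAt R' m)) (h : ∀ x, R (UBar.ι x) = R' (UBar.ι x)) : R = R' :=
  AlgHom.ext fun a => LinearMap.ext fun m =>
    intertwine hd hR hR' LinearMap.id (fun x m => by rw [h]; rfl) a m

theorem mem_of_rep {M : Type*} [AddCommGroup M] [Module ℚ M]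
    {R : UBar d →ₐ[ℚ] Module.End ℚ M} (hR : ∀ m, IsCont (evalAt R m)) (P : Submodule ℚ M)
    (h : ∀ x, ∀ m ∈ P, R (UBar.ι x) m ∈ P) (a : UBar d) {m : M} (hm : m ∈ P) : R a m ∈ P := by
  have hf : ∀ f, ∀ m ∈ P, R (UBar.ofFree d f) m ∈ P := by
    intro f
    induction f using TensorAlgebra.induction with
    | algebraMap r =>
      intro m hm
      simpa [Module.algebraMap_end_apply] using P.smul_mem r hm
    | ι x => intro m hm; rw [UBar.ofFree_ι]; exact h x m hm
    | mul x y hx hy =>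
      intro m hm
      simp only [map_mul, Module.End.mul_apply]
      exact hx _ (hy _ hm)
    | add x y hx hy =>
      intro m hm
      simp only [map_add, LinearMap.add_apply]
      exact P.add_mem (hx _ hm) (hy _ hm)
  exact (hR m).mem P (fun f => hf f m hm) a

/-- Continuity of a representation of `L_V` on a vector contained in a nilpotent finite filtration
on which `L_V` acts through `L_S`. -/
theorem lift_eq_zero {M : Type*} [AddCommGroup M] [Module ℚ M]
    {A : HLie V →ₗ[ℚ] Module.End ℚ M}
    (hrel : ∀ p q (x y : HLie V), x ∈ HLie.deg p → y ∈ HLie.deg q →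
      ∀ m, A x (A y m) = (-1 : ℚ) ^ (p * q) • A y (A x m) + A (HLie.bracket d x y) m)
    (N : ℕ → Submodule ℚ M) (h0 : N 0 = ⊥) (hmono : Monotone N)
    (hA : ∀ x k, ∀ m ∈ N (k + 1), A x m ∈ N k) (S : Idx d) (n : ℕ)
    (hS : ∀ x, S.res x = 0 → ∀ m ∈ N n, A x m = 0) {f : TensorAlgebra ℚ (HLie V)}
    (hf : UQuot.ofFree S n f = 0) {m : M} (hm : m ∈ N n) :
    TensorAlgebra.lift ℚ A f m = 0 := by
  have hst : ∀ x, ∀ k, ∀ m ∈ N k, A x m ∈ N k := by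
    intro x k m hm
    cases k with
    | zero =>
      rw [h0, Submodule.mem_bot] at hm
      rw [hm, map_zero]; exact zero_mem _
    | succ k => exact hmono (Nat.le_succ k) (hA x k m hm)
  -- the action on `N n` factors through `UL_S`
  let AP : HLie V →ₗ[ℚ] Module.End ℚ (N n) :=
    { toFun := fun x => (A x).restrict (hst x n)
      map_add' := fun x y => LinearMap.ext fun m => Subtype.ext (by simp)
      map_smul' := fun c x => LinearMap.ext fun m => Subtype.ext (by simp) }
  have hAP : ∀ x m, ((AP x m : N n) : M) = A x m := fun x m => rfl
  obtain ⟨s, hs⟩ := LinearMap.exists_rightInverse_of_surjective S.res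
    (LinearMap.range_eq_top.2 S.res_surjective)
  -- The choice of section is immaterial on `N n`: a functional that vanishes on `S` acts there by
  -- zero.
  have hg : ∀ x, (AP ∘ₗ s) (S.res x) = AP x := by
    intro x
    refine LinearMap.ext fun m => Subtype.ext ?_
    rw [LinearMap.comp_apply, hAP, hAP, ← sub_eq_zero, ← LinearMap.sub_apply, ← map_sub]
    refine hS _ ?_ m m.2
    have : S.res (s (S.res x)) = S.res x := LinearMap.congr_fun hs (S.res x)
    rw [map_sub, this, sub_self]
  let G : UEnv S →ₐ[ℚ] Module.End ℚ (N n) := UEnv.lift (AP ∘ₗ s) (by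
    intro p q x y hx hy
    simp only [hg]
    refine LinearMap.ext fun m => Subtype.ext ?_
    exact hrel p q x y hx hy m)
  have hGι : ∀ x, G (UEnv.ι S (S.res x)) = AP x := fun x => by rw [UEnv.lift_ι, hg]
  have hGf : ∀ f (m : N n), ((G (UEnv.ofFree S f) m : N n) : M) = TensorAlgebra.lift ℚ A f m := by
    intro f
    induction f using TensorAlgebra.induction with
    | algebraMap r => intro m; simp [Module.algebraMap_end_apply]
    | ι x => intro m; rw [UEnv.ofFree_ι, hGι, TensorAlgebra.lift_ι_apply]; rfl
    | mul x y hx hy =>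
      intro m
      simp only [map_mul, Module.End.mul_apply, hx, hy]
    | add x y hx hy =>
      intro m
      simp only [map_add, LinearMap.add_apply, Submodule.coe_add, hx, hy]
  -- the augmentation ideal lowers the filtration
  have haug : ∀ f k, ∀ m ∈ N (k + 1),
      TensorAlgebra.lift ℚ A f m - UEnv.aug S (UEnv.ofFree S f) • m ∈ N k := by
    intro f
    induction f using TensorAlgebra.induction with
    | algebraMap r => intro k m hm; simp [Module.algebraMap_end_apply]
    | ι x =>
      intro k m hm
      rw [UEnv.ofFree_ι, UEnv.aug_ι, zero_smul, sub_zero, TensorAlgebra.lift_ι_apply]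
      exact hA x k m hm
    | mul x y hx hy =>
      intro k m hm
      have hxst : ∀ m ∈ N k, TensorAlgebra.lift ℚ A x m ∈ N k := by
        intro m hm
        cases k with
        | zero =>
          rw [h0, Submodule.mem_bot] at hm
          rw [hm, map_zero]; exact zero_mem _
        | succ k =>
          have h1 := add_mem (hmono (Nat.le_succ k) (hx k m hm))
            ((N (k + 1)).smul_mem (UEnv.aug S (UEnv.ofFree S x)) hm)
          rwa [sub_add_cancel] at h1
      have h1 := add_mem (hxst _ (hy k m hm))
        ((N k).smul_mem (UEnv.aug S (UEnv.ofFree S y)) (hx k m hm))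
      convert h1 using 1
      simp only [map_mul, Module.End.mul_apply, map_sub, map_smul, smul_sub, smul_smul]
      rw [mul_comm (UEnv.aug S (UEnv.ofFree S y))]
      abel
    | add x y hx hy =>
      intro k m hm
      convert add_mem (hx k m hm) (hy k m hm) using 1
      simp only [map_add, LinearMap.add_apply, add_smul]
      abel
  -- The power `I^j` lowers the filtration by `j`; the claim is the case `j = n`, `k = 0`, where the
  -- target `N 0` is zero.
  have hpow : ∀ j, ∀ u ∈ UEnv.augIdeal S ^ j, ∀ k (m : N n), (m : M) ∈ N (k + j) →
      ((G u m : N n) : M) ∈ N k := by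
    intro j
    induction j with
    | zero =>
      intro u _ k m hm
      obtain ⟨f, rfl⟩ := UEnv.ofFree_surjective S u
      rw [hGf]
      cases k with
      | zero =>
        rw [add_zero, h0, Submodule.mem_bot] at hm
        rw [hm, map_zero]; exact zero_mem _
      | succ k =>
        have h1 := add_mem (hmono (Nat.le_succ k) (haug f k m hm))
            ((N (k + 1)).smul_mem (UEnv.aug S (UEnv.ofFree S f)) hm)
        rwa [sub_add_cancel] at h1
    | succ j ih =>
      intro u hu k m hm
      rw [Submodule.pow_succ] at hu
      refine Submodule.mul_induction_on hu ?_ ?_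
      · intro b hb c hc
        rw [map_mul, Module.End.mul_apply]
        refine ih b hb k _ ?_
        obtain ⟨f, rfl⟩ := UEnv.ofFree_surjective S c
        have hc' : UEnv.aug S (UEnv.ofFree S f) = 0 := hc
        have := haug f (k + j) m hm
        rwa [hc', zero_smul, sub_zero, ← hGf] at this
      · intro b c hb hc
        rw [map_add, LinearMap.add_apply]
        exact add_mem hb hc
  have hfn : UEnv.ofFree S f ∈ UEnv.augIdeal S ^ n := Ideal.Quotient.eq_zero_iff_mem.1 hf
  have := hpow n _ hfn 0 ⟨m, hm⟩ (by rwa [zero_add])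
  rwa [h0, Submodule.mem_bot, hGf] at this

variable (V) in
/-- The elements of degree `p` in the free algebra on `L_V`. -/
def freeDeg (p : ℕ) : Submodule ℚ (TensorAlgebra ℚ (HLie V)) :=
  Submodule.span ℚ {a | ∃ l : List (ℕ × HLie V), (∀ c ∈ l, c.2 ∈ HLie.deg c.1) ∧
    (l.map Prod.fst).sum = p ∧ a = (l.map fun c => TensorAlgebra.ι ℚ c.2).prod}

theorem freeDeg_le (Q : ℕ → Submodule ℚ (TensorAlgebra ℚ (HLie V))) (h1 : 1 ∈ Q 0)
    (hm : ∀ p q, ∀ x ∈ HLie.deg (V := V) p, ∀ f ∈ Q q, TensorAlgebra.ι ℚ x * f ∈ Q (p + q))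
    (p : ℕ) : freeDeg V p ≤ Q p := by
  rw [freeDeg, Submodule.span_le]
  rintro _ ⟨l, hl, rfl, rfl⟩
  induction l with
  | nil => simpa using h1
  | cons c l ih =>
    rw [List.map_cons, List.map_cons, List.prod_cons, List.sum_cons]
    exact hm _ _ _ (hl c (by simp)) _ (ih fun c hc => hl c (by simp [hc]))

theorem map_freeDeg (S : Idx d) (p : ℕ) :
    (freeDeg V p).map (UEnv.ofFree S).toLinearMap = UEnv.deg S p := by
  rw [freeDeg, Submodule.map_span, UEnv.deg]
  congr 1
  ext a
  constructor
  · rintro ⟨_, ⟨l, hl, hp, rfl⟩, rfl⟩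
    refine ⟨l, hl, hp, ?_⟩
    simp [map_list_prod, Function.comp_def]
  · rintro ⟨l, hl, hp, rfl⟩
    refine ⟨_, ⟨l, hl, hp, rfl⟩, ?_⟩
    simp [map_list_prod, Function.comp_def]

theorem UBar.exists_ofFree_deg {p : ℕ} {a : UBar d} (ha : a ∈ UBar.deg p) (S : Idx d) (n : ℕ) :
    ∃ f ∈ freeDeg V p, (UBar.ofFree d f).1 S n = a.1 S n := by
  have h := ha S n
  rw [← map_freeDeg] at h
  obtain ⟨_, ⟨f, hf, rfl⟩, h⟩ := h
  exact ⟨f, hf, by rw [UBar.ofFree_apply, ← h]; rfl⟩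

/-- The degree `p` part of the free algebra is dense in that of the completion. -/
theorem IsCont.mem_of_deg {N : Type*} [AddCommGroup N] [Module ℚ N] {E : UBar d →ₗ[ℚ] N}
    (hE : IsCont E) (P : Submodule ℚ N) {p : ℕ} (h : ∀ f ∈ freeDeg V p, E (UBar.ofFree d f) ∈ P)
    {a : UBar d} (ha : a ∈ UBar.deg p) : E a ∈ P := by
  obtain ⟨S, n, hS⟩ := hE
  obtain ⟨f, hf, hfa⟩ := UBar.exists_ofFree_deg ha S n
  have h0 : E (UBar.ofFree d f - a) = 0 := hS _ (by
    show (UBar.ofFree d f).1 S n - a.1 S n = 0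
    rw [hfa, sub_self])
  rw [map_sub, sub_eq_zero] at h0
  rw [← h0]
  exact h f hf

end Density

end

section

open FreeCGA

/-! ### The completion as the dual of the continuous functionals -/

section Duality

variable {V : ℕ → Type*} [∀ i, AddCommGroup (V i)] [∀ i, Module ℚ (V i)]
  {d : FreeCGA V →ₗ[ℚ] FreeCGA V}

/-- The quotients `UL_S / I^n` are finite dimensional. -/
theorem UQuot.finite (S : Idx d) (n : ℕ) : Module.Finite ℚ (UQuot S n) := by
  have := S.finite
  let mk := Ideal.Quotient.mkₐ ℚ (UEnv.augIdeal S ^ n)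
  let L : Submodule ℚ (UQuot S n) := LinearMap.range (mk.toLinearMap ∘ₗ UEnv.ι S)
  have hL : L.FG := by
    have : FiniteDimensional ℚ S.Lie := inferInstance
    exact Module.Finite.iff_fg.1 (Module.Finite.range _)
  -- The finite dimensional image `L` of `L_S` generates the quotient and consists of augmentation
  -- zero elements. Its powers from the `n`-th on vanish, and the finitely many remaining ones span.
  have hge : ∀ k, n ≤ k → L ^ k = ⊥ := by
    intro k hk
    have h1 : ∀ j, L ^ j ≤ ((UEnv.augIdeal S ^ j).restrictScalars ℚ).map mk.toLinearMap := by
      intro j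
      induction j with
      | zero =>
        rw [pow_zero, Submodule.one_le]
        exact ⟨1, by simp [Submodule.pow_zero, Ideal.one_eq_top], map_one mk⟩
      | succ j ih =>
        rw [pow_succ, Submodule.mul_le]
        rintro a ha _ ⟨x, rfl⟩
        obtain ⟨b, hb, rfl⟩ := ih ha
        refine ⟨b * UEnv.ι S x, ?_, map_mul mk _ _⟩
        show _ ∈ UEnv.augIdeal S ^ (j + 1)
        rw [Submodule.pow_succ]
        exact Ideal.mul_mem_mul hb (UEnv.aug_ι S x)
    rw [eq_bot_iff]
    refine (h1 k).trans ?_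
    rintro _ ⟨b, hb, rfl⟩
    exact Ideal.Quotient.eq_zero_iff_mem.2 (Ideal.pow_le_pow_right hk hb)
  have htop : ⨆ k, L ^ k = ⊤ := by
    rw [eq_top_iff]
    rintro u -
    obtain ⟨f, rfl⟩ := UQuot.ofFree_surjective S n u
    have key : ∀ f, ∀ u ∈ ⨆ k, L ^ k, UQuot.ofFree S n f * u ∈ ⨆ k, L ^ k := by
      intro f
      induction f using TensorAlgebra.induction with
      | algebraMap r =>
        intro u hu
        rw [AlgHom.commutes, ← Algebra.smul_def]
        exact Submodule.smul_mem _ r hu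
      | ι x =>
        intro u hu
        induction hu using Submodule.iSup_induction' with
        | mem k a ha =>
          refine Submodule.mem_iSup_of_mem (k + 1) ?_
          rw [pow_succ']
          refine Submodule.mul_mem_mul ⟨S.res x, ?_⟩ ha
          rw [UQuot.ofFree_apply, UEnv.ofFree_ι]; rfl
        | zero => rw [mul_zero]; exact zero_mem _
        | add x y _ _ hx hy => rw [mul_add]; exact add_mem hx hy
      | mul x y hx hy => intro u hu; rw [map_mul, mul_assoc]; exact hx _ (hy _ hu)
      | add x y hx hy => intro u hu; rw [map_add, add_mul]; exact add_mem (hx _ hu) (hy _ hu)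
    have h1 : (1 : UQuot S n) ∈ ⨆ k, L ^ k :=
      Submodule.mem_iSup_of_mem 0 (by rw [pow_zero]; exact Submodule.one_le.1 le_rfl)
    have := key f 1 h1
    rwa [mul_one] at this
  have hfin : (⨆ k ∈ Finset.range n, L ^ k) = ⊤ := by
    rw [eq_top_iff, ← htop]
    refine iSup_le fun k => ?_
    rcases lt_or_ge k n with h | h
    · exact le_iSup₂_of_le k (Finset.mem_range.2 h) le_rfl
    · rw [hge k h]; exact bot_le
  refine Module.Finite.iff_fg.2 ?_ |> fun h : Module.Finite ℚ (⊤ : Submodule ℚ (UQuot S n)) =>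
    Module.Finite.equiv Submodule.topEquiv
  rw [← hfin]
  exact Submodule.fg_biSup _ _ fun k _ => hL.pow k

/-- The continuous functionals on the free algebra on `L_V`; the Sullivan completion is their
dual. -/
def contDual (hd : IsDer 1 d) : Submodule ℚ (Module.Dual ℚ (TensorAlgebra ℚ (HLie V))) where
  carrier := {φ | ∃ (S : Idx d) (n : ℕ), ∀ f, UQuot.ofFree S n f = 0 → φ f = 0}
  zero_mem' := ⟨Idx.zero hd, 0, fun _ _ => rfl⟩
  add_mem' := by
    rintro φ ψ ⟨S, n, h⟩ ⟨S', n', h'⟩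
    refine ⟨Idx.sup hd S S', max n n', fun f hf => ?_⟩
    rw [← UBar.ofFree_apply] at hf
    rw [LinearMap.add_apply, h, h', add_zero]
    · rw [← UBar.ofFree_apply]
      exact UBar.eq_zero_of_le (Idx.le_sup_right hd S S') (le_max_right _ _) hf
    · rw [← UBar.ofFree_apply]
      exact UBar.eq_zero_of_le (Idx.le_sup_left hd S S') (le_max_left _ _) hf
  smul_mem' := by
    rintro c φ ⟨S, n, h⟩
    exact ⟨S, n, fun f hf => by rw [LinearMap.smul_apply, h f hf, smul_zero]⟩

/-- Functionals on `UL_S / I^n` as continuous functionals on the free algebra. -/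
def contDual.ofQuot (hd : IsDer 1 d) (S : Idx d) (n : ℕ) :
    Module.Dual ℚ (UQuot S n) →ₗ[ℚ] contDual hd where
  toFun ψ := ⟨ψ ∘ₗ (UQuot.ofFree S n).toLinearMap, S, n, fun f hf => by
    rw [LinearMap.comp_apply, AlgHom.toLinearMap_apply, hf, map_zero]⟩
  map_add' _ _ := rfl
  map_smul' _ _ := rfl

/-- Each `UL_S / I^n` is finite dimensional, hence reflexive: `l` restricted to its dual is
evaluation at one element. Compatibility of these elements is tested on functionals. -/
theorem exists_of_functional (hd : IsDer 1 d) (l : Module.Dual ℚ (contDual hd)) :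
    ∃ b : UBar d, ∀ (S : Idx d) (n : ℕ) (ψ : Module.Dual ℚ (UQuot S n)),
      ψ (b.1 S n) = l (contDual.ofQuot hd S n ψ) := by
  have hfin := fun (S : Idx d) n => UQuot.finite S n
  let b : ∀ (S : Idx d) (n : ℕ), UQuot S n := fun S n =>
    (Module.evalEquiv ℚ (UQuot S n)).symm (l ∘ₗ contDual.ofQuot hd S n)
  have hb : ∀ (S : Idx d) (n : ℕ) (ψ : Module.Dual ℚ (UQuot S n)),
      ψ (b S n) = l (contDual.ofQuot hd S n ψ) := by
    intro S n ψ
    have := (Module.evalEquiv ℚ (UQuot S n)).apply_symm_apply (l ∘ₗ contDual.ofQuot hd S n)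
    exact LinearMap.congr_fun this ψ
  refine ⟨⟨b, ?_⟩, hb⟩
  intro S S' n n' h hn
  rw [← sub_eq_zero]
  refine (Module.forall_dual_apply_eq_zero_iff ℚ _).1 fun ψ => ?_
  rw [map_sub, sub_eq_zero, hb]
  have h2 := hb S' n' (ψ ∘ₗ (UQuot.trans h hn).toLinearMap)
  rw [LinearMap.comp_apply, AlgHom.toLinearMap_apply] at h2
  rw [h2]
  congr 1
  refine Subtype.ext (LinearMap.ext fun f => ?_)
  show ψ (UQuot.trans h hn (UQuot.ofFree S' n' f)) = ψ (UQuot.ofFree S n f)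
  rw [← UBar.ofFree_apply, ← UBar.ofFree_apply, (UBar.ofFree d f).2 S S' n n' h hn]

/-- An element of the completion as a functional. -/
theorem exists_functional (hd : IsDer 1 d) (a : UBar d) :
    ∃ α : Module.Dual ℚ (contDual hd),
      (∀ (S : Idx d) (n : ℕ) (ψ : Module.Dual ℚ (UQuot S n)),
        α (contDual.ofQuot hd S n ψ) = ψ (a.1 S n)) ∧
      (∀ p, a ∈ UBar.deg p → ∀ φ : contDual hd, (∀ f ∈ freeDeg V p, φ.1 f = 0) → α φ = 0) := by
  have hE := fun φ : contDual hd => exists_isCont (d := d) φ.1 φ.2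
  choose E hEc hEf using hE
  let α : Module.Dual ℚ (contDual hd) :=
    { toFun := fun φ => E φ a
      map_add' := fun φ ψ => by
        have : E (φ + ψ) = E φ + E ψ := (hEc _).ext hd ((hEc φ).add hd (hEc ψ)) fun f => by
          simp only [LinearMap.add_apply, hEf, Submodule.coe_add]
        rw [this]; rfl
      map_smul' := fun c φ => by
        have : E (c • φ) = c • E φ := (hEc _).ext hd ((hEc φ).smul c) fun f => by
          simp only [LinearMap.smul_apply, hEf, Submodule.coe_smul]
        rw [this]; rfl }
  refine ⟨α, ?_, ?_⟩
  · intro S n ψ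
    let pr : UBar d →ₗ[ℚ] UQuot S n :=
      { toFun := fun a => a.1 S n
        map_add' := fun _ _ => rfl
        map_smul' := fun _ _ => rfl }
    have hpr : IsCont pr := ⟨S, n, fun a ha => ha⟩
    have := (hEc (contDual.ofQuot hd S n ψ)).ext hd (hpr.comp ψ) fun f => by
      rw [hEf]
      show ψ (UQuot.ofFree S n f) = ψ ((UBar.ofFree d f).1 S n)
      rw [UBar.ofFree_apply]
    exact LinearMap.congr_fun this a
  · intro p ha φ hφ
    have := (hEc φ).mem_of_deg ⊥ (fun f hf => by rw [hEf, hφ f hf]; exact zero_mem _) ha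
    exact this

/-- The hypothesis says that `α` kills the kernel of `A → B / K`; over a field it is then the
pullback of a functional on `B / K`. -/
theorem exists_extend {A B : Type*} [AddCommGroup A] [Module ℚ A] [AddCommGroup B] [Module ℚ B]
    (j : A →ₗ[ℚ] B) (K : Submodule ℚ B) (α : Module.Dual ℚ A) (h : ∀ a, j a ∈ K → α a = 0) :
    ∃ l : Module.Dual ℚ B, (∀ a, l (j a) = α a) ∧ ∀ b ∈ K, l b = 0 := by
  have h1 : α ∈ LinearMap.range (K.mkQ ∘ₗ j).dualMap := by
    rw [LinearMap.range_dualMap_eq_dualAnnihilator_ker, Submodule.mem_dualAnnihilator]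
    intro a ha
    refine h a ?_
    rw [LinearMap.mem_ker, LinearMap.comp_apply, Submodule.mkQ_apply,
      Submodule.Quotient.mk_eq_zero] at ha
    exact ha
  obtain ⟨g, hg⟩ := h1
  refine ⟨g ∘ₗ K.mkQ, fun a => LinearMap.congr_fun hg a, fun b hb => ?_⟩
  rw [LinearMap.comp_apply, Submodule.mkQ_apply, (Submodule.Quotient.mk_eq_zero K).2 hb, map_zero]

end Duality

/-! ### The morphism `π` and its surjectivity -/

section Projection

variable {V Z : ℕ → Type*}
  [∀ i, AddCommGroup (V i)] [∀ i, Module ℚ (V i)]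
  [∀ i, AddCommGroup (Z i)] [∀ i, Module ℚ (Z i)]
  {dV : FreeCGA V →ₗ[ℚ] FreeCGA V}
  {dW : FreeCGA (fun i => V i × Z i) →ₗ[ℚ] FreeCGA (fun i => V i × Z i)}

theorem lieToBase_apply (x : HLie fun i => V i × Z i) (v : ⨁ i, V i) :
    lieToBase x v = x (DirectSum.lmap (inV V Z) v) := rfl

theorem lieToBase_mem_deg {p : ℕ} {x : HLie fun i => V i × Z i} (hx : x ∈ HLie.deg p) :
    lieToBase x ∈ HLie.deg p := by
  intro i hi v
  rw [lieToBase_apply, DirectSum.lmap_lof]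
  exact hx i hi _

/-- The extension by zero of a functional on `V` to `W = V ⊕ Z`. -/
def lieOfBase : HLie V →ₗ[ℚ] HLie (fun i => V i × Z i) := (DirectSum.lmap (prV V Z)).dualMap

theorem lieOfBase_apply (x : HLie V) (w : ⨁ i, V i × Z i) :
    lieOfBase (Z := Z) x w = x (DirectSum.lmap (prV V Z) w) := rfl

theorem lmap_prV_inV (v : ⨁ i, V i) :
    DirectSum.lmap (prV V Z) (DirectSum.lmap (inV V Z) v) = v := by
  rw [← LinearMap.comp_apply, ← DirectSum.lmap_comp]
  simp only [LinearMap.fst_comp_inl, DirectSum.lmap_id]; rfl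

theorem lieToBase_lieOfBase (x : HLie V) : lieToBase (lieOfBase (Z := Z) x) = x := by
  refine LinearMap.ext fun v => ?_
  rw [lieToBase_apply, lieOfBase_apply, lmap_prV_inV]

theorem lieToBase_surjective : Function.Surjective (lieToBase (V := V) (Z := Z)) :=
  fun x => ⟨lieOfBase x, lieToBase_lieOfBase x⟩

theorem lieOfBase_mem_deg {p : ℕ} {x : HLie V} (hx : x ∈ HLie.deg p) :
    lieOfBase (Z := Z) x ∈ HLie.deg p := by
  intro i hi v
  rw [lieOfBase_apply, DirectSum.lmap_lof]
  exact hx i hi _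

theorem coad_lmap_inV (hext : IsLambdaExtension dV dW) (x : HLie fun i => V i × Z i)
    (v : ⨁ i, V i) : coad dW x (DirectSum.lmap (inV V Z) v) =
      DirectSum.lmap (inV V Z) (coad dV (lieToBase x) v) := by
  rw [coad_apply, ← FreeCGA.map_ι, hext.comm, ctr_map, lin_map, coad_apply]
  congr 4
  refine LinearMap.ext fun v => ?_
  simp only [LinearMap.comp_apply, sgn_lmap, lieToBase_apply]

theorem lieToBase_bracket (hext : IsLambdaExtension dV dW) (x y : HLie fun i => V i × Z i) :
    lieToBase (HLie.bracket dW x y) = HLie.bracket dV (lieToBase x) (lieToBase y) := by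
  refine LinearMap.ext fun v => ?_
  rw [lieToBase_apply, bracket_apply, bracket_apply, coad_lmap_inV hext]; rfl

/-- An index of `⋀V` as an index of `⋀W`. -/
def Idx.push (hW : IsDer 1 dW) (hext : IsLambdaExtension dV dW) (S : Idx dV) : Idx dW :=
  Idx.ofGenerators hW (S.1.map (DirectSum.lmap (inV V Z)))
    (by have := S.finite; infer_instance) (S.homog.map _) (by
      rintro _ ⟨v, hv, rfl⟩
      rw [← FreeCGA.map_ι, hext.comm]
      have := map_mem_sub (inV V Z) (S.stable _ (ι_mem_sub hv))
      rwa [← Submodule.map_coe] at this)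

/-- The map `L_{S} → L_S` identifying the Lie algebras of an index of `⋀V`, seen in `⋀W` and in
`⋀V`. -/
def Idx.pull (hW : IsDer 1 dW) (hext : IsLambdaExtension dV dW) (S : Idx dV) :
    (S.push hW hext).Lie →ₗ[ℚ] S.Lie :=
  ((DirectSum.lmap (inV V Z)).restrict (p := S.1) (q := (S.push hW hext).1)
    fun v hv => ⟨v, hv, rfl⟩).dualMap

theorem Idx.pull_res (hW : IsDer 1 dW) (hext : IsLambdaExtension dV dW) (S : Idx dV)
    (x : HLie fun i => V i × Z i) :
    S.pull hW hext ((S.push hW hext).res x) = S.res (lieToBase x) := rfl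

/-- The induced morphism of enveloping algebras. -/
def UEnv.pull (hW : IsDer 1 dW) (hext : IsLambdaExtension dV dW) (S : Idx dV) :
    UEnv (S.push hW hext) →ₐ[ℚ] UEnv S :=
  UEnv.lift (UEnv.ι S ∘ₗ S.pull hW hext) (by
    intro p q x y hx hy
    simp only [LinearMap.comp_apply, Idx.pull_res, lieToBase_bracket hext]
    exact UEnv.ι_mul_ι S p q _ _ (lieToBase_mem_deg hx) (lieToBase_mem_deg hy))

variable (V Z) in
/-- The morphism of free algebras induced by `L_W → L_V`. -/
def freeToBase : TensorAlgebra ℚ (HLie fun i => V i × Z i) →ₐ[ℚ] TensorAlgebra ℚ (HLie V) :=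
  TensorAlgebra.lift ℚ (TensorAlgebra.ι ℚ ∘ₗ lieToBase)

theorem freeToBase_ι (x : HLie fun i => V i × Z i) :
    freeToBase V Z (TensorAlgebra.ι ℚ x) = TensorAlgebra.ι ℚ (lieToBase x) := by
  simp [freeToBase]

theorem UEnv.pull_ofFree (hW : IsDer 1 dW) (hext : IsLambdaExtension dV dW) (S : Idx dV)
    (f : TensorAlgebra ℚ (HLie fun i => V i × Z i)) :
    UEnv.pull hW hext S (UEnv.ofFree (S.push hW hext) f) = UEnv.ofFree S (freeToBase V Z f) := by
  have : (UEnv.pull hW hext S).comp (UEnv.ofFree (S.push hW hext)) =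
      (UEnv.ofFree S).comp (freeToBase V Z) := by
    refine TensorAlgebra.hom_ext (LinearMap.ext fun x => ?_)
    simp only [LinearMap.comp_apply, AlgHom.toLinearMap_apply, AlgHom.comp_apply, freeToBase_ι,
      UEnv.ofFree_ι, UEnv.pull, UEnv.lift_ι, Idx.pull_res]
  exact DFunLike.congr_fun this f

theorem UEnv.aug_pull (hW : IsDer 1 dW) (hext : IsLambdaExtension dV dW) (S : Idx dV)
    (a : UEnv (S.push hW hext)) : UEnv.aug S (UEnv.pull hW hext S a) = UEnv.aug _ a := by
  have : (UEnv.aug S).comp (UEnv.pull hW hext S) = UEnv.aug _ := by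
    refine UEnv.hom_ext fun x => ?_
    rw [AlgHom.comp_apply, UEnv.aug_ι, UEnv.pull, UEnv.lift_ι, LinearMap.comp_apply, UEnv.aug_ι]
  exact DFunLike.congr_fun this a

theorem UEnv.pull_mem_pow (hW : IsDer 1 dW) (hext : IsLambdaExtension dV dW) (S : Idx dV)
    (n : ℕ) {a : UEnv (S.push hW hext)} (ha : a ∈ UEnv.augIdeal (S.push hW hext) ^ n) :
    UEnv.pull hW hext S a ∈ UEnv.augIdeal S ^ n := by
  induction n generalizing a with
  | zero => rw [Submodule.pow_zero, Ideal.one_eq_top]; exact Submodule.mem_top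
  | succ n ih =>
    rw [Submodule.pow_succ] at ha ⊢
    refine Submodule.mul_induction_on ha ?_ ?_
    · intro b hb c hc
      rw [map_mul]
      refine Ideal.mul_mem_mul (ih hb) ?_
      have hc' : UEnv.aug _ c = 0 := hc
      show UEnv.aug S _ = 0
      rw [UEnv.aug_pull, hc']
    · intro b c hb hc
      rw [map_add]
      exact add_mem hb hc

/-- The induced morphism `UL_S / I^n → UL_S / I^n`. -/
def UQuot.pull (hW : IsDer 1 dW) (hext : IsLambdaExtension dV dW) (S : Idx dV) (n : ℕ) :
    UQuot (S.push hW hext) n →ₐ[ℚ] UQuot S n :=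
  Ideal.Quotient.liftₐ (UEnv.augIdeal (S.push hW hext) ^ n)
    ((Ideal.Quotient.mkₐ ℚ (UEnv.augIdeal S ^ n)).comp (UEnv.pull hW hext S))
    fun _ ha => Ideal.Quotient.eq_zero_iff_mem.2 (UEnv.pull_mem_pow hW hext S n ha)

theorem UQuot.pull_ofFree (hW : IsDer 1 dW) (hext : IsLambdaExtension dV dW) (S : Idx dV) (n : ℕ)
    (f : TensorAlgebra ℚ (HLie fun i => V i × Z i)) :
    UQuot.pull hW hext S n (UQuot.ofFree (S.push hW hext) n f) =
      UQuot.ofFree S n (freeToBase V Z f) := by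
  rw [UQuot.ofFree_apply S, ← UEnv.pull_ofFree hW hext]; rfl

/-- The morphism `π` of Sullivan completions induced by `L_W → L_V`. -/
def UBar.proj (hW : IsDer 1 dW) (hext : IsLambdaExtension dV dW) : UBar dW →ₐ[ℚ] UBar dV :=
  AlgHom.codRestrict
    (AlgHom.pi fun S => AlgHom.pi fun n => (UQuot.pull hW hext S n).comp
      (((Pi.evalAlgHom ℚ _ n).comp (Pi.evalAlgHom ℚ _ (S.push hW hext))).comp (UBar dW).val))
    (UBar dV) (by
      intro a S S' n n' h hn
      show UQuot.trans h hn (UQuot.pull hW hext S' n' (a.1 (S'.push hW hext) n')) =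
        UQuot.pull hW hext S n (a.1 (S.push hW hext) n)
      have h' : (S.push hW hext).1 ≤ (S'.push hW hext).1 := Submodule.map_mono h
      -- Compatibility may be checked on the free algebra, where all the maps are explicit.
      obtain ⟨f, hf⟩ := UBar.exists_ofFree a (S'.push hW hext) n'
      rw [← a.2 _ _ n n' h' hn, ← hf, (UBar.ofFree dW f).2 _ _ n n' h' hn, UBar.ofFree_apply,
        UBar.ofFree_apply, UQuot.pull_ofFree, UQuot.pull_ofFree, ← UBar.ofFree_apply,
        ← UBar.ofFree_apply, (UBar.ofFree dV _).2 _ _ n n' h hn])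

theorem UBar.proj_apply (hW : IsDer 1 dW) (hext : IsLambdaExtension dV dW) (a : UBar dW)
    (S : Idx dV) (n : ℕ) :
    (UBar.proj hW hext a).1 S n = UQuot.pull hW hext S n (a.1 (S.push hW hext) n) := rfl

theorem UBar.proj_ofFree (hW : IsDer 1 dW) (hext : IsLambdaExtension dV dW)
    (f : TensorAlgebra ℚ (HLie fun i => V i × Z i)) :
    UBar.proj hW hext (UBar.ofFree dW f) = UBar.ofFree dV (freeToBase V Z f) := by
  refine Subtype.ext (funext fun S => funext fun n => ?_)
  rw [UBar.proj_apply, UBar.ofFree_apply, UBar.ofFree_apply, UQuot.pull_ofFree]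

theorem isCompletedProjection_proj (hW : IsDer 1 dW) (hext : IsLambdaExtension dV dW) :
    IsCompletedProjection dV dW (UBar.proj hW hext) where
  extends_lie x := by
    have := UBar.proj_ofFree hW hext (TensorAlgebra.ι ℚ x)
    rwa [freeToBase_ι, UBar.ofFree_ι, UBar.ofFree_ι] at this
  continuous S n := ⟨S.push hW hext, n, fun a ha => by rw [UBar.proj_apply, ha, map_zero]⟩

theorem IsCompletedProjection.unique (hW : IsDer 1 dW) {π π' : UBar dW →ₐ[ℚ] UBar dV}
    (h : IsCompletedProjection dV dW π) (h' : IsCompletedProjection dV dW π') : π = π' := by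
  have hf : π.comp (UBar.ofFree dW) = π'.comp (UBar.ofFree dW) := by
    refine TensorAlgebra.hom_ext (LinearMap.ext fun x => ?_)
    simp only [LinearMap.comp_apply, AlgHom.toLinearMap_apply, AlgHom.comp_apply, UBar.ofFree_ι,
      h.extends_lie, h'.extends_lie]
  refine AlgHom.ext fun a => Subtype.ext (funext fun S => funext fun n => ?_)
  let pr : UBar dV →ₗ[ℚ] UQuot S n :=
    { toFun := fun a => a.1 S n
      map_add' := fun _ _ => rfl
      map_smul' := fun _ _ => rfl }
  have h1 : IsCont (pr ∘ₗ π.toLinearMap) := h.continuous S n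
  have h2 : IsCont (pr ∘ₗ π'.toLinearMap) := h'.continuous S n
  have := h1.ext hW h2 fun f => congrArg pr (DFunLike.congr_fun hf f)
  exact LinearMap.congr_fun this a

theorem freeToBase_surjective : Function.Surjective (freeToBase V Z) := by
  intro f
  induction f using TensorAlgebra.induction with
  | algebraMap r => exact ⟨algebraMap ℚ _ r, AlgHom.commutes _ r⟩
  | ι x => exact ⟨TensorAlgebra.ι ℚ (lieOfBase x), by rw [freeToBase_ι, lieToBase_lieOfBase]⟩
  | mul x y hx hy =>
    obtain ⟨a, rfl⟩ := hx
    obtain ⟨b, rfl⟩ := hy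
    exact ⟨a * b, map_mul _ _ _⟩
  | add x y hx hy =>
    obtain ⟨a, rfl⟩ := hx
    obtain ⟨b, rfl⟩ := hy
    exact ⟨a + b, map_add _ _ _⟩

theorem map_freeToBase_freeDeg (p : ℕ) :
    (freeDeg (fun i => V i × Z i) p).map (freeToBase V Z).toLinearMap = freeDeg V p := by
  refine le_antisymm (Submodule.map_le_iff_le_comap.2 ?_) ?_
  · rw [freeDeg, Submodule.span_le]
    rintro _ ⟨l, hl, hp, rfl⟩
    refine Submodule.subset_span ⟨l.map fun c => (c.1, lieToBase c.2), ?_, ?_, ?_⟩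
    · intro c hc
      obtain ⟨b, hb, rfl⟩ := List.mem_map.1 hc
      exact lieToBase_mem_deg (hl b hb)
    · simpa [Function.comp_def] using hp
    · simp [map_list_prod, Function.comp_def, freeToBase_ι]
  · rw [freeDeg, Submodule.span_le]
    rintro _ ⟨l, hl, hp, rfl⟩
    refine ⟨((l.map fun c => (c.1, lieOfBase (Z := Z) c.2)).map
      fun c => TensorAlgebra.ι ℚ c.2).prod, Submodule.subset_span ⟨_, ?_, ?_, rfl⟩, ?_⟩
    · intro c hc
      obtain ⟨b, hb, rfl⟩ := List.mem_map.1 hc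
      exact lieOfBase_mem_deg (hl b hb)
    · simpa [Function.comp_def] using hp
    · simp [map_list_prod, Function.comp_def, freeToBase_ι, lieToBase_lieOfBase]

/-- Pullback of continuous functionals along the morphism of free algebras. -/
def contDual.pull (hV : IsDer 1 dV) (hW : IsDer 1 dW) (hext : IsLambdaExtension dV dW) :
    contDual hV →ₗ[ℚ] contDual hW where
  toFun φ := ⟨φ.1 ∘ₗ (freeToBase V Z).toLinearMap, by
    obtain ⟨S, n, h⟩ := φ.2
    refine ⟨S.push hW hext, n, fun f hf => h _ ?_⟩
    have := UQuot.pull_ofFree hW hext S n f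
    rw [hf, map_zero] at this
    exact this.symm⟩
  map_add' _ _ := rfl
  map_smul' _ _ := rfl

/-- `π` is the transpose of `contDual.pull`, so a preimage of `a` is an extension along it of the
functional attached to `a`. The subspace `K` is where the extension is required to vanish; it allows
the degree of the preimage to be prescribed. -/
theorem exists_proj_eq (hV : IsDer 1 dV) (hW : IsDer 1 dW) (hext : IsLambdaExtension dV dW)
    (a : UBar dV) (K : Submodule ℚ (contDual hW))
    (hK : ∀ α : Module.Dual ℚ (contDual hV),
      (∀ p, a ∈ UBar.deg p → ∀ φ : contDual hV, (∀ f ∈ freeDeg V p, φ.1 f = 0) → α φ = 0) →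
      ∀ φ, contDual.pull hV hW hext φ ∈ K → α φ = 0) :
    ∃ b : UBar dW, UBar.proj hW hext b = a ∧
      ∀ (S : Idx dW) (n : ℕ) (ψ : Module.Dual ℚ (UQuot S n)), contDual.ofQuot hW S n ψ ∈ K →
        ψ (b.1 S n) = 0 := by
  obtain ⟨α, hα, hα'⟩ := exists_functional hV a
  obtain ⟨l, hl, hlK⟩ := exists_extend (contDual.pull hV hW hext) K α (hK α hα')
  obtain ⟨b, hb⟩ := exists_of_functional hW l
  refine ⟨b, ?_, fun S n ψ hψ => by rw [hb, hlK _ hψ]⟩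
  refine Subtype.ext (funext fun S => funext fun n => ?_)
  rw [← sub_eq_zero]
  refine (Module.forall_dual_apply_eq_zero_iff ℚ _).1 fun ψ => ?_
  rw [map_sub, sub_eq_zero, ← hα, ← hl, UBar.proj_apply]
  have := hb (S.push hW hext) n (ψ ∘ₗ (UQuot.pull hW hext S n).toLinearMap)
  rw [LinearMap.comp_apply, AlgHom.toLinearMap_apply] at this
  rw [this]
  congr 1
  refine Subtype.ext (LinearMap.ext fun f => ?_)
  exact congrArg ψ (UQuot.pull_ofFree hW hext S n f)

theorem proj_surjective (hV : IsDer 1 dV) (hW : IsDer 1 dW) (hext : IsLambdaExtension dV dW) :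
    Function.Surjective (UBar.proj hW hext) := by
  intro a
  obtain ⟨b, hb, -⟩ := exists_proj_eq hV hW hext a ⊥ (by
    intro α _ φ hφ
    have : φ = 0 := by
      refine Subtype.ext (LinearMap.ext fun f => ?_)
      obtain ⟨g, rfl⟩ := freeToBase_surjective (Z := Z) f
      exact LinearMap.congr_fun (congrArg Subtype.val ((Submodule.mem_bot ℚ).1 hφ)) g
    rw [this, map_zero])
  exact ⟨b, hb⟩

theorem map_proj_deg (hV : IsDer 1 dV) (hW : IsDer 1 dW) (hext : IsLambdaExtension dV dW)
    (p : ℕ) : (UBar.deg (d := dW) p).map (UBar.proj hW hext).toLinearMap =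
      UBar.deg (d := dV) p := by
  apply le_antisymm
  · rintro _ ⟨b, hb, rfl⟩ S n
    obtain ⟨f, hf, hfb⟩ := UBar.exists_ofFree_deg hb (S.push hW hext) n
    show (UBar.proj hW hext b).1 S n ∈ _
    rw [UBar.proj_apply, ← hfb, UBar.ofFree_apply, UQuot.pull_ofFree, UQuot.ofFree_apply]
    refine ⟨_, ?_, rfl⟩
    rw [SetLike.mem_coe, ← map_freeDeg, ← map_freeToBase_freeDeg (Z := Z)]
    exact ⟨_, ⟨f, hf, rfl⟩, rfl⟩
  · intro a ha
    -- The functionals vanishing in degree `p`: an element of the completion that they all kill is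
    -- of degree `p`. The compatibility condition holds because the degree `p` part of the free
    -- algebra on `L_V` is the image of that on `L_W`.
    let K : Submodule ℚ (contDual hW) :=
      { carrier := {φ | ∀ f ∈ freeDeg (fun i => V i × Z i) p, φ.1 f = 0}
        zero_mem' := fun f _ => rfl
        add_mem' := fun {φ ψ} h h' f hf => by
          rw [Submodule.coe_add, LinearMap.add_apply, h f hf, h' f hf, add_zero]
        smul_mem' := fun c φ h f hf => by
          rw [Submodule.coe_smul, LinearMap.smul_apply, h f hf, smul_zero] }
    obtain ⟨b, hb, hbK⟩ := exists_proj_eq hV hW hext a K (by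
      intro α hα φ hφ
      refine hα p ha φ fun f hf => ?_
      rw [← map_freeToBase_freeDeg (Z := Z)] at hf
      obtain ⟨g, hg, rfl⟩ := hf
      exact hφ g hg)
    refine ⟨b, fun S n => ?_, hb⟩
    -- A vector lies in a subspace as soon as the annihilator of the subspace kills it.
    refine (Subspace.forall_mem_dualAnnihilator_apply_eq_zero_iff _ _).1 fun ψ hψ => ?_
    refine hbK S n ψ fun f hf => ?_
    refine (Submodule.mem_dualAnnihilator _).1 hψ _ ⟨UEnv.ofFree S f, ?_, rfl⟩
    rw [SetLike.mem_coe, ← map_freeDeg]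
    exact ⟨f, hf, rfl⟩

end Projection

end

section

open FreeCGA

/-! ### Locally nilpotent actions, and the socle filtration dual to the lower central series -/

section Chains

variable {V : ℕ → Type*} [∀ i, AddCommGroup (V i)] [∀ i, Module ℚ (V i)]
  {d : FreeCGA V →ₗ[ℚ] FreeCGA V}

/-- A locally finite and locally nilpotent representation of the graded Lie algebra `L_V` extends
to a continuous representation of the Sullivan completion. -/
theorem exists_rep_of_chain (hd : IsDer 1 d) {M : Type*} [AddCommGroup M] [Module ℚ M]
    (A : HLie V →ₗ[ℚ] Module.End ℚ M)
    (hrel : ∀ p q (x y : HLie V), x ∈ HLie.deg p → y ∈ HLie.deg q →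
      ∀ m, A x (A y m) = (-1 : ℚ) ^ (p * q) • A y (A x m) + A (HLie.bracket d x y) m)
    (hch : ∀ m, ∃ (N : ℕ → Submodule ℚ M) (S : Idx d) (n : ℕ), N 0 = ⊥ ∧ Monotone N ∧
      (∀ x k, ∀ m ∈ N (k + 1), A x m ∈ N k) ∧
      (∀ x, (∀ v ∈ S.1, x v = 0) → ∀ m ∈ N n, A x m = 0) ∧ m ∈ N n) :
    ∃ R : UBar d →ₐ[ℚ] Module.End ℚ M, (∀ x, R (UBar.ι x) = A x) ∧
      ∀ m, IsCont (evalAt R m) := by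
  obtain ⟨R, hR, hc⟩ := exists_rep hd (TensorAlgebra.lift ℚ A) (by
    intro m
    obtain ⟨N, S, n, h0, hmono, hA, hS, hm⟩ := hch m
    exact ⟨S, n, fun f hf => lift_eq_zero hrel N h0 hmono hA S n
      (fun x hx => hS x (Idx.res_eq_zero.1 hx)) hf hm⟩)
  refine ⟨R, fun x => ?_, hc⟩
  rw [← UBar.ofFree_ι, hR, TensorAlgebra.lift_ι_apply]

/-- The restriction of a representation to a stable subspace. -/
def restrictRep {A : Type*} [Ring A] [Algebra ℚ A] {M : Type*} [AddCommGroup M] [Module ℚ M]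
    (R : A →ₐ[ℚ] Module.End ℚ M) (P : Submodule ℚ M)
    (hP : ∀ a, ∀ m ∈ P, R a m ∈ P) : A →ₐ[ℚ] Module.End ℚ P :=
  AlgHom.ofLinearMap
    { toFun := fun a => (R a).restrict (hP a)
      map_add' := fun a b => LinearMap.ext fun m => Subtype.ext (by simp)
      map_smul' := fun c a => LinearMap.ext fun m => Subtype.ext (by simp) }
    (LinearMap.ext fun m => Subtype.ext (by simp))
    (fun a b => LinearMap.ext fun m => Subtype.ext (by simp))

@[simp] theorem restrictRep_apply {A : Type*} [Ring A] [Algebra ℚ A] {M : Type*} [AddCommGroup M]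
    [Module ℚ M] (R : A →ₐ[ℚ] Module.End ℚ M) (P : Submodule ℚ M)
    (hP : ∀ a, ∀ m ∈ P, R a m ∈ P) (a : A) (m : P) :
    (restrictRep R P hP a m : M) = R a m := rfl

theorem isCont_restrictRep {M : Type*} [AddCommGroup M] [Module ℚ M]
    {R : UBar d →ₐ[ℚ] Module.End ℚ M} (hR : ∀ m, IsCont (evalAt R m)) (P : Submodule ℚ M)
    (hP : ∀ a, ∀ m ∈ P, R a m ∈ P) (m : P) : IsCont (evalAt (restrictRep R P hP) m) := by
  obtain ⟨S, n, h⟩ := hR m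
  exact ⟨S, n, fun a ha => Subtype.ext (h a ha)⟩

/-! ### The Sullivan lower central series as an annihilator -/

/-- The socle filtration of `V` under the coadjoint action. -/
def socle (d : FreeCGA V →ₗ[ℚ] FreeCGA V) : ℕ → Submodule ℚ (⨁ i, V i)
  | 0 => ⊥
  | k + 1 => ⨅ x : HLie V, (socle d k).comap (coad d x)

theorem mem_socle_succ {k : ℕ} {v : ⨁ i, V i} :
    v ∈ socle d (k + 1) ↔ ∀ x, coad d x v ∈ socle d k := by
  simp [socle]

theorem mem_socle_succ_of_deg (h0 : Subsingleton (V 0)) {k : ℕ} {v : ⨁ i, V i}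
    (h : ∀ p, ∀ x ∈ HLie.deg (V := V) p, coad d x v ∈ socle d k) : v ∈ socle d (k + 1) := by
  rw [mem_socle_succ]
  intro x
  obtain ⟨N, hN⟩ := coad_eq_sum (d := d) h0 v
  rw [hN N le_rfl]
  exact Submodule.sum_mem _ fun p _ => h p _ (HLie.comp_mem p x)

theorem lin_tw (a : FreeCGA V) : lin V (tw V 1 a) = sgn V (lin V a) := by
  rw [tw, lin_map]
  congr 1
  simp [sgn]

theorem ι_sgn (v : ⨁ i, V i) : FreeCGA.ι V (sgn V v) = tw V 1 (FreeCGA.ι V v) := by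
  rw [tw, map_ι]
  congr 2
  simp [sgn]

theorem coad_sgn (hd : IsMinimalSullivan d) {p : ℕ} {x : HLie V} (hx : x ∈ HLie.deg p)
    (v : ⨁ i, V i) : coad d x (sgn V v) = (-1 : ℚ) ^ p • sgn V (coad d x v) := by
  rw [coad_apply, coad_apply, HLie.comp_sgn hx, ι_sgn, hd.isDer.tw, map_smul, ctr_smul, ctr_smul,
    (isDer_ctr hx).tw]
  simp only [map_smul, lin_tw, smul_smul]
  congr 1
  ring

theorem sgn_mem_socle (hd : IsMinimalSullivan d) {k : ℕ} {v : ⨁ i, V i} (hv : v ∈ socle d k) :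
    sgn V v ∈ socle d k := by
  induction k generalizing v with
  | zero =>
    have : v = 0 := hv
    rw [this, map_zero]; exact zero_mem _
  | succ k ih =>
    refine mem_socle_succ_of_deg hd.connected fun p x hx => ?_
    rw [coad_sgn hd hx]
    exact Submodule.smul_mem _ _ (ih (mem_socle_succ.1 hv x))

theorem sgn_pow_mem {P : Submodule ℚ (⨁ i, V i)} (h : ∀ v ∈ P, sgn V v ∈ P) (k : ℕ)
    {v : ⨁ i, V i} (hv : v ∈ P) : (sgn V ^ k) v ∈ P := by
  induction k with
  | zero => exact hv
  | succ k ih => rw [pow_succ']; exact h _ ih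

theorem sgn_pow_sgn_pow (k : ℕ) (v : ⨁ i, V i) : (sgn V ^ k) ((sgn V ^ k) v) = v := by
  have h : sgn V * sgn V = 1 := LinearMap.ext sgn_sgn
  rw [← Module.End.mul_apply, ← pow_add, ← two_mul, pow_mul, pow_two, h, one_pow]; rfl

/-- Antisymmetry of the bracket, with only one homogeneous argument. -/
theorem bracket_eq_neg (hd : IsMinimalSullivan d) {p : ℕ} {x : HLie V} (hx : x ∈ HLie.deg p)
    (y : HLie V) (v : ⨁ i, V i) :
    HLie.bracket d x y v = -(-1 : ℚ) ^ p * y ((sgn V ^ p) (coad d x v)) := by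
  rw [bracket_apply]
  obtain ⟨N, hN⟩ := coad_eq_sum (d := d) hd.connected v
  obtain ⟨M, hM⟩ := HLie.apply_eq_sum hd.connected ((sgn V ^ p) (coad d x v))
  rw [hN _ (le_max_left N M), map_sum, hM _ (le_max_right _ _), Finset.mul_sum]
  refine Finset.sum_congr rfl fun q _ => ?_
  have h1 := LinearMap.congr_fun (bracket_symm (d := d) hx (HLie.comp_mem q y)) v
  have h2 := LinearMap.congr_fun (HLie.comp_sgn_pow (HLie.comp_mem q y) p) (coad d x v)
  rw [LinearMap.comp_apply] at h2
  rw [← bracket_apply, h1, h2]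
  simp only [LinearMap.smul_apply, bracket_apply, smul_eq_mul]
  rw [← mul_assoc]
  congr 1
  have h3 : (-1 : ℚ) ^ p * (-1) ^ p = 1 := by rw [← mul_pow]; simp
  have h4 : (q + 1) * p = p * q + p := by ring
  rw [h4, pow_add]
  linear_combination (-1 : ℚ) ^ (p * q) * h3

/-- Up to sign `[x, y]` at `v` is `y` at a sign twist of `coad x v`. If `y` runs through the
annihilator of the `r`-th socle, the common zeros of these brackets in `S` are the `v` that every
`x` maps into that socle, i.e. the next socle. As `S` is finite dimensional, `L_S^{r+2}` is
recovered as the annihilator of its common zeros. -/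
theorem lcs_succ_eq (hd : IsMinimalSullivan d) (S : Idx d) (r : ℕ) :
    S.lcs (r + 1) = ((socle d r).comap S.1.subtype).dualAnnihilator := by
  have := S.finite
  induction r with
  | zero =>
    have h : (socle d 0).comap S.1.subtype = ⊥ := by
      rw [show socle d 0 = ⊥ from rfl, Submodule.comap_bot, Submodule.ker_subtype]
    rw [h, Submodule.dualAnnihilator_bot]; rfl
  | succ r ih =>
    have hres : ∀ y : HLie V, S.res y ∈ S.lcs (r + 1) ↔
        ∀ v ∈ S.1, v ∈ socle d r → y v = 0 := by
      intro y
      rw [ih, Submodule.mem_dualAnnihilator]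
      exact ⟨fun h v hv hv' => h ⟨v, hv⟩ hv', fun h v hv => h v v.2 hv⟩
    have hcoann : (S.lcs (r + 2)).dualCoannihilator = (socle d (r + 1)).comap S.1.subtype := by
      ext v
      rw [Submodule.mem_dualCoannihilator]
      constructor
      · intro h
        refine mem_socle_succ_of_deg hd.connected fun p x hx => ?_
        have hmem : coad d x v ∈ S.1 := coad_mem S.homog (S.stable _ (ι_mem_sub v.2)) x
        suffices h2 : (⟨coad d x v, hmem⟩ : S.1) ∈ (socle d r).comap S.1.subtype from h2
        refine (Subspace.forall_mem_dualAnnihilator_apply_eq_zero_iff _ _).1 fun l hl => ?_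
        obtain ⟨y, rfl⟩ := S.res_surjective l
        rw [← ih, hres] at hl
        -- Using `y ∘ sgn ^ p` in place of `y` cancels the involution in `bracket_eq_neg`; it is
        -- admissible because `S` and the socle are stable under `sgn`.
        have h3 := h _ (Submodule.subset_span ⟨x, y ∘ₗ sgn V ^ p, (hres _).2 fun w hw hw' =>
          hl _ (sgn_pow_mem (fun _ => S.homog.sgn_mem) p hw)
            (sgn_pow_mem (fun _ => sgn_mem_socle hd) p hw'), rfl⟩)
        have h4 : HLie.bracket d x (y ∘ₗ sgn V ^ p) v = 0 := h3
        rw [bracket_eq_neg hd hx, LinearMap.comp_apply, sgn_pow_sgn_pow] at h4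
        have h5 : -(-1 : ℚ) ^ p ≠ 0 := by simp
        exact (mul_eq_zero.1 h4).resolve_left h5
      · intro hv
        suffices h : S.lcs (r + 2) ≤ LinearMap.ker (LinearMap.applyₗ v :
            Module.Dual ℚ S.1 →ₗ[ℚ] ℚ) from fun l hl => h hl
        refine Submodule.span_le.2 ?_
        rintro _ ⟨x, y, hy, rfl⟩
        show HLie.bracket d x y v = 0
        rw [bracket_apply]
        obtain ⟨N, hN⟩ := HLie.apply_eq_sum hd.connected (coad d y v)
        rw [hN N le_rfl]
        refine Finset.sum_eq_zero fun p _ => ?_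
        rw [← bracket_apply, bracket_eq_neg hd (HLie.comp_mem p x)]
        have h2 := coad_mem S.homog (S.stable _ (ι_mem_sub v.2)) (HLie.comp p x)
        have h3 := mem_socle_succ.1 hv (HLie.comp p x)
        rw [(hres y).1 hy _ (sgn_pow_mem (fun _ => S.homog.sgn_mem) p h2)
          (sgn_pow_mem (fun _ => sgn_mem_socle hd) p h3), mul_zero]
    rw [← hcoann, Subspace.dualCoannihilator_dualAnnihilator_eq]

/-- `L_V^{(r+1)}` is the annihilator of the `r`-th term of the socle filtration. -/
theorem mem_sullivanLCS_succ (hd : IsMinimalSullivan d) {r : ℕ} {y : HLie V} :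
    y ∈ sullivanLCS d (r + 1) ↔ ∀ v ∈ socle d r, y v = 0 := by
  simp only [sullivanLCS, Submodule.mem_iInf, Submodule.mem_comap, lcs_succ_eq hd,
    Submodule.mem_dualAnnihilator]
  constructor
  · intro h v hv
    obtain ⟨S, hS⟩ := exists_idx_mem hd v
    exact h S ⟨v, hS⟩ hv
  · intro h S v hv
    exact h v hv

theorem sullivanLCS_zero : sullivanLCS d 0 = ⊤ := by
  simp [sullivanLCS, Idx.lcs]

end Chains

/-! ### The quotient algebra `⋀Z` and the coadjoint action of `L_W` on `Z` -/

section Fibre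

variable {V Z : ℕ → Type*}
  [∀ i, AddCommGroup (V i)] [∀ i, Module ℚ (V i)]
  [∀ i, AddCommGroup (Z i)] [∀ i, Module ℚ (Z i)]
  {dV : FreeCGA V →ₗ[ℚ] FreeCGA V}
  {dW : FreeCGA (fun i => V i × Z i) →ₗ[ℚ] FreeCGA (fun i => V i × Z i)}

theorem map_prZ_inZ (a : FreeCGA Z) :
    FreeCGA.map (prZ V Z) (FreeCGA.map (inZ V Z) a) = a := by
  rw [map_comp_apply]
  simp only [LinearMap.snd_comp_inr]
  exact map_id_apply a

theorem map_prZ_inV (a : FreeCGA V) :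
    FreeCGA.map (prZ V Z) (FreeCGA.map (inV V Z) a) = algebraMap ℚ _ (aug V a) := by
  have : (FreeCGA.map (prZ V Z)).comp (FreeCGA.map (inV V Z)) =
      (Algebra.ofId ℚ _).comp (aug V) := algHom_ext (by intro i v; simp)
  exact DFunLike.congr_fun this a

theorem lmap_prZ_inZ (z : ⨁ i, Z i) :
    DirectSum.lmap (prZ V Z) (DirectSum.lmap (inZ V Z) z) = z := by
  rw [← LinearMap.comp_apply, ← DirectSum.lmap_comp]
  simp only [LinearMap.snd_comp_inr, DirectSum.lmap_id]; rfl

theorem lmap_prZ_inV (v : ⨁ i, V i) :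
    DirectSum.lmap (prZ V Z) (DirectSum.lmap (inV V Z) v) = 0 := by
  induction v using DirectSum.induction_on with
  | zero => simp
  | of i v => rw [← DirectSum.lof_eq_of ℚ, DirectSum.lmap_lof, DirectSum.lmap_lof]; simp
  | add x y hx hy => rw [map_add, map_add, hx, hy, add_zero]

theorem lmap_decomp (w : ⨁ i, V i × Z i) :
    w = DirectSum.lmap (inV V Z) (DirectSum.lmap (prV V Z) w) +
      DirectSum.lmap (inZ V Z) (DirectSum.lmap (prZ V Z) w) := by
  induction w using DirectSum.induction_on with
  | zero => simp
  | of i w =>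
    simp only [← DirectSum.lof_eq_of ℚ, DirectSum.lmap_lof]
    rw [← map_add]; simp
  | add x y hx hy =>
    simp only [map_add]
    nth_rewrite 1 [hx, hy]
    abel

theorem gen_decomp (i : ℕ) (w : V i × Z i) :
    gen (fun i => V i × Z i) i w = FreeCGA.map (inV V Z) (gen V i w.1) +
      FreeCGA.map (inZ V Z) (gen Z i w.2) := by
  rw [map_gen, map_gen, ← map_add]; simp

theorem isDer_descend {k : ℕ} {D : FreeCGA (fun i => V i × Z i) →ₗ[ℚ] FreeCGA fun i => V i × Z i}
    (hD : IsDer k D) : IsDer k ((FreeCGA.map (prZ V Z)).toLinearMap ∘ₗ D ∘ₗ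
      (FreeCGA.map (inZ V Z)).toLinearMap) where
  mul a b := by
    simp only [LinearMap.comp_apply, AlgHom.toLinearMap_apply, map_mul, hD.mul, map_add,
      tw_map, map_prZ_inZ]
  tw j a := by
    simp only [LinearMap.comp_apply, AlgHom.toLinearMap_apply, ← tw_map, hD.tw, map_smul]

/-- A derivation of `⋀W` preserving `⋀⁺V` descends to `⋀Z = ⋀W / (⋀⁺V)`. -/
theorem descend_apply {k : ℕ}
    {D : FreeCGA (fun i => V i × Z i) →ₗ[ℚ] FreeCGA fun i => V i × Z i}
    (hD : IsDer k D) (h0 : ∀ i w, aug _ (D (gen _ i w)) = 0)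
    (hV : ∀ i (v : V i), D (FreeCGA.map (inV V Z) (gen V i v)) ∈
      LinearMap.range (FreeCGA.map (inV V Z)).toLinearMap) (b : FreeCGA fun i => V i × Z i) :
    FreeCGA.map (prZ V Z) (D b) =
      FreeCGA.map (prZ V Z) (D (FreeCGA.map (inZ V Z) (FreeCGA.map (prZ V Z) b))) := by
  refine hD.map_comp_ext (isDer_descend hD) (prZ V Z) (fun i w => ?_) b
  simp only [LinearMap.comp_apply, AlgHom.toLinearMap_apply]
  rw [gen_decomp, map_add, map_add]
  obtain ⟨c, hc⟩ := hV i w.1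
  have hc0 : aug V c = 0 := by
    rw [← aug_map (inV V Z)]
    rw [AlgHom.toLinearMap_apply] at hc
    rw [hc, map_gen]
    exact h0 _ _
  rw [← hc, AlgHom.toLinearMap_apply, map_prZ_inV, hc0, map_zero, zero_add]
  rfl

/-- `dW` preserves `⋀V` and the augmentation ideal, hence the ideal generated by `⋀⁺V`; so the
projection onto `⋀Z` is a morphism of complexes. -/
theorem quotDiff_map_prZ (hW : IsMinimalSullivan dW) (hext : IsLambdaExtension dV dW)
    (b : FreeCGA fun i => V i × Z i) :
    quotDiff dW (FreeCGA.map (prZ V Z) b) = FreeCGA.map (prZ V Z) (dW b) :=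
  (descend_apply hW.isDer hW.aug_gen (fun i v => ⟨_, (hext.comm (gen V i v)).symm⟩) b).symm

theorem map_mem_wedgeGE {W : ℕ → Type*} [∀ i, AddCommGroup (W i)] [∀ i, Module ℚ (W i)]
    (f : ∀ i, V i →ₗ[ℚ] W i) {p : ℕ} {a : FreeCGA V} (ha : a ∈ wedgeGE V p) :
    FreeCGA.map f a ∈ wedgeGE W p := by
  have h : wedgeGE V p ≤ (wedgeGE W p).comap (FreeCGA.map f).toLinearMap := by
    refine iSup₂_le fun q hq => ?_
    rw [← Submodule.map_le_iff_le_comap, Submodule.map_pow]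
    refine le_trans (pow_le_pow_left' ?_ q) (le_iSup₂_of_le q hq le_rfl)
    rintro _ ⟨_, ⟨v, rfl⟩, rfl⟩
    exact ⟨DirectSum.lmap f v, (map_ι f v).symm⟩
  exact h ha

theorem sullivanFiltration_prZ (hW : IsMinimalSullivan dW) (hext : IsLambdaExtension dV dW)
    (n : ℕ) {w : ⨁ i, V i × Z i} (hw : w ∈ sullivanFiltration dW n) :
    DirectSum.lmap (prZ V Z) w ∈ sullivanFiltration (quotDiff dW) n := by
  have h : ∀ w, quotDiff dW (FreeCGA.ι Z (DirectSum.lmap (prZ V Z) w)) =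
      FreeCGA.map (prZ V Z) (dW (FreeCGA.ι _ w)) := by
    intro w
    rw [← quotDiff_map_prZ hW hext, map_ι]
  induction n generalizing w with
  | zero =>
    have hw' : dW (FreeCGA.ι _ w) = 0 := hw
    show quotDiff dW (FreeCGA.ι Z _) = 0
    rw [h, hw', map_zero]
  | succ n ih =>
    rw [sullivanFiltration_succ] at hw ⊢
    rw [h]
    refine sub_mono ?_ (map_mem_sub (prZ V Z) hw)
    rintro _ ⟨w, hw, rfl⟩
    exact ih hw

/-- Every condition is inherited through the projection from `⋀W`; for the Sullivan condition,
`W(n)` projects into `Z(n)`. -/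
theorem quotDiff_isMinimalSullivan (hW : IsMinimalSullivan dW) (hext : IsLambdaExtension dV dW) :
    IsMinimalSullivan (quotDiff dW) where
  connected := ⟨fun a b => by
    have := hW.connected
    exact congrArg Prod.snd (Subsingleton.elim ((0, a) : V 0 × Z 0) (0, b))⟩
  degree n a ha := by
    rw [← degZ_natCast] at ha ⊢
    have := map_mem_degZ (prZ V Z) (hW.degZ (map_mem_degZ (inZ V Z) ha))
    exact_mod_cast this
  leibniz n a ha b := by
    have ha' : FreeCGA.map (inZ V Z) a ∈ deg _ n := by
      rw [← degZ_natCast] at ha ⊢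
      exact map_mem_degZ _ ha
    simp only [quotDiff, LinearMap.comp_apply, AlgHom.toLinearMap_apply, map_mul,
      hW.leibniz n _ ha', map_add, map_smul, map_prZ_inZ]
  square_zero a := by
    have : quotDiff dW a = FreeCGA.map (prZ V Z) (dW (FreeCGA.map (inZ V Z) a)) := rfl
    rw [this, quotDiff_map_prZ hW hext, hW.square_zero, map_zero]
  sullivan z := by
    obtain ⟨n, hn⟩ := hW.sullivan (DirectSum.lmap (inZ V Z) z)
    refine ⟨n, ?_⟩
    have := sullivanFiltration_prZ hW hext n hn
    rwa [lmap_prZ_inZ] at this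
  minimal z := by
    have : quotDiff dW (FreeCGA.ι Z z) =
      FreeCGA.map (prZ V Z) (dW (FreeCGA.map (inZ V Z) (FreeCGA.ι Z z))) := rfl
    rw [this, map_ι]
    exact map_mem_wedgeGE _ (hW.minimal _)

theorem lieOfFibre_apply (x : HLie Z) (w : ⨁ i, V i × Z i) :
    lieOfFibre x w = x (DirectSum.lmap (prZ V Z) w) := rfl

theorem lieOfFibre_injective : Function.Injective (lieOfFibre (V := V) (Z := Z)) := by
  intro x y h
  refine LinearMap.ext fun z => ?_
  have := LinearMap.congr_fun h (DirectSum.lmap (inZ V Z) z)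
  rwa [lieOfFibre_apply, lieOfFibre_apply, lmap_prZ_inZ] at this

theorem lieOfFibre_mem_deg {p : ℕ} {x : HLie Z} (hx : x ∈ HLie.deg p) :
    lieOfFibre (V := V) x ∈ HLie.deg p := by
  intro i hi w
  rw [lieOfFibre_apply, DirectSum.lmap_lof]
  exact hx i hi _

/-- The functionals vanishing on `V` come from `Z`. -/
theorem exists_lieOfFibre {x : HLie fun i => V i × Z i} (hx : lieToBase x = 0) :
    ∃ y : HLie Z, x = lieOfFibre y := by
  refine ⟨lieToFibre x, LinearMap.ext fun w => ?_⟩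
  have h1 : x (DirectSum.lmap (inV V Z) (DirectSum.lmap (prV V Z) w)) = 0 :=
    LinearMap.congr_fun hx _
  nth_rewrite 1 [lmap_decomp w]
  rw [map_add, h1, zero_add]; rfl

variable (dW) in
/-- The coadjoint action of `L_W` on `Z = W / V`. -/
def fibreAct : HLie (fun i => V i × Z i) →ₗ[ℚ] Module.End ℚ (⨁ i, Z i) where
  toFun x := DirectSum.lmap (prZ V Z) ∘ₗ coad dW x ∘ₗ DirectSum.lmap (inZ V Z)
  map_add' x y := LinearMap.ext fun z => by
    simp only [LinearMap.comp_apply, LinearMap.add_apply, coad_add, map_add]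
  map_smul' c x := LinearMap.ext fun z => by
    simp only [LinearMap.comp_apply, LinearMap.smul_apply, coad_smul, map_smul,
      RingHom.id_apply]

theorem fibreAct_apply (x : HLie fun i => V i × Z i) (z : ⨁ i, Z i) :
    fibreAct dW x z = DirectSum.lmap (prZ V Z) (coad dW x (DirectSum.lmap (inZ V Z) z)) := rfl

/-- `V` is stable under the coadjoint action, which therefore descends to `W / V`. -/
theorem fibreAct_prZ (hext : IsLambdaExtension dV dW) (x : HLie fun i => V i × Z i)
    (w : ⨁ i, V i × Z i) : fibreAct dW x (DirectSum.lmap (prZ V Z) w) =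
      DirectSum.lmap (prZ V Z) (coad dW x w) := by
  nth_rewrite 2 [lmap_decomp w]
  rw [map_add, map_add, coad_lmap_inV hext, lmap_prZ_inV, zero_add, fibreAct_apply]

theorem fibreAct_eq_sum (hW : IsMinimalSullivan dW) (z : ⨁ i, Z i) :
    ∃ N, ∀ x : HLie fun i => V i × Z i,
      fibreAct dW x z = ∑ p ∈ Finset.range N, fibreAct dW (HLie.comp p x) z := by
  obtain ⟨N, hN⟩ := coad_eq_sum (d := dW) hW.connected (DirectSum.lmap (inZ V Z) z)
  refine ⟨N, fun x => ?_⟩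
  simp only [fibreAct_apply, ← map_sum]
  rw [hN N le_rfl]

theorem fibreAct_rel (hW : IsMinimalSullivan dW) (hext : IsLambdaExtension dV dW) {p q : ℕ}
    {x y : HLie fun i => V i × Z i} (hx : x ∈ HLie.deg p) (hy : y ∈ HLie.deg q) (z : ⨁ i, Z i) :
    fibreAct dW x (fibreAct dW y z) = (-1 : ℚ) ^ (p * q) • fibreAct dW y (fibreAct dW x z) +
      fibreAct dW (HLie.bracket dW x y) z := by
  rw [fibreAct_apply y z, fibreAct_prZ hext, coad_coad hW hx hy, map_add, map_smul,
    ← fibreAct_prZ hext y, ← fibreAct_apply, ← fibreAct_apply]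

theorem fibreAct_lieOfFibre (hW : IsMinimalSullivan dW) (hext : IsLambdaExtension dV dW)
    (x : HLie Z) (z : ⨁ i, Z i) : fibreAct dW (lieOfFibre x) z = coad (quotDiff dW) x z := by
  rw [fibreAct_apply, coad_apply, coad_apply, ← lin_map]
  have h : lieOfFibre (V := V) x ∘ₗ sgn _ = (x ∘ₗ sgn Z) ∘ₗ DirectSum.lmap (prZ V Z) := by
    refine LinearMap.ext fun w => ?_
    simp only [LinearMap.comp_apply, sgn_lmap, lieOfFibre_apply]
  rw [h, ← ctr_map, ← quotDiff_map_prZ hW hext, map_ι, lmap_prZ_inZ]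

/-- Shows that `L_Z` is an ideal and that its right adjoint action is the transpose of `fibreAct`.
-/
theorem bracket_lieOfFibre (hext : IsLambdaExtension dV dW) (y : HLie Z)
    (x : HLie fun i => V i × Z i) :
    HLie.bracket dW (lieOfFibre y) x = lieOfFibre (y ∘ₗ fibreAct dW x) := by
  refine LinearMap.ext fun w => ?_
  rw [bracket_apply, lieOfFibre_apply, lieOfFibre_apply, LinearMap.comp_apply, fibreAct_prZ hext]

/-- To apply `y ∈ L_Z` after `x`, commute them: `y` first lowers the socle and induction applies,
while `[y, x]` again lies in the ideal `L_Z` and lowers the socle by itself. -/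
theorem fibreAct_mem_socle (hW : IsMinimalSullivan dW) (hext : IsLambdaExtension dV dW)
    (x : HLie fun i => V i × Z i) {k : ℕ} {z : ⨁ i, Z i} (hz : z ∈ socle (quotDiff dW) k) :
    fibreAct dW x z ∈ socle (quotDiff dW) k := by
  have hZ := quotDiff_isMinimalSullivan hW hext
  induction k generalizing z x with
  | zero =>
    have : z = 0 := hz
    rw [this, map_zero]; exact zero_mem _
  | succ k ih =>
    obtain ⟨N, hN⟩ := fibreAct_eq_sum hW z
    rw [hN]
    refine Submodule.sum_mem _ fun q _ => ?_
    refine mem_socle_succ_of_deg hZ.connected fun p y hy => ?_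
    rw [← fibreAct_lieOfFibre hW hext,
      fibreAct_rel hW hext (lieOfFibre_mem_deg hy) (HLie.comp_mem q x), bracket_lieOfFibre hext,
      fibreAct_lieOfFibre hW hext, fibreAct_lieOfFibre hW hext]
    exact add_mem (Submodule.smul_mem _ _ (ih _ (mem_socle_succ.1 hz y))) (mem_socle_succ.1 hz _)

/-- The functionals on `W` extending a given functional on `V` and vanishing on a subspace. -/
theorem exists_lieToBase_eq {T : Submodule ℚ (⨁ i, V i × Z i)} {x : HLie V}
    (hx : ∀ v, DirectSum.lmap (inV V Z) v ∈ T → x v = 0) :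
    ∃ x' : HLie fun i => V i × Z i, lieToBase x' = x ∧ ∀ w ∈ T, x' w = 0 := by
  obtain ⟨l, hl, hl'⟩ := exists_extend (DirectSum.lmap (inV V Z)) T x hx
  exact ⟨l, LinearMap.ext hl, hl'⟩

/-- Local finiteness over `W` yields local finiteness over `V`, because `T ∩ V` is finite
dimensional. -/
theorem exists_idx_base (hV : IsMinimalSullivan dV) (T : Idx dW) :
    ∃ S : Idx dV, ∀ v, DirectSum.lmap (inV V Z) v ∈ T.1 → v ∈ S.1 := by
  have := T.finite
  have hinj : Function.Injective (DirectSum.lmap (inV V Z)) :=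
    Function.LeftInverse.injective (lmap_prV_inV (V := V) (Z := Z))
  have hfg : (T.1.comap (DirectSum.lmap (inV V Z))).FG := by
    refine Submodule.fg_of_fg_map_injective _ hinj ?_
    have := Submodule.finiteDimensional_of_le
      (Submodule.map_comap_le (DirectSum.lmap (inV V Z)) T.1)
    exact Module.Finite.iff_fg.1 this
  obtain ⟨S, hS⟩ := exists_idx_le hV _ hfg
  exact ⟨S, fun v hv => hS hv⟩

/-- The filtration of a finite dimensional stable subspace of `Z` used to integrate the coadjoint
action. -/
def fibreChain (T : Idx dW) (k : ℕ) : Submodule ℚ (⨁ i, Z i) :=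
  (T.1 ⊓ coadFiltration dW k).map (DirectSum.lmap (prZ V Z))

theorem fibreChain_zero (T : Idx dW) : fibreChain T 0 = ⊥ := by
  rw [fibreChain, show coadFiltration dW 0 = ⊥ from rfl, inf_bot_eq, Submodule.map_bot]

theorem fibreChain_mono (T : Idx dW) : Monotone (fibreChain T) :=
  fun _ _ h => Submodule.map_mono (inf_le_inf_left _ (coadFiltration_mono h))

theorem fibreAct_mem_fibreChain (hW : IsMinimalSullivan dW) (hext : IsLambdaExtension dV dW)
    (T : Idx dW) (x : HLie fun i => V i × Z i) (k : ℕ) {z : ⨁ i, Z i}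
    (hz : z ∈ fibreChain T (k + 1)) : fibreAct dW x z ∈ fibreChain T k := by
  obtain ⟨w, ⟨hw, hw'⟩, rfl⟩ := hz
  rw [fibreAct_prZ hext]
  exact ⟨_, ⟨coad_mem T.homog (T.stable _ (ι_mem_sub hw)) x,
    coad_mem_coadFiltration hW x hw'⟩, rfl⟩

theorem fibreAct_eq_zero (hext : IsLambdaExtension dV dW)
    (T : Idx dW) {x : HLie fun i => V i × Z i} (hx : ∀ w ∈ T.1, x w = 0) (k : ℕ) {z : ⨁ i, Z i}
    (hz : z ∈ fibreChain T k) : fibreAct dW x z = 0 := by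
  obtain ⟨w, ⟨hw, hw'⟩, rfl⟩ := hz
  rw [fibreAct_prZ hext, coad_eq_zero T.homog T.stable hw hx, map_zero]

theorem exists_mem_fibreChain (hW : IsMinimalSullivan dW) (z : ⨁ i, Z i) :
    ∃ (T : Idx dW) (n : ℕ), z ∈ fibreChain T n := by
  obtain ⟨T, hT⟩ := exists_idx_mem hW (DirectSum.lmap (inZ V Z) z)
  obtain ⟨n, hn⟩ := exists_le_sullivanFiltration hW T
  exact ⟨T, n + 1, _, ⟨hT, hn hT⟩, lmap_prZ_inZ z⟩

/-- The coadjoint representation of the Sullivan completion in `Z`. -/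
theorem exists_fibreRep (hW : IsMinimalSullivan dW) (hext : IsLambdaExtension dV dW) :
    ∃ R : UBar dW →ₐ[ℚ] Module.End ℚ (⨁ i, Z i), (∀ x, R (UBar.ι x) = fibreAct dW x) ∧
      ∀ z, IsCont (evalAt R z) := by
  refine exists_rep_of_chain hW.isDer (fibreAct dW)
    (fun p q x y hx hy z => fibreAct_rel hW hext hx hy z) fun z => ?_
  obtain ⟨T, n, hz⟩ := exists_mem_fibreChain hW z
  exact ⟨fibreChain T, T, n, fibreChain_zero T, fibreChain_mono T,
    fun x k z hz => fibreAct_mem_fibreChain hW hext T x k hz,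
    fun x hx z hz => fibreAct_eq_zero hext T hx n hz, hz⟩

end Fibre

end

section

open FreeCGA

/-! ### Cohomology classes and their linear parts -/

section CohomologyLemmas

variable {V : ℕ → Type*} [∀ i, AddCommGroup (V i)] [∀ i, Module ℚ (V i)]
  {d : FreeCGA V →ₗ[ℚ] FreeCGA V}

theorem Coh.mk_surjective : Function.Surjective (Coh.mk d) := Submodule.mkQ_surjective _

theorem Coh.mk_eq_zero {Φ : LinearMap.ker d} : Coh.mk d Φ = 0 ↔ Φ.1 ∈ LinearMap.range d :=
  Submodule.Quotient.mk_eq_zero _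

theorem Coh.mk_eq {Φ Ψ : LinearMap.ker d} :
    Coh.mk d Φ = Coh.mk d Ψ ↔ Φ.1 - Ψ.1 ∈ LinearMap.range d := by
  rw [← sub_eq_zero, ← map_sub, Coh.mk_eq_zero]; rfl

/-- The map induced in cohomology by an operator preserving cycles and boundaries. -/
def Coh.map (T : FreeCGA V →ₗ[ℚ] FreeCGA V) (h : ∀ Φ ∈ LinearMap.ker d, T Φ ∈ LinearMap.ker d)
    (h' : ∀ Φ ∈ LinearMap.range d, T Φ ∈ LinearMap.range d) : Module.End ℚ (Coh d) :=
  Submodule.mapQ _ _ (T.restrict h) fun Φ hΦ => h' Φ.1 hΦ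

theorem Coh.map_mk (T : FreeCGA V →ₗ[ℚ] FreeCGA V) (h h') (Φ : LinearMap.ker d) :
    Coh.map T h h' (Coh.mk d Φ) = Coh.mk d ⟨T Φ.1, h _ Φ.2⟩ := rfl

theorem comp_zero_eq (h0 : Subsingleton (V 0)) (a : FreeCGA V) :
    FreeCGA.comp V 0 a = algebraMap ℚ _ (aug V a) := by
  have := linearMap_ext (f := FreeCGA.comp V 0)
    (g := (Algebra.linearMap ℚ (FreeCGA V)) ∘ₗ (aug V).toLinearMap)
    (by simp [comp_apply]) (by
      intro i v a _
      simp only [LinearMap.comp_apply, AlgHom.toLinearMap_apply, map_mul, aug_gen, zero_mul,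
        map_zero, comp_apply, grd_gen]
      cases i with
      | zero => rw [Subsingleton.elim v 0]; simp
      | succ i => rw [Polynomial.mul_coeff_zero, Polynomial.coeff_monomial]; simp)
  exact LinearMap.congr_fun this a

/-- The classes of positive degree are those of the cycles in the augmentation ideal. -/
theorem Coh.mk_mem_pos (hd : IsMinimalSullivan d) {Φ : LinearMap.ker d} :
    Coh.mk d Φ ∈ Coh.pos d ↔ aug V Φ.1 = 0 := by
  constructor
  · let e : Coh d →ₗ[ℚ] ℚ := Submodule.liftQ _ ((aug V).toLinearMap ∘ₗ (LinearMap.ker d).subtype)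
      (by
        rintro ⟨_, _⟩ ⟨Ψ, rfl⟩
        exact hd.aug_d Ψ)
    have he : Coh.pos d ≤ LinearMap.ker e := by
      refine iSup₂_le fun m hm => ?_
      rintro _ ⟨Ψ, hΨ, rfl⟩
      have hΨ' : Ψ.1 ∈ FreeCGA.deg V m := hΨ
      rw [← FreeCGA.degZ_natCast] at hΨ'
      exact aug_eq_zero_of_degZ (by omega) hΨ'
    exact fun h => he h
  · intro h
    -- The components of a cycle are cycles. As `V^0 = 0`, the degree zero component is the
    -- augmentation, zero by assumption.
    have hc : ∀ n, FreeCGA.comp V n Φ.1 ∈ LinearMap.ker d := by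
      intro n
      rw [LinearMap.mem_ker, ← hd.comp_d, LinearMap.mem_ker.1 Φ.2, map_zero]
    have hΦ : Φ = ∑ n ∈ (grd V Φ.1).support, ⟨FreeCGA.comp V n Φ.1, hc n⟩ := by
      refine Subtype.ext ?_
      rw [AddSubmonoidClass.coe_finsetSum]
      exact (sum_comp Φ.1).symm
    rw [hΦ, map_sum]
    refine Submodule.sum_mem _ fun n _ => ?_
    cases n with
    | zero =>
      have : (⟨FreeCGA.comp V 0 Φ.1, hc 0⟩ : LinearMap.ker d) = 0 := by
        refine Subtype.ext ?_
        show FreeCGA.comp V 0 Φ.1 = 0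
        rw [comp_zero_eq hd.connected, h, map_zero]
      rw [this, map_zero]; exact zero_mem _
    | succ n =>
      exact Submodule.mem_iSup_of_mem (n + 1) (Submodule.mem_iSup_of_mem (by omega)
        ⟨_, comp_mem (n + 1) Φ.1, rfl⟩)

/-- The classes of degree `k`, with `k` an integer. -/
def Coh.degZ (d : FreeCGA V →ₗ[ℚ] FreeCGA V) (k : ℤ) : Submodule ℚ (Coh d) :=
  ((FreeCGA.degZ V k).submoduleOf (LinearMap.ker d)).map (Coh.mk d)

theorem Coh.degZ_natCast (n : ℕ) : Coh.degZ d n = Coh.deg d n := by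
  rw [Coh.degZ, FreeCGA.degZ_natCast, Coh.deg]

theorem Coh.eq_zero_of_degZ {k : ℤ} (hk : k < 0) {c : Coh d} (hc : c ∈ Coh.degZ d k) : c = 0 := by
  obtain ⟨Φ, hΦ, rfl⟩ := hc
  have h : Φ.1 ∈ FreeCGA.degZ V k := hΦ
  rw [FreeCGA.degZ_of_neg hk, Submodule.mem_bot] at h
  rw [Subtype.ext (a2 := (0 : LinearMap.ker d)) h, map_zero]

/-- The contraction of `d₁` depends on the linear component only. -/
theorem lin_ctr_d (hd : IsMinimalSullivan d) (x : HLie V) (a : FreeCGA V) :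
    lin V (ctr V x (d a)) = lin V (ctr V x (d (FreeCGA.ι V (lin V a)))) := by
  obtain ⟨N, hN⟩ := ctr_eq_sum hd.connected (d a)
  obtain ⟨M, hM⟩ := ctr_eq_sum hd.connected (d (FreeCGA.ι V (lin V a)))
  rw [hN (max N M) (le_max_left _ _), hM (max N M) (le_max_right _ _), map_sum, map_sum]
  refine Finset.sum_congr rfl fun p _ => ?_
  have hx := HLie.comp_mem p x
  have h := (isDer_lieDer hd hx).lin_eq (aug_lieDer_gen hd _) a
  simpa only [lieDer_apply, map_sub, hd.lin_d, sub_zero] using h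

/-- The coadjoint action on the linear part of `Φ` is the linear part of a contraction of `d Φ = 0`.
This is why the Hurewicz map vanishes on `L_Z^{(2)}`. -/
theorem lin_mem_socle (hd : IsMinimalSullivan d) {Φ : FreeCGA V} (hΦ : d Φ = 0) :
    lin V Φ ∈ socle d 1 := by
  rw [mem_socle_succ]
  intro x
  rw [coad_apply, ← lin_ctr_d hd, hΦ, map_zero, map_zero]
  exact zero_mem _

end CohomologyLemmas

/-! ### The holonomy action, and the action on the layers of the socle filtration -/

section Holonomy

variable {V Z : ℕ → Type*}
  [∀ i, AddCommGroup (V i)] [∀ i, Module ℚ (V i)]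
  [∀ i, AddCommGroup (Z i)] [∀ i, Module ℚ (Z i)]
  {dV : FreeCGA V →ₗ[ℚ] FreeCGA V}
  {dW : FreeCGA (fun i => V i × Z i) →ₗ[ℚ] FreeCGA (fun i => V i × Z i)}

theorem theta_apply (x : HLie V) (Φ : FreeCGA Z) :
    theta dW x Φ = - FreeCGA.map (prZ V Z)
      (ctr _ (lieOfBase x) (dW (FreeCGA.map (inZ V Z) Φ))) := by
  rw [theta, LinearMap.neg_apply, neg_inj]
  exact contract_split (prV V Z) (prZ V Z) x _

theorem ctr_map_inZ_eq_zero {x : HLie fun i => V i × Z i}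
    (hx : ∀ z : ⨁ i, Z i, x (DirectSum.lmap (inZ V Z) z) = 0) (Φ : FreeCGA Z) :
    ctr _ x (FreeCGA.map (inZ V Z) Φ) = 0 := by
  have : x ∘ₗ DirectSum.lmap (inZ V Z) = 0 := LinearMap.ext hx
  rw [ctr_map, this]
  simp [ctr, contract]

theorem lieOfBase_lmap_inZ (x : HLie V) (z : ⨁ i, Z i) :
    lieOfBase x (DirectSum.lmap (inZ V Z) z) = 0 := by
  rw [lieOfBase_apply]
  have : DirectSum.lmap (prV V Z) (DirectSum.lmap (inZ V Z) z) = 0 := by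
    induction z using DirectSum.induction_on with
    | zero => simp
    | of i v => rw [← DirectSum.lof_eq_of ℚ, DirectSum.lmap_lof, DirectSum.lmap_lof]; simp
    | add x y hx hy => rw [map_add, map_add, hx, hy, add_zero]
  rw [this, map_zero]

/-- The extension of `x` by zero annihilates `Z`, so the term `d I_x` of the commutator vanishes on
`⋀Z`. -/
theorem theta_eq_lieDer (x : HLie V) (Φ : FreeCGA Z) :
    theta dW x Φ = - FreeCGA.map (prZ V Z)
      (lieDer dW (lieOfBase x) (FreeCGA.map (inZ V Z) Φ)) := by
  rw [theta_apply, lieDer_apply, ctr_map_inZ_eq_zero (x := lieOfBase x ∘ₗ sgn _) (fun z => by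
    rw [LinearMap.comp_apply, sgn_lmap, lieOfBase_lmap_inZ]), map_zero, sub_zero]

theorem lieDer_map_inV (hext : IsLambdaExtension dV dW) (x : HLie fun i => V i × Z i)
    (a : FreeCGA V) : lieDer dW x (FreeCGA.map (inV V Z) a) ∈
      LinearMap.range (FreeCGA.map (inV V Z)).toLinearMap := by
  rw [lieDer_apply, hext.comm, ctr_map, ctr_map, hext.comm]
  exact sub_mem ⟨_, rfl⟩ ⟨_, rfl⟩

/-- `L_x` preserves `⋀V` and has no constant terms on generators, so it preserves the ideal
generated by `⋀⁺V` and descends to `⋀Z`. -/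
theorem map_prZ_lieDer_eq_zero (hW : IsMinimalSullivan dW) (hext : IsLambdaExtension dV dW)
    (x : HLie fun i => V i × Z i) {b : FreeCGA fun i => V i × Z i}
    (hb : FreeCGA.map (prZ V Z) b = 0) : FreeCGA.map (prZ V Z) (lieDer dW x b) = 0 := by
  obtain ⟨N, hN⟩ := lieDer_eq_sum (d := dW) hW.connected b
  rw [hN, map_sum]
  refine Finset.sum_eq_zero fun p _ => ?_
  rw [descend_apply (isDer_lieDer hW (HLie.comp_mem p x)) (aug_lieDer_gen hW _)
    (fun i v => lieDer_map_inV hext _ _), hb, map_zero, map_zero, map_zero]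

theorem map_prZ_lieDer_congr (hW : IsMinimalSullivan dW) (hext : IsLambdaExtension dV dW)
    (x : HLie fun i => V i × Z i) {b c : FreeCGA fun i => V i × Z i}
    (hb : FreeCGA.map (prZ V Z) b = FreeCGA.map (prZ V Z) c) :
    FreeCGA.map (prZ V Z) (lieDer dW x b) = FreeCGA.map (prZ V Z) (lieDer dW x c) := by
  rw [← sub_eq_zero, ← map_sub, ← map_sub]
  exact map_prZ_lieDer_eq_zero hW hext x (by rw [map_sub, hb, sub_self])

theorem comp_sgn_comp_sgn (x : HLie V) : (x ∘ₗ sgn V) ∘ₗ sgn V = x := by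
  refine LinearMap.ext fun v => ?_
  simp only [LinearMap.comp_apply, sgn_sgn]

theorem d_lieDer (hW : IsMinimalSullivan dW) (x : HLie fun i => V i × Z i)
    (b : FreeCGA fun i => V i × Z i) :
    dW (lieDer dW x b) = - lieDer dW (x ∘ₗ sgn _) (dW b) := by
  rw [lieDer_d hW, comp_sgn_comp_sgn, neg_neg]

theorem theta_mem_ker (hW : IsMinimalSullivan dW) (hext : IsLambdaExtension dV dW) (x : HLie V)
    {Φ : FreeCGA Z} (hΦ : Φ ∈ LinearMap.ker (quotDiff dW)) :
    theta dW x Φ ∈ LinearMap.ker (quotDiff dW) := by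
  rw [LinearMap.mem_ker, theta_eq_lieDer, map_neg, quotDiff_map_prZ hW hext, d_lieDer hW, map_neg,
    neg_neg]
  exact map_prZ_lieDer_eq_zero hW hext _ hΦ

theorem theta_mem_range (hW : IsMinimalSullivan dW) (hext : IsLambdaExtension dV dW) (x : HLie V)
    {Φ : FreeCGA Z} (hΦ : Φ ∈ LinearMap.range (quotDiff dW)) :
    theta dW x Φ ∈ LinearMap.range (quotDiff dW) := by
  obtain ⟨Ψ, rfl⟩ := hΦ
  have h1 := map_prZ_lieDer_congr hW hext (lieOfBase x)
    (b := FreeCGA.map (inZ V Z) (quotDiff dW Ψ)) (c := dW (FreeCGA.map (inZ V Z) Ψ))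
    (map_prZ_inZ _)
  rw [theta_eq_lieDer, h1, lieDer_d hW, map_neg, neg_neg, ← quotDiff_map_prZ hW hext]
  exact ⟨_, rfl⟩

/-- In cohomology, `L_x` depends on the restriction of `x` to `V` only. -/
theorem map_prZ_lieDer_mem_range (hW : IsMinimalSullivan dW) (hext : IsLambdaExtension dV dW)
    {x : HLie fun i => V i × Z i} (hx : lieToBase x = 0) {Φ : FreeCGA Z}
    (hΦ : quotDiff dW Φ = 0) :
    FreeCGA.map (prZ V Z) (lieDer dW x (FreeCGA.map (inZ V Z) Φ)) ∈
      LinearMap.range (quotDiff dW) := by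
  obtain ⟨y, rfl⟩ := exists_lieOfFibre hx
  have h1 : FreeCGA.map (prZ V Z) (ctr _ (lieOfFibre y) (dW (FreeCGA.map (inZ V Z) Φ))) = 0 := by
    have : lieOfFibre (V := V) y = y ∘ₗ DirectSum.lmap (prZ V Z) := rfl
    rw [this, ← ctr_map]
    have h2 : FreeCGA.map (prZ V Z) (dW (FreeCGA.map (inZ V Z) Φ)) = 0 := hΦ
    rw [h2, map_zero]
  rw [lieDer_apply, map_sub, h1, zero_sub, ← quotDiff_map_prZ hW hext]
  exact neg_mem ⟨_, rfl⟩

/-- On cycles any extension of `x₀` to `W` computes the holonomy up to a boundary; the sum is a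
difference, since `theta` is induced by `-L`. -/
theorem theta_sub_mem_range (hW : IsMinimalSullivan dW) (hext : IsLambdaExtension dV dW)
    {x : HLie fun i => V i × Z i} {x₀ : HLie V} (hx : lieToBase x = x₀) {Φ : FreeCGA Z}
    (hΦ : quotDiff dW Φ = 0) :
    theta dW x₀ Φ + FreeCGA.map (prZ V Z) (lieDer dW x (FreeCGA.map (inZ V Z) Φ)) ∈
      LinearMap.range (quotDiff dW) := by
  have h := map_prZ_lieDer_mem_range hW hext
    (x := x + (-1 : ℚ) • lieOfBase x₀) (by
      rw [map_add, map_smul, lieToBase_lieOfBase, hx]; simp) hΦ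
  rw [lieDer_add, lieDer_smul, map_add, map_smul] at h
  rw [theta_eq_lieDer]
  convert h using 1
  simp [add_comm]

theorem theta_add (x y : HLie V) (Φ : FreeCGA Z) :
    theta dW (x + y) Φ = theta dW x Φ + theta dW y Φ := by
  simp only [theta_apply, map_add, ctr_add]; abel

theorem theta_smul (c : ℚ) (x : HLie V) (Φ : FreeCGA Z) :
    theta dW (c • x) Φ = c • theta dW x Φ := by
  simp only [theta_apply, map_smul, ctr_smul, smul_neg]

/-- The holonomy operators in cohomology. -/
def holAct (hW : IsMinimalSullivan dW) (hext : IsLambdaExtension dV dW) :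
    HLie V →ₗ[ℚ] Module.End ℚ (Coh (quotDiff dW)) where
  toFun x := Coh.map (theta dW x) (fun _ h => theta_mem_ker hW hext x h)
    (fun _ h => theta_mem_range hW hext x h)
  map_add' x y := LinearMap.ext fun c => by
    obtain ⟨Φ, rfl⟩ := Coh.mk_surjective c
    rw [LinearMap.add_apply, Coh.map_mk, Coh.map_mk, Coh.map_mk, ← map_add]
    exact congrArg _ (Subtype.ext (theta_add x y Φ.1))
  map_smul' r x := LinearMap.ext fun c => by
    obtain ⟨Φ, rfl⟩ := Coh.mk_surjective c
    rw [LinearMap.smul_apply, Coh.map_mk, Coh.map_mk, ← map_smul]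
    exact congrArg _ (Subtype.ext (theta_smul r x Φ.1))

theorem holAct_mk (hW : IsMinimalSullivan dW) (hext : IsLambdaExtension dV dW) (x : HLie V)
    (Φ : LinearMap.ker (quotDiff dW)) :
    holAct hW hext x (Coh.mk _ Φ) = Coh.mk _ ⟨theta dW x Φ.1, theta_mem_ker hW hext x Φ.2⟩ := rfl

/-- `lieDer_lieDer` is projected to `⋀Z`. The minus signs of two holonomy operators cancel, and
`-L_{[x,y]}` is the holonomy of the bracket. -/
theorem holAct_rel (hW : IsMinimalSullivan dW) (hext : IsLambdaExtension dV dW) {p q : ℕ}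
    {x y : HLie V} (hx : x ∈ HLie.deg p) (hy : y ∈ HLie.deg q) (c : Coh (quotDiff dW)) :
    holAct hW hext x (holAct hW hext y c) =
      (-1 : ℚ) ^ (p * q) • holAct hW hext y (holAct hW hext x c) +
        holAct hW hext (HLie.bracket dV x y) c := by
  obtain ⟨Φ, rfl⟩ := Coh.mk_surjective c
  simp only [holAct_mk]
  rw [← map_smul, ← map_add, Coh.mk_eq]
  have hΦ : quotDiff dW Φ.1 = 0 := Φ.2
  obtain ⟨K, k, s, hK, hK0, hKP, h⟩ :=
    lieDer_lieDer hW (lieOfBase_mem_deg (Z := Z) hx) (lieOfBase_mem_deg (Z := Z) hy)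
  set X := lieOfBase (Z := Z) x
  set Y := lieOfBase (Z := Z) y
  set Ψ := FreeCGA.map (inZ V Z) Φ.1 with hΨ
  have hcomp : ∀ x' y' : HLie V, theta dW x' (theta dW y' Φ.1) =
      FreeCGA.map (prZ V Z) (lieDer dW (lieOfBase x') (lieDer dW (lieOfBase y') Ψ)) := by
    intro x' y'
    rw [theta_eq_lieDer x', theta_eq_lieDer y', map_neg, map_neg, map_neg, neg_neg]
    exact map_prZ_lieDer_congr hW hext _ (map_prZ_inZ _)
  -- `K` is built from `d` and contractions, so it preserves `⋀V` and descends to `⋀Z`, where `dW Ψ`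
  -- becomes zero.
  have hKd : FreeCGA.map (prZ V Z) (K (dW Ψ)) = 0 := by
    rw [descend_apply hK hK0 (fun i v => hKP _ ?_ ?_ _ ⟨_, rfl⟩)]
    · have : FreeCGA.map (prZ V Z) (dW Ψ) = 0 := hΦ
      rw [this, map_zero, map_zero, map_zero]
    · rintro _ ⟨a, rfl⟩
      exact ⟨_, (hext.comm a).symm⟩
    · rintro z _ ⟨a, rfl⟩
      exact ⟨_, (ctr_map _ _ _).symm⟩
  -- The bracket of the extensions by zero extends `[x, y]`, though not necessarily by zero; the
  -- discrepancy is a boundary.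
  have hb : lieToBase (HLie.bracket dW X Y) = HLie.bracket dV x y := by
    rw [lieToBase_bracket hext, lieToBase_lieOfBase, lieToBase_lieOfBase]
  have key : theta dW x (theta dW y Φ.1) - ((-1 : ℚ) ^ (p * q) • theta dW y (theta dW x Φ.1) +
      theta dW (HLie.bracket dV x y) Φ.1) =
      s • quotDiff dW (FreeCGA.map (prZ V Z) (K Ψ)) - (theta dW (HLie.bracket dV x y) Φ.1 +
        FreeCGA.map (prZ V Z) (lieDer dW (HLie.bracket dW X Y) Ψ)) := by
    rw [hcomp, hcomp, h, quotDiff_map_prZ hW hext]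
    simp only [map_add, map_sub, map_smul, hKd]
    abel
  show theta dW x (theta dW y Φ.1) - ((-1 : ℚ) ^ (p * q) • theta dW y (theta dW x Φ.1) +
      theta dW (HLie.bracket dV x y) Φ.1) ∈ _
  rw [key]
  exact sub_mem (Submodule.smul_mem _ _ ⟨_, rfl⟩) (theta_sub_mem_range hW hext hb hΦ)

/-- The classes of the cycles in the image of a subspace of `⋀W`. -/
def cohChain (dW : FreeCGA (fun i => V i × Z i) →ₗ[ℚ] FreeCGA (fun i => V i × Z i))
    (T : Idx dW) (k : ℕ) : Submodule ℚ (Coh (quotDiff dW)) :=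
  ((((Subalgebra.toSubmodule (FreeCGA.sub (T.1 : Set (⨁ i, V i × Z i)))) ⊓ lieNil dW k).map
    (FreeCGA.map (prZ V Z)).toLinearMap).submoduleOf (LinearMap.ker (quotDiff dW))).map (Coh.mk _)

theorem cohChain_zero (T : Idx dW) : cohChain dW T 0 = ⊥ := by
  rw [eq_bot_iff]
  rintro _ ⟨Φ, ⟨a, ⟨_, ha⟩, haΦ⟩, rfl⟩
  have h0 : a = 0 := ha
  rw [h0, map_zero] at haΦ
  have h1 : Φ = 0 := Subtype.ext haΦ.symm
  rw [h1, map_zero]; exact zero_mem _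

theorem cohChain_mono (T : Idx dW) : Monotone (cohChain dW T) :=
  fun _ _ h => Submodule.map_mono (Submodule.comap_mono
    (Submodule.map_mono (inf_le_inf_left _ (lieNil_mono h))))

theorem holAct_mem_cohChain (hW : IsMinimalSullivan dW) (hext : IsLambdaExtension dV dW)
    (T : Idx dW) (x : HLie V) (k : ℕ) {c : Coh (quotDiff dW)} (hc : c ∈ cohChain dW T (k + 1)) :
    holAct hW hext x c ∈ cohChain dW T k := by
  obtain ⟨Φ, ⟨a, ⟨ha, ha'⟩, haΦ⟩, rfl⟩ := hc
  rw [holAct_mk]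
  refine ⟨_, ⟨- lieDer dW (lieOfBase x) a, ⟨neg_mem (lieDer_mem_sub T.homog T.stable ha _),
    neg_mem (lieDer_mem_lieNil hW ha' _)⟩, ?_⟩, rfl⟩
  have haΦ' : FreeCGA.map (prZ V Z) a = Φ.1 := haΦ
  show FreeCGA.map (prZ V Z) (- lieDer dW (lieOfBase x) a) = theta dW x Φ.1
  rw [theta_eq_lieDer, map_neg, neg_inj]
  refine map_prZ_lieDer_congr hW hext _ ?_
  rw [haΦ', map_prZ_inZ]

/-- As `x` vanishes on `V ∩ T`, it has an extension vanishing on `T`, whose `L` kills `⋀T`; in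
cohomology the choice of extension is irrelevant. -/
theorem holAct_eq_zero (hW : IsMinimalSullivan dW) (hext : IsLambdaExtension dV dW)
    (T : Idx dW) {x : HLie V} (hx : ∀ v, DirectSum.lmap (inV V Z) v ∈ T.1 → x v = 0) (k : ℕ)
    {c : Coh (quotDiff dW)} (hc : c ∈ cohChain dW T k) : holAct hW hext x c = 0 := by
  obtain ⟨Φ, ⟨a, ⟨ha, ha'⟩, haΦ⟩, rfl⟩ := hc
  have haΦ' : FreeCGA.map (prZ V Z) a = Φ.1 := haΦ
  obtain ⟨x', hx', hxT⟩ := exists_lieToBase_eq hx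
  rw [holAct_mk, Coh.mk_eq_zero]
  have h := theta_sub_mem_range hW hext hx' Φ.2
  rwa [map_prZ_lieDer_congr hW hext x' (c := a) (by rw [haΦ', map_prZ_inZ]),
    lieDer_eq_zero T.homog T.stable ha hxT, map_zero, add_zero] at h

theorem exists_cohChain (hV : IsMinimalSullivan dV) (hW : IsMinimalSullivan dW)
    (hext : IsLambdaExtension dV dW) (c : Coh (quotDiff dW)) :
    ∃ (N : ℕ → Submodule ℚ (Coh (quotDiff dW))) (S : Idx dV) (n : ℕ), N 0 = ⊥ ∧ Monotone N ∧
      (∀ x k, ∀ m ∈ N (k + 1), holAct hW hext x m ∈ N k) ∧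
      (∀ x, (∀ v ∈ S.1, x v = 0) → ∀ m ∈ N n, holAct hW hext x m = 0) ∧ c ∈ N n := by
  obtain ⟨Φ, rfl⟩ := Coh.mk_surjective c
  obtain ⟨T, hT⟩ := exists_idx_mem_sub hW (FreeCGA.map (inZ V Z) Φ.1)
  obtain ⟨n, hn⟩ := exists_mem_lieNil hW (FreeCGA.map (inZ V Z) Φ.1)
  obtain ⟨S, hS⟩ := exists_idx_base hV T
  exact ⟨cohChain dW T, S, n, cohChain_zero T, cohChain_mono T,
    fun x k c hc => holAct_mem_cohChain hW hext T x k hc,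
    fun x hx c hc => holAct_eq_zero hW hext T (fun v hv => hx v (hS v hv)) n hc,
    Φ, ⟨_, ⟨hT, hn⟩, map_prZ_inZ _⟩, rfl⟩

/-- The action of `L_V` on the layers of the socle filtration of `Z`. -/
def layerAct (hW : IsMinimalSullivan dW) (hext : IsLambdaExtension dV dW) (k : ℕ) :
    HLie V →ₗ[ℚ] Module.End ℚ (socle (quotDiff dW) (k + 1) ⧸
      (socle (quotDiff dW) k).submoduleOf (socle (quotDiff dW) (k + 1))) where
  toFun x := Submodule.mapQ _ _
    ((fibreAct dW (lieOfBase x)).restrict fun _ h => fibreAct_mem_socle hW hext _ h)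
    fun _ h => fibreAct_mem_socle hW hext _ h
  map_add' x y := LinearMap.ext fun c => by
    obtain ⟨z, rfl⟩ := Submodule.mkQ_surjective _ c
    simp only [map_add, LinearMap.add_apply, Submodule.mkQ_apply, Submodule.mapQ_apply]
    rfl
  map_smul' r x := LinearMap.ext fun c => by
    obtain ⟨z, rfl⟩ := Submodule.mkQ_surjective _ c
    simp only [map_smul, LinearMap.smul_apply, Submodule.mkQ_apply, Submodule.mapQ_apply]
    rfl

/-- Two functionals with the same restriction to `V` differ by an element of `L_Z`, which lowers the
socle filtration. -/
theorem fibreAct_sub_mem_socle (hW : IsMinimalSullivan dW) (hext : IsLambdaExtension dV dW)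
    {k : ℕ} {x x' : HLie fun i => V i × Z i} (h : lieToBase x = lieToBase x') {z : ⨁ i, Z i}
    (hz : z ∈ socle (quotDiff dW) (k + 1)) :
    fibreAct dW x z - fibreAct dW x' z ∈ socle (quotDiff dW) k := by
  obtain ⟨y, hy⟩ := exists_lieOfFibre (x := x - x') (by rw [map_sub, h, sub_self])
  rw [← LinearMap.sub_apply, ← map_sub, hy, fibreAct_lieOfFibre hW hext]
  exact mem_socle_succ.1 hz y

/-- The quotient map onto a layer of the socle filtration. -/
abbrev layerMk (d : FreeCGA Z →ₗ[ℚ] FreeCGA Z) (k : ℕ) :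
    socle d (k + 1) →ₗ[ℚ] socle d (k + 1) ⧸ (socle d k).submoduleOf (socle d (k + 1)) :=
  ((socle d k).submoduleOf (socle d (k + 1))).mkQ

theorem layerMk_eq {d : FreeCGA Z →ₗ[ℚ] FreeCGA Z} {k : ℕ} {z z' : socle d (k + 1)} :
    layerMk d k z = layerMk d k z' ↔ z.1 - z'.1 ∈ socle d k := by
  rw [← sub_eq_zero, ← map_sub, Submodule.mkQ_apply, Submodule.Quotient.mk_eq_zero]; rfl

theorem layerAct_mk (hW : IsMinimalSullivan dW) (hext : IsLambdaExtension dV dW) (k : ℕ)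
    {x : HLie fun i => V i × Z i} {x₀ : HLie V} (hx : lieToBase x = x₀)
    (z : socle (quotDiff dW) (k + 1)) :
    layerAct hW hext k x₀ (layerMk (quotDiff dW) k z) =
      layerMk (quotDiff dW) k ⟨fibreAct dW x z, fibreAct_mem_socle hW hext x z.2⟩ := by
  have h : layerAct hW hext k x₀ (layerMk (quotDiff dW) k z) =
      layerMk (quotDiff dW) k ⟨fibreAct dW (lieOfBase x₀) z, fibreAct_mem_socle hW hext _ z.2⟩ := rfl
  rw [h, layerMk_eq]
  exact fibreAct_sub_mem_socle hW hext (by rw [lieToBase_lieOfBase, hx]) z.2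

/-- Elements of the kernel of `π` act on the socle filtration of `Z` like `L_Z` does. -/
theorem mem_socle_of_proj_eq_zero (hV : IsMinimalSullivan dV) (hW : IsMinimalSullivan dW)
    (hext : IsLambdaExtension dV dW) {R : UBar dW →ₐ[ℚ] Module.End ℚ (⨁ i, Z i)}
    (hR : ∀ x, R (UBar.ι x) = fibreAct dW x) (hRc : ∀ z, IsCont (evalAt R z))
    {π : UBar dW →ₐ[ℚ] UBar dV} (hπ : IsCompletedProjection dV dW π) {a : UBar dW}
    (ha : π a = 0) {k : ℕ} {z : ⨁ i, Z i} (hz : z ∈ socle (quotDiff dW) (k + 1)) :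
    R a z ∈ socle (quotDiff dW) k := by
  have hst : ∀ a, ∀ z ∈ socle (quotDiff dW) (k + 1), R a z ∈ socle (quotDiff dW) (k + 1) :=
    fun a z hz => mem_of_rep hRc _ (fun x z hz => by
      rw [hR]; exact fibreAct_mem_socle hW hext x hz) a hz
  obtain ⟨L, hL, hLc⟩ := exists_rep_of_chain hV.isDer (layerAct hW hext k) (by
      intro p q x y hx hy m
      obtain ⟨z, rfl⟩ := Submodule.mkQ_surjective _ m
      have hb : lieToBase (HLie.bracket dW (lieOfBase (Z := Z) x) (lieOfBase (Z := Z) y)) =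
          HLie.bracket dV x y := by
        rw [lieToBase_bracket hext, lieToBase_lieOfBase, lieToBase_lieOfBase]
      rw [layerAct_mk hW hext k (lieToBase_lieOfBase x), layerAct_mk hW hext k
        (lieToBase_lieOfBase y), layerAct_mk hW hext k (lieToBase_lieOfBase x),
        layerAct_mk hW hext k (lieToBase_lieOfBase y), layerAct_mk hW hext k hb,
        ← map_smul, ← map_add]
      exact congrArg _ (Subtype.ext (fibreAct_rel hW hext (lieOfBase_mem_deg hx)
        (lieOfBase_mem_deg hy) z.1))) (by
      intro m
      obtain ⟨z, rfl⟩ := Submodule.mkQ_surjective _ m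
      obtain ⟨T, n, hn⟩ := exists_mem_fibreChain hW z.1
      obtain ⟨S, hS⟩ := exists_idx_base hV T
      refine ⟨fun j => ((fibreChain T j).submoduleOf _).map (layerMk (quotDiff dW) k), S, n, ?_, ?_, ?_, ?_,
        ⟨z, hn, rfl⟩⟩
      · rw [eq_bot_iff]
        rintro _ ⟨w, hw, rfl⟩
        have h0 : w.1 ∈ fibreChain T 0 := hw
        rw [fibreChain_zero, Submodule.mem_bot] at h0
        rw [Subtype.ext (a2 := (0 : socle (quotDiff dW) (k + 1))) h0, map_zero]
        exact zero_mem _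
      · exact fun i j h => Submodule.map_mono (Submodule.comap_mono (fibreChain_mono T h))
      · rintro x j _ ⟨w, hw, rfl⟩
        rw [layerAct_mk hW hext k (lieToBase_lieOfBase x)]
        exact ⟨_, fibreAct_mem_fibreChain hW hext T _ j hw, rfl⟩
      · rintro x hx _ ⟨w, hw, rfl⟩
        obtain ⟨x', hx', hxT⟩ := exists_lieToBase_eq (T := T.1) fun v hv => hx v (hS v hv)
        rw [layerAct_mk hW hext k hx', ← map_zero (layerMk (quotDiff dW) k)]
        refine congrArg _ (Subtype.ext ?_)
        exact fibreAct_eq_zero hext T hxT n hw)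
  have hLπ : ∀ m, IsCont (evalAt (L.comp π) m) := by
    intro m
    obtain ⟨S, n, h⟩ := hLc m
    obtain ⟨S', n', h'⟩ := hπ.continuous S n
    exact ⟨S', n', fun a ha => h _ (h' a ha)⟩
  -- On the layer, `R` and `L ∘ π` are continuous and agree on `L_W`, hence everywhere; an element
  -- killed by `π` therefore acts there by zero.
  have key := intertwine hW.isDer (isCont_restrictRep hRc _ hst) hLπ (layerMk (quotDiff dW) k) (by
    intro x z
    rw [AlgHom.comp_apply, hπ.extends_lie, hL, layerAct_mk hW hext k rfl]
    refine congrArg _ (Subtype.ext ?_)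
    rw [restrictRep_apply, hR]) a ⟨z, hz⟩
  rw [AlgHom.comp_apply, ha, map_zero, LinearMap.zero_apply, ← map_zero (layerMk (quotDiff dW) k),
    layerMk_eq] at key
  rw [restrictRep_apply, ZeroMemClass.coe_zero, sub_zero] at key
  exact key

end Holonomy

end

section

open FreeCGA

/-! ### Transposed, quotient and factored representations -/

section Generic

variable {A B M : Type*} [Ring A] [Algebra ℚ A] [Ring B] [Algebra ℚ B] [AddCommGroup M]
  [Module ℚ M]

/-- The transposed right representation in the dual. -/
def dualRep (R : A →ₐ[ℚ] Module.End ℚ M) : Aᵐᵒᵖ →ₐ[ℚ] Module.End ℚ (Module.Dual ℚ M) :=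
  AlgHom.ofLinearMap
    { toFun := fun a => (R a.unop).dualMap
      map_add' := fun a b => by ext; simp
      map_smul' := fun c a => by ext; simp }
    (by ext; simp) (fun a b => by ext; simp)

theorem dualRep_apply (R : A →ₐ[ℚ] Module.End ℚ M) (a : A) (f : Module.Dual ℚ M) :
    dualRep R (MulOpposite.op a) f = f ∘ₗ R a := rfl

/-- The quotient of a representation by a stable subspace. -/
def quotRep (R : A →ₐ[ℚ] Module.End ℚ M) (P : Submodule ℚ M) (hP : ∀ a, ∀ m ∈ P, R a m ∈ P) :
    A →ₐ[ℚ] Module.End ℚ (M ⧸ P) :=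
  AlgHom.ofLinearMap
    { toFun := fun a => P.mapQ P (R a) (hP a)
      map_add' := fun a b => by ext; simp
      map_smul' := fun c a => by ext; simp }
    (by ext; simp) (fun a b => by ext; simp)

theorem exists_algHom_factor {C : Type*} [Ring C] [Algebra ℚ C] {π : A →ₐ[ℚ] B}
    (hπ : Function.Surjective π) (R : A →ₐ[ℚ] C) (h : ∀ a, π a = 0 → R a = 0) :
    ∃ ρ : B →ₐ[ℚ] C, ∀ a, ρ (π a) = R a := by
  have hRπ : ∀ a b, π a = π b → R a = R b := fun a b hab => by
    rw [← sub_eq_zero, ← map_sub]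
    exact h _ (by rw [map_sub, hab, sub_self])
  have hs := Function.surjInv_eq hπ
  refine ⟨AlgHom.ofLinearMap
    { toFun := fun b => R (Function.surjInv hπ b)
      map_add' := fun a b => by rw [← map_add]; exact hRπ _ _ (by simp [hs])
      map_smul' := fun c a => by
        rw [RingHom.id_apply, ← map_smul]; exact hRπ _ _ (by simp [hs]) }
    ?_ fun a b => ?_, fun a => hRπ _ _ (hs _)⟩
  · show R _ = 1
    rw [← map_one R]
    exact hRπ _ _ (by simp [hs])
  · show R _ = R _ * R _
    rw [← map_mul]
    exact hRπ _ _ (by simp [hs])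

end Generic

/-! ### Degrees and signs in continuous representations -/

section Graded

variable {V : ℕ → Type*} [∀ i, AddCommGroup (V i)] [∀ i, Module ℚ (V i)]
  {d : FreeCGA V →ₗ[ℚ] FreeCGA V} {M : Type*} [AddCommGroup M] [Module ℚ M]

/-- A continuous representation is compatible with gradings if the action of `L_V` is. -/
theorem rep_mem_of_deg {R : UBar d →ₐ[ℚ] Module.End ℚ M} (hR : ∀ m, IsCont (evalAt R m))
    (G : ℤ → Submodule ℚ M)
    (hG : ∀ p, ∀ x ∈ HLie.deg p, ∀ k, ∀ m ∈ G k, R (UBar.ι x) m ∈ G (k - p))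
    {p : ℕ} {a : UBar d} (ha : a ∈ UBar.deg p) {k : ℤ} {m : M} (hm : m ∈ G k) :
    R a m ∈ G (k - p) := by
  refine (hR m).mem_of_deg (G (k - p)) (fun f hf => ?_) ha
  let Q (p : ℕ) : Submodule ℚ (TensorAlgebra ℚ (HLie V)) := ⨅ (k : ℤ) (m : G k),
    (G (k - p)).comap (LinearMap.applyₗ m.1 ∘ₗ R.toLinearMap ∘ₗ (UBar.ofFree d).toLinearMap)
  have hQ : ∀ p f, f ∈ Q p ↔ ∀ k, ∀ m ∈ G k, R (UBar.ofFree d f) m ∈ G (k - p) := by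
    intro p f
    simp only [Q, Submodule.mem_iInf, Submodule.mem_comap, Subtype.forall]
    rfl
  refine (hQ p f).1 (freeDeg_le Q ?_ ?_ p hf) k m hm
  · rw [hQ]
    intro k m hm
    simpa using hm
  · intro p q x hx f hf
    rw [hQ] at hf ⊢
    intro k m hm
    rw [map_mul, map_mul, UBar.ofFree_ι, Module.End.mul_apply]
    have := hG p x hx _ _ (hf k m hm)
    rwa [sub_sub, ← Nat.cast_add, add_comm q p] at this

/-- Two continuous representations which on `L_V` differ by the sign of the degree. -/
theorem rep_eq_of_deg {R R' : UBar d →ₐ[ℚ] Module.End ℚ M} (hd : IsDer 1 d)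
    (hR : ∀ m, IsCont (evalAt R m)) (hR' : ∀ m, IsCont (evalAt R' m))
    (h : ∀ p, ∀ x ∈ HLie.deg p, R' (UBar.ι x) = (-1 : ℚ) ^ p • R (UBar.ι x)) {p : ℕ} {a : UBar d}
    (ha : a ∈ UBar.deg p) (m : M) : R' a m = (-1 : ℚ) ^ p • R a m := by
  rw [← sub_eq_zero]
  refine (Submodule.mem_bot ℚ).1 (((hR' m).sub hd ((hR m).smul ((-1) ^ p))).mem_of_deg ⊥
    (fun f hf => ?_) ha)
  let Q (p : ℕ) : Submodule ℚ (TensorAlgebra ℚ (HLie V)) := LinearMap.ker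
    (R'.toLinearMap ∘ₗ (UBar.ofFree d).toLinearMap -
      (-1 : ℚ) ^ p • (R.toLinearMap ∘ₗ (UBar.ofFree d).toLinearMap))
  have hQ : ∀ p f, f ∈ Q p ↔ R' (UBar.ofFree d f) = (-1 : ℚ) ^ p • R (UBar.ofFree d f) := by
    intro p f
    rw [LinearMap.mem_ker, LinearMap.sub_apply, sub_eq_zero]; rfl
  have key := (hQ p f).1 (freeDeg_le Q (by rw [hQ]; simp) (fun p q x hx f hf => by
    rw [hQ] at hf ⊢
    rw [map_mul, map_mul, map_mul, UBar.ofFree_ι, hf, h p x hx, pow_add, smul_mul_smul_comm]) p hf)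
  rw [Submodule.mem_bot, LinearMap.sub_apply, LinearMap.smul_apply, evalAt_apply, evalAt_apply, key,
    LinearMap.smul_apply, sub_self]

end Graded

variable {V Z : ℕ → Type*}
  [∀ i, AddCommGroup (V i)] [∀ i, Module ℚ (V i)]
  [∀ i, AddCommGroup (Z i)] [∀ i, Module ℚ (Z i)]
  {dV : FreeCGA V →ₗ[ℚ] FreeCGA V}
  {dW : FreeCGA (fun i => V i × Z i) →ₗ[ℚ] FreeCGA (fun i => V i × Z i)}

/-! ### The right adjoint representation and the lower central series of `L_Z` -/

section Adjoint

variable {R : UBar dW →ₐ[ℚ] Module.End ℚ (⨁ i, Z i)}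

theorem comp_fibreAct_mem_deg (hW : IsMinimalSullivan dW) (hext : IsLambdaExtension dV dW)
    {p q : ℕ} {x : HLie fun i => V i × Z i} (hx : x ∈ HLie.deg p) {y : HLie Z}
    (hy : y ∈ HLie.deg q) : y ∘ₗ fibreAct dW x ∈ HLie.deg (q + p) := by
  intro i hi z
  have h := bracket_mem_deg hW (lieOfFibre_mem_deg (V := V) hy) hx i hi (inZ V Z i z)
  rwa [bracket_lieOfFibre hext, ← DirectSum.lmap_lof, lieOfFibre_apply, lmap_prZ_inZ] at h

theorem isRightAdjoint_dualRep (hW : IsMinimalSullivan dW) (hext : IsLambdaExtension dV dW)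
    (hR : ∀ x, R (UBar.ι x) = fibreAct dW x) (hRc : ∀ z, IsCont (evalAt R z)) :
    IsRightAdjoint dW (dualRep R) where
  adjoint x y := by rw [dualRep_apply, hR, bracket_lieOfFibre hext]
  continuous z := by
    obtain ⟨S, n, h⟩ := hRc z
    refine ⟨S, n, fun a ha y => ?_⟩
    have h0 : R a z = 0 := h a ha
    rw [dualRep_apply, LinearMap.comp_apply, h0, map_zero]
  graded p q a ha y hy := by
    intro i hi v
    refine (Submodule.mem_bot ℚ).1 (((hRc (DirectSum.lof ℚ ℕ Z i v)).comp y).mem_of_deg ⊥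
      (fun f hf => ?_) ha)
    let Q (p : ℕ) : Submodule ℚ (TensorAlgebra ℚ (HLie fun i => V i × Z i)) :=
      ⨅ (q : ℕ) (y : HLie.deg (V := Z) q), (HLie.deg (q + p)).comap
        (LinearMap.llcomp ℚ (⨁ i, Z i) (⨁ i, Z i) ℚ y.1 ∘ₗ R.toLinearMap ∘ₗ
          (UBar.ofFree dW).toLinearMap)
    have hQ : ∀ p f, f ∈ Q p ↔
        ∀ q, ∀ y ∈ HLie.deg (V := Z) q, y ∘ₗ R (UBar.ofFree dW f) ∈ HLie.deg (q + p) := by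
      intro p f
      simp only [Q, Submodule.mem_iInf, Submodule.mem_comap, Subtype.forall]
      rfl
    refine (hQ p f).1 (freeDeg_le Q ?_ ?_ p hf) q y hy i hi v
    · rw [hQ]
      intro q y hy
      rw [map_one, map_one]
      exact hy
    · intro p p' x hx f hf
      rw [hQ] at hf ⊢
      intro q y hy
      rw [map_mul, map_mul, UBar.ofFree_ι, hR, ← add_assoc]
      exact hf _ _ (comp_fibreAct_mem_deg hW hext hx hy)

/-- Both sides are right actions agreeing on `L_W`, hence on the free algebra; evaluated at a fixed
`z` they are continuous in `a`. -/
theorem IsRightAdjoint.apply_eq (hW : IsMinimalSullivan dW) (hext : IsLambdaExtension dV dW)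
    (hR : ∀ x, R (UBar.ι x) = fibreAct dW x) (hRc : ∀ z, IsCont (evalAt R z))
    {adR : (UBar dW)ᵐᵒᵖ →ₐ[ℚ] Module.End ℚ (HLie Z)} (h : IsRightAdjoint dW adR) (a : UBar dW)
    (y : HLie Z) : adR (MulOpposite.op a) y = y ∘ₗ R a := by
  refine LinearMap.ext fun z => ?_
  let E : UBar dW →ₗ[ℚ] ℚ := LinearMap.applyₗ z ∘ₗ LinearMap.applyₗ y ∘ₗ adR.toLinearMap ∘ₗ
    (MulOpposite.opLinearEquiv ℚ).toLinearMap
  have hE : IsCont E := by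
    obtain ⟨S, n, hS⟩ := h.continuous z
    exact ⟨S, n, fun a ha => hS a ha y⟩
  have hf : ∀ f y, adR (MulOpposite.op (UBar.ofFree dW f)) y = y ∘ₗ R (UBar.ofFree dW f) := by
    intro f
    induction f using TensorAlgebra.induction with
    | algebraMap r =>
      intro y
      rw [AlgHom.commutes, AlgHom.commutes, ← MulOpposite.algebraMap_apply, AlgHom.commutes]
      ext; simp [Module.algebraMap_end_apply]
    | ι x =>
      intro y
      rw [UBar.ofFree_ι, hR]
      exact lieOfFibre_injective (V := V) (by rw [h.adjoint, bracket_lieOfFibre hext])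
    | mul f g hf hg =>
      intro y
      rw [map_mul, MulOpposite.op_mul, map_mul, Module.End.mul_apply, hf, hg, map_mul]; rfl
    | add f g hf hg =>
      intro y
      rw [map_add, MulOpposite.op_add, map_add, LinearMap.add_apply, hf, hg, map_add,
        LinearMap.comp_add]
  exact LinearMap.congr_fun (hE.ext hW.isDer ((hRc z).comp y)
    fun f => LinearMap.congr_fun (hf f y) z) a

theorem existsUnique_rightAdjoint (hW : IsMinimalSullivan dW) (hext : IsLambdaExtension dV dW) :
    ∃! adR : (UBar dW)ᵐᵒᵖ →ₐ[ℚ] Module.End ℚ (HLie Z), IsRightAdjoint dW adR := by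
  obtain ⟨R, hR, hRc⟩ := exists_fibreRep hW hext
  refine ⟨dualRep R, isRightAdjoint_dualRep hW hext hR hRc, fun adR h => ?_⟩
  refine AlgHom.ext fun a => LinearMap.ext fun y => ?_
  exact h.apply_eq hW hext hR hRc a.unop y

theorem adjoint_mem_sullivanLCS (hW : IsMinimalSullivan dW) (hext : IsLambdaExtension dV dW)
    (hR : ∀ x, R (UBar.ι x) = fibreAct dW x) (hRc : ∀ z, IsCont (evalAt R z)) (r : ℕ)
    (a : UBar dW) {y : HLie Z} (hy : y ∈ sullivanLCS (quotDiff dW) r) :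
    y ∘ₗ R a ∈ sullivanLCS (quotDiff dW) r := by
  have hZ := quotDiff_isMinimalSullivan hW hext
  cases r with
  | zero => rw [sullivanLCS_zero]; exact Submodule.mem_top
  | succ k =>
    rw [mem_sullivanLCS_succ hZ] at hy ⊢
    intro z hz
    exact hy _ (mem_of_rep hRc _
      (fun x z hz => by rw [hR]; exact fibreAct_mem_socle hW hext x hz) a hz)

/-- The kernel of `π` maps `L_Z^{(r)}` to `L_Z^{(r+1)}`. -/
theorem adjoint_mem_sullivanLCS_succ (hV : IsMinimalSullivan dV) (hW : IsMinimalSullivan dW)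
    (hext : IsLambdaExtension dV dW) (hR : ∀ x, R (UBar.ι x) = fibreAct dW x)
    (hRc : ∀ z, IsCont (evalAt R z)) {π : UBar dW →ₐ[ℚ] UBar dV}
    (hπ : IsCompletedProjection dV dW π) (r : ℕ) {a : UBar dW} (ha : π a = 0) {y : HLie Z}
    (hy : y ∈ sullivanLCS (quotDiff dW) r) : y ∘ₗ R a ∈ sullivanLCS (quotDiff dW) (r + 1) := by
  have hZ := quotDiff_isMinimalSullivan hW hext
  rw [mem_sullivanLCS_succ hZ]
  cases r with
  | zero =>
    intro z hz
    have hz0 : z = 0 := hz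
    rw [hz0, map_zero]
  | succ k =>
    rw [mem_sullivanLCS_succ hZ] at hy
    exact fun z hz => hy _ (mem_socle_of_proj_eq_zero hV hW hext hR hRc hπ ha hz)

/-- `π` is onto and its kernel maps each `L_Z^{(r)}` into the next term. At `r = 0` both terms are
all of `L_Z` and the layer is zero. -/
theorem exists_layerRep (hV : IsMinimalSullivan dV) (hW : IsMinimalSullivan dW)
    (hext : IsLambdaExtension dV dW) (hR : ∀ x, R (UBar.ι x) = fibreAct dW x)
    (hRc : ∀ z, IsCont (evalAt R z)) {π : UBar dW →ₐ[ℚ] UBar dV}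
    (hπ : IsCompletedProjection dV dW π) (hπs : Function.Surjective π) (r : ℕ) :
    ∃ ρ : (UBar dV)ᵐᵒᵖ →ₐ[ℚ] Module.End ℚ (LCSQuot (quotDiff dW) r),
      ∀ (a : UBar dW) (y : sullivanLCS (quotDiff dW) r),
        ρ (MulOpposite.op (π a)) (LCSQuot.mk _ r y) =
          LCSQuot.mk _ r ⟨y.1 ∘ₗ R a, adjoint_mem_sullivanLCS hW hext hR hRc r a y.2⟩ := by
  let L := restrictRep (dualRep R) (sullivanLCS (quotDiff dW) r)
    fun a y hy => adjoint_mem_sullivanLCS hW hext hR hRc r a.unop hy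
  let Lq := quotRep L ((sullivanLCS (quotDiff dW) (r + 1)).submoduleOf _)
    fun a y hy => adjoint_mem_sullivanLCS hW hext hR hRc (r + 1) a.unop hy
  obtain ⟨ρ, hρ⟩ := exists_algHom_factor (π := AlgHom.op π)
    (fun b => by
      obtain ⟨a, ha⟩ := hπs b.unop
      exact ⟨MulOpposite.op a, MulOpposite.unop_injective ha⟩) Lq (by
    intro a ha
    refine LinearMap.ext fun u => ?_
    obtain ⟨y, rfl⟩ := Submodule.mkQ_surjective _ u
    refine (Submodule.Quotient.mk_eq_zero _).2 ?_
    exact adjoint_mem_sullivanLCS_succ hV hW hext hR hRc hπ r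
      (MulOpposite.op_injective ha) y.2)
  exact ⟨ρ, fun a y => LinearMap.congr_fun (hρ (MulOpposite.op a)) (LCSQuot.mk _ r y)⟩

end Adjoint

/-! ### The holonomy representation and its twist by the sign of the degree -/

section HolonomyRep

theorem theta_mem_degZ (hW : IsMinimalSullivan dW) {p : ℕ} {x : HLie V} (hx : x ∈ HLie.deg p)
    {k : ℤ} {Φ : FreeCGA Z} (hΦ : Φ ∈ FreeCGA.degZ Z k) :
    theta dW x Φ ∈ FreeCGA.degZ Z (k - p) := by
  rw [theta_apply]
  have := map_mem_degZ (prZ V Z) (ctr_mem_degZ (lieOfBase_mem_deg (Z := Z) hx)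
    (hW.degZ (map_mem_degZ (inZ V Z) hΦ)))
  rw [add_sub_add_right_eq_sub] at this
  exact neg_mem this

theorem holAct_mem_degZ (hW : IsMinimalSullivan dW) (hext : IsLambdaExtension dV dW) {p : ℕ}
    {x : HLie V} (hx : x ∈ HLie.deg p) {k : ℤ} {c : Coh (quotDiff dW)}
    (hc : c ∈ Coh.degZ (quotDiff dW) k) :
    holAct hW hext x c ∈ Coh.degZ (quotDiff dW) (k - p) := by
  obtain ⟨Φ, hΦ, rfl⟩ := hc
  exact ⟨_, theta_mem_degZ hW hx hΦ, (holAct_mk hW hext x Φ).symm⟩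

theorem isHolonomy_of_rep (hW : IsMinimalSullivan dW) (hext : IsLambdaExtension dV dW)
    {H : UBar dV →ₐ[ℚ] Module.End ℚ (Coh (quotDiff dW))}
    (hH : ∀ x, H (UBar.ι x) = holAct hW hext x) (hHc : ∀ c, IsCont (evalAt H c)) :
    IsHolonomy dV dW H where
  holonomy x Φ := ⟨theta_mem_ker hW hext x Φ.2, by rw [hH, holAct_mk]⟩
  continuous := hHc
  graded p a ha := by
    -- In integer degrees both clauses are one statement: for `m < p` the target has negative degree
    -- and is zero.
    have key : ∀ k, ∀ c ∈ Coh.degZ (quotDiff dW) k, H a c ∈ Coh.degZ (quotDiff dW) (k - p) :=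
      fun k c hc => rep_mem_of_deg hHc (Coh.degZ (quotDiff dW))
        (fun p x hx k c hc => by rw [hH]; exact holAct_mem_degZ hW hext hx hc) ha hc
    constructor
    · intro m c hc
      rw [← Coh.degZ_natCast] at hc ⊢
      have := key _ c hc
      rwa [Nat.cast_add, add_sub_cancel_right] at this
    · intro m hm c hc
      rw [← Coh.degZ_natCast] at hc
      exact Coh.eq_zero_of_degZ (by omega) (key _ c hc)

theorem IsHolonomy.apply_ι (hW : IsMinimalSullivan dW) (hext : IsLambdaExtension dV dW)
    {H : UBar dV →ₐ[ℚ] Module.End ℚ (Coh (quotDiff dW))} (h : IsHolonomy dV dW H) (x : HLie V) :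
    H (UBar.ι x) = holAct hW hext x := by
  refine LinearMap.ext fun c => ?_
  obtain ⟨Φ, rfl⟩ := Coh.mk_surjective c
  obtain ⟨_, h1⟩ := h.holonomy x Φ
  rw [h1, holAct_mk]

theorem existsUnique_holonomy (hV : IsMinimalSullivan dV) (hW : IsMinimalSullivan dW)
    (hext : IsLambdaExtension dV dW) :
    ∃! hol : UBar dV →ₐ[ℚ] Module.End ℚ (Coh (quotDiff dW)), IsHolonomy dV dW hol := by
  obtain ⟨H, hH, hHc⟩ := exists_rep_of_chain hV.isDer (holAct hW hext)
    (fun p q x y hx hy c => holAct_rel hW hext hx hy c) (exists_cohChain hV hW hext)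
  refine ⟨H, isHolonomy_of_rep hW hext hH hHc, fun H' h' => ?_⟩
  exact rep_ext hV.isDer h'.continuous hHc fun x => by rw [h'.apply_ι hW hext, hH]

/-- The constant term of `I_x dΦ` is `x` evaluated on the linear part of `dΦ`, which is zero. -/
theorem holAct_mem_pos (hW : IsMinimalSullivan dW) (hext : IsLambdaExtension dV dW) (x : HLie V)
    (c : Coh (quotDiff dW)) : holAct hW hext x c ∈ Coh.pos (quotDiff dW) := by
  obtain ⟨Φ, rfl⟩ := Coh.mk_surjective c
  rw [holAct_mk, Coh.mk_mem_pos (quotDiff_isMinimalSullivan hW hext)]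
  show aug Z (theta dW x Φ.1) = 0
  rw [theta_apply, map_neg, aug_map, ← lin_eq, hW.lin_d, map_zero, neg_zero]

/-- The holonomy operators twisted by the sign of the degree. -/
def twistedHolAct (hW : IsMinimalSullivan dW) (hext : IsLambdaExtension dV dW) :
    HLie V →ₗ[ℚ] Module.End ℚ (Coh (quotDiff dW)) :=
  - (holAct hW hext ∘ₗ (sgn V).dualMap)

theorem twistedHolAct_apply (hW : IsMinimalSullivan dW) (hext : IsLambdaExtension dV dW)
    (x : HLie V) (c : Coh (quotDiff dW)) :
    twistedHolAct hW hext x c = - holAct hW hext (x ∘ₗ sgn V) c := rfl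

theorem twistedHolAct_of_deg (hW : IsMinimalSullivan dW) (hext : IsLambdaExtension dV dW)
    {p : ℕ} {x : HLie V} (hx : x ∈ HLie.deg p) :
    twistedHolAct hW hext x = (-1 : ℚ) ^ p • holAct hW hext x := by
  refine LinearMap.ext fun c => ?_
  rw [twistedHolAct_apply, HLie.comp_sgn hx, map_smul, pow_succ]
  simp

/-- The sign `(-1)^p` is multiplicative in the degree, so the Lie relation survives the twist. The
dual right representation, sign included, is the plain transpose of this one. -/
theorem exists_twistedHolonomy (hV : IsMinimalSullivan dV) (hW : IsMinimalSullivan dW)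
    (hext : IsLambdaExtension dV dW) :
    ∃ H : UBar dV →ₐ[ℚ] Module.End ℚ (Coh (quotDiff dW)),
      (∀ x, H (UBar.ι x) = twistedHolAct hW hext x) ∧ ∀ c, IsCont (evalAt H c) := by
  refine exists_rep_of_chain hV.isDer (twistedHolAct hW hext) (fun p q x y hx hy c => ?_)
    fun c => ?_
  · rw [twistedHolAct_of_deg hW hext hx, twistedHolAct_of_deg hW hext hy,
      twistedHolAct_of_deg hW hext (bracket_mem_deg hV hx hy)]
    simp only [LinearMap.smul_apply, map_smul]
    rw [holAct_rel hW hext hx hy, pow_add]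
    module
  · obtain ⟨N, S, n, h0, hmono, hN, hS, hc⟩ := exists_cohChain hV hW hext c
    exact ⟨N, S, n, h0, hmono, fun x k m hm => neg_mem (hN _ k m hm), fun x hx m hm => by
      rw [twistedHolAct_apply, hS _ (comp_sgn_apply_eq_zero S.homog hx) m hm, neg_zero], hc⟩

end HolonomyRep

/-! ### Linear parts of cohomology classes and the Hurewicz map -/

section Hurewicz

/-- The map induced in cohomology by division by `⋀^{≥2}V`. -/
def cohLin (hd : IsMinimalSullivan dV) : Coh dV →ₗ[ℚ] ⨁ i, V i :=
  Submodule.liftQ _ (lin V ∘ₗ (LinearMap.ker dV).subtype) (by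
    rintro ⟨_, _⟩ ⟨Ψ, rfl⟩
    exact hd.lin_d Ψ)

theorem cohLin_mk (hd : IsMinimalSullivan dV) (Φ : LinearMap.ker dV) :
    cohLin hd (Coh.mk dV Φ) = lin V Φ := rfl

theorem cohLin_mem_socle (hd : IsMinimalSullivan dV) (c : Coh dV) : cohLin hd c ∈ socle dV 1 := by
  obtain ⟨Φ, rfl⟩ := Coh.mk_surjective c
  exact lin_mem_socle hd Φ.2

/-- On the first socle of `Z` the coadjoint action of `L_W` factors through `L_V`, and division by
`⋀^{≥2}Z` intertwines it with the twisted holonomy action. -/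
theorem cohLin_twistedHolAct (hW : IsMinimalSullivan dW) (hext : IsLambdaExtension dV dW)
    (x : HLie fun i => V i × Z i) (c : Coh (quotDiff dW)) :
    cohLin (quotDiff_isMinimalSullivan hW hext) (twistedHolAct hW hext (lieToBase x) c) =
      fibreAct dW x (cohLin (quotDiff_isMinimalSullivan hW hext) c) := by
  have hs := cohLin_mem_socle (quotDiff_isMinimalSullivan hW hext) c
  -- The case `k = 0`: socle `0` vanishes, so on the first socle `x` acts through its restriction to
  -- `V`.
  have h1 : fibreAct dW x (cohLin (quotDiff_isMinimalSullivan hW hext) c) =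
      fibreAct dW (lieOfBase (lieToBase x)) (cohLin (quotDiff_isMinimalSullivan hW hext) c) :=
    sub_eq_zero.1 (fibreAct_sub_mem_socle (k := 0) hW hext (lieToBase_lieOfBase _).symm hs)
  obtain ⟨Φ, rfl⟩ := Coh.mk_surjective c
  rw [h1, twistedHolAct_apply, holAct_mk, map_neg, cohLin_mk, cohLin_mk, fibreAct_apply, coad_apply]
  show -lin Z (theta dW (lieToBase x ∘ₗ sgn V) Φ.1) = _
  -- By `lin_ctr_d` only the linear part of the cycle matters, and both sides become the same
  -- coadjoint expression.
  rw [theta_apply, map_neg, neg_neg, lin_map, lin_ctr_d hW, lin_map]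
  have h2 : lieOfBase (Z := Z) (lieToBase x ∘ₗ sgn V) = lieOfBase (lieToBase x) ∘ₗ sgn _ := by
    refine LinearMap.ext fun w => ?_
    simp only [LinearMap.comp_apply, lieOfBase_apply, sgn_lmap]
  rw [h2]

end Hurewicz

end

end SullivanRep

end

theorem proposition7 {V Z : ℕ → Type*}
    [∀ i, AddCommGroup (V i)] [∀ i, Module ℚ (V i)]
    [∀ i, AddCommGroup (Z i)] [∀ i, Module ℚ (Z i)]
    (dV : FreeCGA V →ₗ[ℚ] FreeCGA V)
    (dW : FreeCGA (fun i => V i × Z i) →ₗ[ℚ]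
      FreeCGA (fun i => V i × Z i))
    (hV : IsMinimalSullivan dV) (hW : IsMinimalSullivan dW)
    (hext : IsLambdaExtension dV dW) :
    -- the right adjoint representation, the holonomy representation and the morphism
    -- `π` exist and are unique
    (∃! adR : (UBar dW)ᵐᵒᵖ →ₐ[ℚ] Module.End ℚ (HLie Z),
      IsRightAdjoint dW adR) ∧
    (∃! hol : UBar dV →ₐ[ℚ]
        Module.End ℚ (Coh (quotDiff dW)),
      IsHolonomy dV dW hol) ∧
    (∃! π : UBar dW →ₐ[ℚ] UBar dV,
      IsCompletedProjection dV dW π) ∧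
    ∀ (adR : (UBar dW)ᵐᵒᵖ →ₐ[ℚ] Module.End ℚ (HLie Z))
      (hol : UBar dV →ₐ[ℚ]
        Module.End ℚ (Coh (quotDiff dW)))
      (π : UBar dW →ₐ[ℚ] UBar dV),
      IsRightAdjoint dW adR → IsHolonomy dV dW hol →
      IsCompletedProjection dV dW π →
      -- each term of the Sullivan lower central series of `L_Z` is a submodule
      (∀ r, 1 ≤ r → ∀ (a : UBar dW),
        ∀ y ∈ sullivanLCS (quotDiff dW) r,
          adR (MulOpposite.op a) y ∈ sullivanLCS (quotDiff dW) r) ∧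
      -- `L_W → L_V` is onto, and so is `π`, in each degree and on the total algebras
      (Function.Surjective (lieToBase (V := V) (Z := Z)) ∧ Function.Surjective π ∧
        ∀ p, (UBar.deg (d := dW) p).map π.toLinearMap =
          UBar.deg (d := dV) p) ∧
      -- the quotient right representations factor through `π`, as `ρ r`
      ∃ ρ : ∀ r, (UBar dV)ᵐᵒᵖ →ₐ[ℚ]
          Module.End ℚ (LCSQuot (quotDiff dW) r),
        (∀ r, 1 ≤ r → ∀ (a : UBar dW)
          (y : sullivanLCS (quotDiff dW) r),
          ∃ h : adR (MulOpposite.op a) y ∈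
              sullivanLCS (quotDiff dW) r,
            ρ r (MulOpposite.op (π a)) (LCSQuot.mk _ r y) =
              LCSQuot.mk _ r ⟨adR (MulOpposite.op a) y, h⟩) ∧
      -- `ξ` is induced by division by `⋀^{≥2}Z`; its dual `hur` is a morphism of right modules
        ∃ (holPos : UBar dV →ₐ[ℚ]
            Module.End ℚ (Coh.pos (quotDiff dW)))
          (holDual : (UBar dV)ᵐᵒᵖ →ₐ[ℚ] Module.End ℚ
            (Module.Dual ℚ (Coh.pos (quotDiff dW))))
          (ξ : Coh.pos (quotDiff dW) →ₗ[ℚ] (⨁ i, Z i))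
          (hur : LCSQuot (quotDiff dW) 1 →ₗ[ℚ]
            Module.Dual ℚ (Coh.pos (quotDiff dW))),
          (∀ a c, (holPos a c : Coh (quotDiff dW)) = hol a c) ∧
          IsDualRight holPos holDual ∧
          (∀ (Φ : LinearMap.ker (quotDiff dW))
            (h : Coh.mk _ Φ ∈ Coh.pos (quotDiff dW)),
            ξ ⟨Coh.mk _ Φ, h⟩ = lin Z Φ) ∧
          (∀ y : sullivanLCS (quotDiff dW) 1,
            hur (LCSQuot.mk _ 1 y) = (y : HLie Z) ∘ₗ ξ) ∧
          ∀ (a : UBar dV) (u : LCSQuot (quotDiff dW) 1),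
            hur (ρ 1 (MulOpposite.op a) u) = holDual (MulOpposite.op a) (hur u) := by
  have hZ := quotDiff_isMinimalSullivan hW hext
  have hπ₀ := isCompletedProjection_proj hW.isDer hext
  refine ⟨existsUnique_rightAdjoint hW hext, existsUnique_holonomy hV hW hext,
    ⟨_, hπ₀, fun π h => h.unique hW.isDer hπ₀⟩, fun adR hol π hadR hhol hπ => ?_⟩
  obtain rfl := hπ.unique hW.isDer hπ₀
  obtain ⟨R, hR, hRc⟩ := exists_fibreRep hW hext
  have had : ∀ a y, adR (MulOpposite.op a) y = y ∘ₗ R a := hadR.apply_eq hW hext hR hRc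
  have hsurj := proj_surjective hV.isDer hW.isDer hext
  refine ⟨fun r _ a y hy => ?_,
    ⟨lieToBase_surjective, hsurj, map_proj_deg hV.isDer hW.isDer hext⟩, ?_⟩
  · rw [had]
    exact adjoint_mem_sullivanLCS hW hext hR hRc r a hy
  choose ρ hρ using exists_layerRep hV hW hext hR hRc hπ hsurj
  obtain ⟨H, hH, hHc⟩ := exists_twistedHolonomy hV hW hext
  have hpos : ∀ a, ∀ c ∈ Coh.pos (quotDiff dW), hol a c ∈ Coh.pos (quotDiff dW) :=
    fun a c hc => mem_of_rep hhol.continuous _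
      (fun x c _ => by rw [hhol.apply_ι hW hext]; exact holAct_mem_pos hW hext x c) a hc
  have hpos' : ∀ a, ∀ c ∈ Coh.pos (quotDiff dW), H a c ∈ Coh.pos (quotDiff dW) :=
    fun a c hc => mem_of_rep hHc _
      (fun x c _ => by rw [hH]; exact neg_mem (holAct_mem_pos hW hext _ c)) a hc
  have htw : ∀ p, ∀ a ∈ UBar.deg p, ∀ c, H a c = (-1 : ℚ) ^ p • hol a c := fun p a ha c =>
    rep_eq_of_deg hV.isDer hhol.continuous hHc
      (fun p x hx => by rw [hH, hhol.apply_ι hW hext, twistedHolAct_of_deg hW hext hx]) ha c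
  -- The twisted representation on positive classes; its transpose is taken as `holDual`, and `htw`
  -- accounts for the sign `(-1)^{deg a}`.
  let Hpos := restrictRep H _ hpos'
  have hHpos : ∀ c, IsCont (evalAt Hpos c) := isCont_restrictRep hHc _ hpos'
  let ξ := cohLin hZ ∘ₗ (Coh.pos (quotDiff dW)).subtype
  -- Well defined because `L_Z^{(2)}` annihilates the first socle, where `ξ` takes its values.
  let e : LCSQuot (quotDiff dW) 1 →ₗ[ℚ] Module.Dual ℚ (Coh.pos (quotDiff dW)) :=
    Submodule.liftQ _ (ξ.dualMap ∘ₗ (sullivanLCS (quotDiff dW) 1).subtype) fun y hy =>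
      LinearMap.ext fun c => (mem_sullivanLCS_succ hZ).1 hy _ (cohLin_mem_socle hZ c.1)
  have he : ∀ y, e (LCSQuot.mk _ 1 y) = (y : HLie Z) ∘ₗ ξ := fun y => rfl
  refine ⟨ρ, fun r _ a y => ?_, restrictRep hol _ hpos, dualRep Hpos, ξ, e, fun a c => rfl,
    ⟨fun p a ha f m => ?_, fun m => ?_⟩, fun Φ h => rfl, he, fun a u => ?_⟩
  · have h := adjoint_mem_sullivanLCS hW hext hR hRc r a y.2
    rw [← had] at h
    refine ⟨h, (hρ r a y).trans (congrArg _ (Subtype.ext (had a y).symm))⟩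
  · rw [dualRep_apply, LinearMap.comp_apply, ← smul_eq_mul, ← map_smul]
    exact congrArg f (Subtype.ext (htw p a ha m))
  · obtain ⟨S, n, h⟩ := hHpos m
    refine ⟨S, n, fun a ha f => ?_⟩
    have h0 : Hpos a m = 0 := h a ha
    rw [dualRep_apply, LinearMap.comp_apply, h0, map_zero]
  · obtain ⟨b, rfl⟩ := hsurj a
    obtain ⟨y, rfl⟩ := Submodule.mkQ_surjective _ u
    have hHπ : ∀ c, IsCont (evalAt (Hpos.comp (UBar.proj hW.isDer hext)) c) := by
      intro c
      obtain ⟨S, n, h⟩ := hHpos c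
      obtain ⟨S', n', h'⟩ := hπ.continuous S n
      exact ⟨S', n', fun a ha => h _ (h' a ha)⟩
    -- The comparison is made over `UBar dW`, since `Z` itself carries no action of `UBar dV`;
    -- surjectivity of `π` makes this enough. Transposing `ξ ∘ H(π b) = R b ∘ ξ` gives the claim.
    have key := intertwine hW.isDer hHπ hRc ξ (fun x c => by
      rw [AlgHom.comp_apply, hπ.extends_lie, hR]
      refine Eq.trans ?_ (cohLin_twistedHolAct hW hext x c.1)
      rw [← hH]; rfl) b
    have h1 := congrArg e (hρ 1 b y)
    refine h1.trans ?_
    rw [he]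
    refine LinearMap.ext fun c => ?_
    exact congrArg y.1 (key c).symm
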